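/- Let $S^1\subset\mathbb C$ be the unit circle with base point $1$, let $S^2\subset\mathbb R^3$ be the unit sphere, and let $\Omega SO(3)$ be the space of continuous loops $\gamma:S^1\to SO(3)$, $t\mapsto\gamma_t$, with $\gamma_1=\mathrm{id}$, with the compact-open topology. Let $F_T$ be the trivial fibering of $S^1\times S^2$, whose fibers are the circles $S^1\times\{y\}$, $y\in S^2$. For $(\alpha,\beta,\gamma)\in O(2)\times O(3)\times\Omega SO(3)$ consider the rigid map $(x,y)\mapsto(\alpha(x),\beta(\gamma_x(y)))$ of $S^1\times S^2$, and let $SF^{rigid}$ be the set of all images of $F_T$ under rigid maps. For $\gamma\in\Omega SO(3)$ let $\Phi(\gamma)\in SF^{rigid}$ be the fibering with fibers $\{(t,\gamma_t(y)) : t\in S^1\}$, $y\in S^2$. The map $\Phi:\Omega SO(3)\to SF^{rigid}$ is a bijection, and $SF^{rigid}$ carries the topology that makes it a homeomorphism. For $p\in S^2$ let $G_p\in\Omega SO(3)$ be the Gluck loop at $p$: $(G_p)_{e^{i\theta}}$ is the rotation by the angle $\theta$ about the oriented axis through $p$. Let $s=(0,0,-1)$ be the south pole, and let $*$ be concatenation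 of loops. Let $SF^{rigid}_T$ be the connected component of $SF^{rigid}$ that contains $F_T$, and $SF^{rigid}_N$ its complement. **Theorem.** The space $SF^{rigid}_N$ is non-empty and connected, so that it is the only other connected component of $SF^{rigid}$. Moreover: 1. $p\mapsto\Phi(G_p*G_s)$ is a continuous map $S^2\to SF^{rigid}_T$, and it sends a generator of $H_2(S^2;\mathbb Z)$ to a generator of the group $H_2(SF^{rigid}_T;\mathbb Z)$. 2. $p\mapsto\Phi(G_p)$ is a continuous map $S^2\to SF^{rigid}_N$, and it sends a generator of $H_2(S^2;\mathbb Z)$ to a generator of the group $H_2(SF^{rigid}_N;\mathbb Z)$. Here $H_2$ is singular homology, and a generator of a group is an element that generates it. -/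

import Mathlib

noncomputable section

namespace RigidFiberings

/-- The unit sphere of Euclidean three-space. The circle is Mathlib's `Circle`, the unit complex
numbers, with base point `1`. -/
abbrev S2 : Type := Metric.sphere (0 : EuclideanSpace ℝ (Fin 3)) 1

/-- The orthogonal group in dimension three. -/
abbrev O3 : Type := Matrix.orthogonalGroup (Fin 3) ℝ

/-- The rotation group, with the topology of a space of matrices. -/
abbrev SO3 : Type := Matrix.specialOrthogonalGroup (Fin 3) ℝ

/-- The orthogonal group in dimension two, as the linear isometries of the real plane underlying
the complex numbers. -/
abbrev O2 : Type := ℂ ≃ₗᵢ[ℝ] ℂ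

/-- The action of a planar isometry on the circle. -/
def actCircle (α : O2) (x : Circle) : Circle :=
  ⟨α x, by
    refine mem_sphere_zero_iff_norm.2 ?_
    rw [LinearIsometryEquiv.norm_map]
    exact Circle.norm_coe x⟩

/-- An orthogonal matrix preserves the Euclidean norm. -/
theorem norm_orthogonal_mulVec {A : Matrix (Fin 3) (Fin 3) ℝ}
    (hA : A ∈ Matrix.orthogonalGroup (Fin 3) ℝ) (v : EuclideanSpace ℝ (Fin 3)) :
    ‖WithLp.toLp 2 (A.mulVec v.ofLp)‖ = ‖v‖ := by
  have h : A.transpose * A = 1 := (Matrix.mem_orthogonalGroup_iff' (Fin 3) ℝ).1 hA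
  have key : A.mulVec v.ofLp ⬝ᵥ A.mulVec v.ofLp = v.ofLp ⬝ᵥ v.ofLp := by
    rw [Matrix.dotProduct_mulVec, Matrix.vecMul_mulVec, h, Matrix.vecMul_one]
  rw [EuclideanSpace.norm_eq, EuclideanSpace.norm_eq]
  congr 1
  simpa [dotProduct, sq] using key

/-- The action of an orthogonal matrix on the two-sphere. -/
def actSphere (A : O3) (y : S2) : S2 :=
  ⟨WithLp.toLp 2 (A.1.mulVec y.1.ofLp), by
    have hy : ‖y.1‖ = 1 := by simp
    simpa [hy] using norm_orthogonal_mulVec A.2 y.1⟩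

/-- A rotation, regarded as an orthogonal matrix. -/
def SO3.toO3 (A : SO3) : O3 := ⟨A.1, A.2.1⟩

/-- The space of identity-based loops in the rotation group, with the compact-open topology. -/
abbrev LoopSO3 : Type := {γ : C(Circle, SO3) // γ 1 = 1}

/-- Concatenation of loops: run through the first loop on the upper half of the circle (that is,
for `z = exp (i θ)` with `0 ≤ θ ≤ π`), then through the second one on the lower half, each at
double speed. -/
def LoopSO3.concat (γ δ : LoopSO3) : LoopSO3 :=
  ⟨{ toFun := fun z => if 0 ≤ (z : ℂ).im then γ.1 (z ^ 2) else δ.1 (z ^ 2)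
     continuous_toFun := by
      refine Continuous.if_le (by fun_prop) (by fun_prop) continuous_const
        (Complex.continuous_im.comp continuous_subtype_val) ?_
      intro z hz
      have h1 : z ^ 2 = 1 := by
        apply Circle.ext
        have h := Circle.normSq_coe z
        rw [Complex.normSq_apply, ← hz] at h
        apply Complex.ext
        · simp [sq, ← hz]; simpa using h
        · simp [sq, ← hz]
      rw [h1, γ.2, δ.2] }, by simp [γ.2]⟩

/-- The matrix of the rotation about the oriented axis spanned by `p` through an angle with cosine
`c` and sine `s` (counterclockwise, by the right-hand rule):
`c • v + s • (p × v) + (1 - c) • ⟪p, v⟫ • p`. -/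
def rotationMatrix (p : S2) (c s : ℝ) : Matrix (Fin 3) (Fin 3) ℝ :=
  c • (1 : Matrix (Fin 3) (Fin 3) ℝ)
    + s • LinearMap.toMatrix' (crossProduct p.1.ofLp)
    + (1 - c) • Matrix.vecMulVec p.1.ofLp p.1.ofLp

/-- The coordinates of a point of the sphere. -/
theorem S2.sum_sq (p : S2) : p.1 0 ^ 2 + p.1 1 ^ 2 + p.1 2 ^ 2 = 1 := by
  have hp : ‖p.1‖ = 1 := mem_sphere_zero_iff_norm.1 p.2
  have h := EuclideanSpace.real_norm_sq_eq p.1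
  rw [hp, Fin.sum_univ_three] at h
  linarith

/-- The entries of the rotation matrix. -/
theorem rotationMatrix_eq (p : S2) (c s : ℝ) : rotationMatrix p c s =
    !![c + (1 - c) * (p.1 0 * p.1 0), -(s * p.1 2) + (1 - c) * (p.1 0 * p.1 1),
        s * p.1 1 + (1 - c) * (p.1 0 * p.1 2);
      s * p.1 2 + (1 - c) * (p.1 1 * p.1 0), c + (1 - c) * (p.1 1 * p.1 1),
        -(s * p.1 0) + (1 - c) * (p.1 1 * p.1 2);
      -(s * p.1 1) + (1 - c) * (p.1 2 * p.1 0), s * p.1 0 + (1 - c) * (p.1 2 * p.1 1),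
        c + (1 - c) * (p.1 2 * p.1 2)] := by
  ext i j
  fin_cases i <;> fin_cases j <;>
    simp [rotationMatrix, LinearMap.toMatrix'_apply, cross_apply, Matrix.vecMulVec_apply]

theorem rotationMatrix_aux {x y z c s : ℝ} (hp : x ^ 2 + y ^ 2 + z ^ 2 = 1)
    (h : c ^ 2 + s ^ 2 = 1) :
    !![c + (1 - c) * (x * x), -(s * z) + (1 - c) * (x * y), s * y + (1 - c) * (x * z);
      s * z + (1 - c) * (y * x), c + (1 - c) * (y * y), -(s * x) + (1 - c) * (y * z);
      -(s * y) + (1 - c) * (z * x), s * x + (1 - c) * (z * y), c + (1 - c) * (z * z)] ∈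
      Matrix.specialOrthogonalGroup (Fin 3) ℝ := by
  rw [Matrix.mem_specialOrthogonalGroup_iff, Matrix.mem_orthogonalGroup_iff]
  constructor
  · ext i j
    fin_cases i <;> fin_cases j <;>
      simp [Matrix.mul_apply, Fin.sum_univ_three] <;> grind
  · rw [Matrix.det_fin_three]
    simp
    grind

/-- The rotation matrix is a rotation. -/
theorem rotationMatrix_mem (p : S2) {c s : ℝ} (h : c ^ 2 + s ^ 2 = 1) :
    rotationMatrix p c s ∈ Matrix.specialOrthogonalGroup (Fin 3) ℝ := by
  rw [rotationMatrix_eq]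
  exact rotationMatrix_aux (S2.sum_sq p) h

/-- The loop of rotations of a Gluck twist: one full turn at constant speed about the oriented
axis through `p`; at the point `exp (i θ)` of the circle the angle of rotation is `θ`. -/
def gluckLoop (p : S2) : LoopSO3 :=
  ⟨{ toFun := fun z => ⟨rotationMatrix p (z : ℂ).re (z : ℂ).im, rotationMatrix_mem p (by
        have h := Circle.normSq_coe z
        rw [Complex.normSq_apply] at h
        linarith)⟩
     continuous_toFun := by
      refine Continuous.subtype_mk ?_ _
      have h1 : Continuous fun z : Circle => (z : ℂ).re :=
        Complex.continuous_re.comp continuous_subtype_val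
      have h2 : Continuous fun z : Circle => (z : ℂ).im :=
        Complex.continuous_im.comp continuous_subtype_val
      unfold rotationMatrix
      fun_prop }, by
    apply Subtype.ext
    simp [rotationMatrix]⟩

/-- The south pole. -/
def southPole : S2 := ⟨EuclideanSpace.single 2 (-1), by simp⟩

/-- A decomposition of `S¹ × S²` into subsets, given as the set of its fibers. -/
abbrev Decomposition : Type := Set (Set (Circle × S2))

/-- The trivial fibering, with fibers the circles `S¹ × {y}`. -/
def trivialDecomposition : Decomposition := {C | ∃ y : S2, C = {q | q.2 = y}}

/-- The rigid self-map `(x, y) ↦ (α x, β (γ_x y))` of `S¹ × S²`. -/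
def rigidMap (α : O2) (β : O3) (γ : LoopSO3) (q : Circle × S2) : Circle × S2 :=
  (actCircle α q.1, actSphere β (actSphere (γ.1 q.1).toO3 q.2))

/-- The image of a decomposition under a self-map: its fibers are the images of the fibers. -/
def Decomposition.map (f : Circle × S2 → Circle × S2) (F : Decomposition) : Decomposition :=
  {C | ∃ C₀ ∈ F, C = f '' C₀}

/-- The fibering of a loop `γ`: its fibers are the curves `t ↦ (t, γ_t y)`, one for each point `y`
of the sphere over the base point of the circle. -/
def loopDecomposition (γ : LoopSO3) : Decomposition :=
  {C | ∃ y : S2, C = Set.range fun t : Circle => (t, actSphere (γ.1 t).toO3 y)}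

/-- The space of rigid fiberings: the orbit of the trivial fibering under the rigid maps. -/
def SFrigid : Type :=
  {F : Decomposition // ∃ (α : O2) (β : O3) (γ : LoopSO3),
    F = trivialDecomposition.map (rigidMap α β γ)}

theorem actCircle_refl (x : Circle) : actCircle (LinearIsometryEquiv.refl ℝ ℂ) x = x := rfl

theorem actSphere_one (y : S2) : actSphere 1 y = y := by
  apply Subtype.ext
  simp [actSphere]

theorem loopDecomposition_eq (γ : LoopSO3) : loopDecomposition γ =
    trivialDecomposition.map (rigidMap (LinearIsometryEquiv.refl ℝ ℂ) 1 γ) := by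
  have key : ∀ y : S2, (Set.range fun t : Circle => (t, actSphere (γ.1 t).toO3 y)) =
      rigidMap (LinearIsometryEquiv.refl ℝ ℂ) 1 γ '' {q | q.2 = y} := by
    intro y
    ext q
    constructor
    · rintro ⟨t, rfl⟩
      exact ⟨(t, y), rfl, by simp [rigidMap, actCircle_refl, actSphere_one]⟩
    · rintro ⟨⟨t, y'⟩, rfl, rfl⟩
      exact ⟨t, by simp [rigidMap, actCircle_refl, actSphere_one]⟩
  ext C
  constructor
  · rintro ⟨y, rfl⟩
    exact ⟨_, ⟨y, rfl⟩, key y⟩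
  · rintro ⟨_, ⟨y, rfl⟩, rfl⟩
    exact ⟨y, (key y).symm⟩

/-- The map (in fact a bijection) from loops of rotations to rigid fiberings. -/
def Phi (γ : LoopSO3) : SFrigid := ⟨loopDecomposition γ, _, _, _, loopDecomposition_eq γ⟩

/-- A set of rigid fiberings is open if and only if its preimage under `Phi` is open in the
compact-open topology. -/
instance : TopologicalSpace SFrigid := TopologicalSpace.coinduced Phi inferInstance

theorem trivialDecomposition_eq : trivialDecomposition =
    loopDecomposition ⟨ContinuousMap.const Circle 1, rfl⟩ := by
  have key : ∀ y : S2, ({q | q.2 = y} : Set (Circle × S2)) = Set.range fun t : Circle =>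
      (t, actSphere (SO3.toO3 (ContinuousMap.const Circle (1 : SO3) t)) y) := by
    intro y
    have h1 : actSphere (SO3.toO3 1) y = y := actSphere_one y
    ext ⟨t, y'⟩
    simp [h1, eq_comm]
  ext C
  constructor
  · rintro ⟨y, rfl⟩
    exact ⟨y, key y⟩
  · rintro ⟨y, rfl⟩
    exact ⟨y, (key y).symm⟩

/-- The trivial fibering, as a rigid fibering. -/
def trivialFibering : SFrigid :=
  ⟨trivialDecomposition, _, _, _, trivialDecomposition_eq.trans (loopDecomposition_eq _)⟩

/-- The connected component of the trivial fibering. -/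
def SFrigidT : Set SFrigid := connectedComponent trivialFibering

/-- The rest of the space, which is the other connected component. -/
def SFrigidN : Set SFrigid := SFrigidTᶜ

/-- Second singular homology with integer coefficients. -/
abbrev H2 (X : Type) [TopologicalSpace X] : ModuleCat.{0} ℤ :=
  ((AlgebraicTopology.singularHomologyFunctor (ModuleCat.{0} ℤ) 2).obj (ModuleCat.of ℤ ℤ)).obj
    (TopCat.of X)

/-- The homomorphism of second homology groups induced by a continuous map. -/
def H2map {X Y : Type} [TopologicalSpace X] [TopologicalSpace Y] (f : C(X, Y)) :
    H2 X →ₗ[ℤ] H2 Y :=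
  (((AlgebraicTopology.singularHomologyFunctor (ModuleCat.{0} ℤ) 2).obj (ModuleCat.of ℤ ℤ)).map
    (TopCat.ofHom f)).hom

/-- The second homology of `X` is generated by the sphere `f`: there is a generator of the second
homology of the two-sphere (a fundamental class) whose image generates that of `X`. -/
def SphereGeneratesH2 {X : Type} [TopologicalSpace X] (f : C(S2, X)) : Prop :=
  ∃ σ : H2 S2, Submodule.span ℤ {σ} = ⊤ ∧ Submodule.span ℤ {H2map f σ} = ⊤

end RigidFiberings

end

open RigidFiberings

/-! `Phi` is a homeomorphism, so everything happens in ΩSO(3). Lifting along the double cover S³ →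
SO(3) turns a based loop of rotations into a path of unit quaternions from 1 to 1 or to −1. The end
point of the lift is continuous with two values, so the loops split into two clopen pieces,
homeomorphic to `PathTo 1` and `PathTo (-1)`. Both are path connected, hence they are the components
T and N.

The Gluck loop at p lifts to the meridian from 1 to −1 through p, and G_p * G_s lifts to a path
homotopic to the pointwise product of the meridians through p and s. Multiplication by the meridian
through s is a homeomorphism `PathTo (-1)` ≃ `PathTo 1`, so both homological claims reduce to
`meridian_surjective`: the meridians S² → `PathTo (-1)` are onto in H₂. Surjectivity suffices
because H₂(S²) is cyclic; neither its infinite order nor injectivity of the maps is needed.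

For surjectivity, cut the contractible space of all paths starting at 1 into the paths not ending at
1 and those not ending at −1. Geodesics trivialise the end point map over each part, with fibres
`PathTo (-1)` and `PathTo 1`; the overlap is (S³ minus ±1) × `PathTo 1`, and `clutching` is the
change of fibre. By Mayer-Vietoris, every class of `PathTo (-1)` in positive degree is the clutching
image of an overlap class whose projection to `PathTo 1` vanishes. Since S³ minus ±1 retracts to S²,
a Künneth-type splitting in low degrees moves such a class onto S² × {constant loop}, where
clutching is homotopic to the meridian map. The same argument gives path connectedness in degree 0,
and in degree 1 the vanishing of H₁ that the splitting in degree 2 requires.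

Mayer-Vietoris rests on barycentric subdivision of explicit chains, identified with Mathlib's
singular chains. Its connecting homomorphism is used only as a relation, `MVRel`. -/

noncomputable section

/-! ### Explicit singular chains and their comparison with Mathlib's complex. -/

namespace SingularChains

open CategoryTheory Simplicial

/-- The standard topological simplex of dimension `n`. -/
abbrev Simp (n : ℕ) : Type := stdSimplex ℝ (Fin (n + 1))

/-- Singular chains with integer coefficients. -/
abbrev Ch (X : Type) [TopologicalSpace X] (n : ℕ) : Type := C(Simp n, X) →₀ ℤ

/-- The inclusion of a face of the standard simplex. -/
def faceMap {n : ℕ} (i : Fin (n + 2)) : C(Simp n, Simp (n + 1)) :=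
  ⟨stdSimplex.map i.succAbove, stdSimplex.continuous_map _⟩

variable {X Y Z : Type} [TopologicalSpace X] [TopologicalSpace Y] [TopologicalSpace Z]

/-- The boundary of a singular chain. -/
def bd (n : ℕ) : Ch X (n + 1) →ₗ[ℤ] Ch X n :=
  ∑ i : Fin (n + 2), (-1 : ℤ) ^ i.val • Finsupp.lmapDomain ℤ ℤ fun σ => σ.comp (faceMap i)

/-- The push-forward of singular chains. -/
def push (f : C(X, Y)) (n : ℕ) : Ch X n →ₗ[ℤ] Ch Y n :=
  Finsupp.lmapDomain ℤ ℤ fun σ => f.comp σ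

@[simp]
theorem push_single (f : C(X, Y)) (n : ℕ) (σ : C(Simp n, X)) (a : ℤ) :
    push f n (Finsupp.single σ a) = Finsupp.single (f.comp σ) a := by
  simp [push]

theorem push_comp (g : C(Y, Z)) (f : C(X, Y)) (n : ℕ) (c : Ch X n) :
    push (g.comp f) n c = push g n (push f n c) := by
  simp only [push, Finsupp.lmapDomain_apply, ← Finsupp.mapDomain_comp]
  rfl

theorem bd_single (n : ℕ) (σ : C(Simp (n + 1), X)) (a : ℤ) :
    bd n (Finsupp.single σ a) =
      ∑ i : Fin (n + 2), (-1 : ℤ) ^ i.val • Finsupp.single (σ.comp (faceMap i)) a := by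
  simp [bd, LinearMap.sum_apply]

theorem bd_push (f : C(X, Y)) (n : ℕ) (c : Ch X (n + 1)) :
    bd n (push f (n + 1) c) = push f n (bd n c) := by
  induction c using Finsupp.induction_linear with
  | zero => simp
  | add a b ha hb => simp only [map_add, ha, hb]
  | single σ a =>
    simp only [push_single, bd_single, map_sum, map_smul]
    rfl

/-- Singular homology with integer coefficients. -/
abbrev H (n : ℕ) (X : Type) [TopologicalSpace X] : ModuleCat.{0} ℤ :=
  ((AlgebraicTopology.singularHomologyFunctor (ModuleCat.{0} ℤ) n).obj (ModuleCat.of ℤ ℤ)).obj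
    (TopCat.of X)

/-- The map of singular homology induced by a continuous map. -/
def Hmap (n : ℕ) (f : C(X, Y)) : H n X →ₗ[ℤ] H n Y :=
  (((AlgebraicTopology.singularHomologyFunctor (ModuleCat.{0} ℤ) n).obj (ModuleCat.of ℤ ℤ)).map
    (TopCat.ofHom f)).hom

theorem Hmap_comp (n : ℕ) (g : C(Y, Z)) (f : C(X, Y)) :
    Hmap n (g.comp f) = (Hmap n g).comp (Hmap n f) := by
  unfold Hmap
  rw [TopCat.ofHom_comp, Functor.map_comp]
  rfl

theorem Hmap_comp_apply (n : ℕ) (g : C(Y, Z)) (f : C(X, Y)) (x : H n X) :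
    Hmap n (g.comp f) x = Hmap n g (Hmap n f x) := by
  rw [Hmap_comp]; rfl

theorem Hmap_id (n : ℕ) (x : H n X) : Hmap n (ContinuousMap.id X) x = x := by
  unfold Hmap
  change (((AlgebraicTopology.singularHomologyFunctor (ModuleCat.{0} ℤ) n).obj
    (ModuleCat.of ℤ ℤ)).map (𝟙 (TopCat.of X))).hom x = x
  rw [CategoryTheory.Functor.map_id]
  rfl

theorem Hmap_congr (n : ℕ) {f g : C(X, Y)} (h : f.Homotopic g) : Hmap n f = Hmap n g := by
  obtain ⟨F⟩ := h
  have := TopCat.Homotopy.congr_homologyMap_singularChainComplexFunctor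
    (C := ModuleCat.{0} ℤ) (f := TopCat.ofHom f) (g := TopCat.ofHom g) F (ModuleCat.of ℤ ℤ) n
  exact congrArg ModuleCat.Hom.hom this

theorem H_subsingleton_of_totallyDisconnected [TotallyDisconnectedSpace X] {n : ℕ} (hn : n ≠ 0) :
    Subsingleton (H n X) :=
  ModuleCat.subsingleton_of_isZero
    (AlgebraicTopology.isZero_singularHomologyFunctor_of_totallyDisconnectedSpace
      (ModuleCat.{0} ℤ) n (ModuleCat.of ℤ ℤ) (TopCat.of X) hn)

variable (X) in
/-- Mathlib's singular chain complex. -/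
abbrev cplx : ChainComplex (ModuleCat.{0} ℤ) ℕ :=
  ((AlgebraicTopology.singularChainComplexFunctor (ModuleCat.{0} ℤ)).obj (ModuleCat.of ℤ ℤ)).obj
    (TopCat.of X)

variable (X) in
/-- The singular simplicial set. -/
abbrev SS : SSet.{0} := TopCat.toSSet.obj (TopCat.of X)

/-- The simplex of the singular simplicial set given by a continuous map. -/
abbrev toS {n : ℕ} (σ : C(Simp n, X)) : (SS X) _⦋n⦌ :=
  ((TopCat.of X).toSSetObjEquiv (.op ⦋n⦌)).symm σ

/-- The inclusion of the summand of a simplex. -/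
def simplexHom (n : ℕ) (σ : C(Simp n, X)) : ℤ →ₗ[ℤ] (cplx X).X n :=
  ((SS X).ιChainComplex (R := ModuleCat.of ℤ ℤ) (toS σ)).hom

variable (X) in
/-- The comparison from concrete chains to Mathlib's chains. -/
def toCplx (n : ℕ) : Ch X n →ₗ[ℤ] (cplx X).X n :=
  Finsupp.lsum ℕ (simplexHom n)

theorem toCplx_single (n : ℕ) (σ : C(Simp n, X)) (a : ℤ) :
    toCplx X n (Finsupp.single σ a) =
      ((SS X).ιChainComplex (R := ModuleCat.of ℤ ℤ) (toS σ)).hom a :=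
   Finsupp.lsum_single ℕ (simplexHom n) σ a

variable (X) in
/-- The inverse of the comparison map. -/
def ofCplx (n : ℕ) : (cplx X).X n ⟶ ModuleCat.of ℤ (Ch X n) :=
  Limits.Cofan.IsColimit.desc
    (SSet.isColimitChainComplexXCofan (SS X) (ModuleCat.of ℤ ℤ) n)
    fun x => ModuleCat.ofHom (Finsupp.lsingle ((TopCat.of X).toSSetObjEquiv (.op ⦋n⦌) x))

theorem ι_ofCplx (n : ℕ) (x : (SS X) _⦋n⦌) :
    (SS X).ιChainComplex x ≫ ofCplx X n =
      ModuleCat.ofHom (Finsupp.lsingle ((TopCat.of X).toSSetObjEquiv (.op ⦋n⦌) x)) :=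
  Limits.Cofan.IsColimit.fac
    (SSet.isColimitChainComplexXCofan (SS X) (ModuleCat.of ℤ ℤ) n) _ x

theorem ofCplx_toCplx (n : ℕ) (c : Ch X n) : (ofCplx X n).hom (toCplx X n c) = c := by
  induction c using Finsupp.induction_linear with
  | zero => simp
  | add a b ha hb => simp only [map_add, ha, hb]
  | single σ a =>
    rw [toCplx_single]
    have := congrArg (fun f => f.hom a) (ι_ofCplx n (toS σ))
    exact this

theorem toCplx_ofCplx (n : ℕ) (c : (cplx X).X n) : toCplx X n ((ofCplx X n).hom c) = c := by
  have : ofCplx X n ≫ ModuleCat.ofHom (toCplx X n) = 𝟙 _ := by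
    refine SSet.chainComplex_hom_ext fun x => ?_
    refine (congrArg (· ≫ ModuleCat.ofHom (toCplx X n)) (ι_ofCplx n x)).trans ?_
    ext
    exact toCplx_single n ((TopCat.of X).toSSetObjEquiv (.op ⦋n⦌) x) 1
  exact congrArg (fun f => f.hom c) this

variable (X) in
/-- Concrete chains are the chains of Mathlib's singular chain complex. -/
def chainEquiv (n : ℕ) : Ch X n ≃ₗ[ℤ] (cplx X).X n :=
  { toCplx X n with
    invFun := (ofCplx X n).hom
    left_inv := ofCplx_toCplx n
    right_inv := toCplx_ofCplx n }

theorem chainEquiv_single (n : ℕ) (σ : C(Simp n, X)) (a : ℤ) :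
    chainEquiv X n (Finsupp.single σ a) =
      ((SS X).ιChainComplex (R := ModuleCat.of ℤ ℤ) (toS σ)).hom a :=
  toCplx_single n σ a

theorem d_chainEquiv (n : ℕ) (c : Ch X (n + 1)) :
    ((cplx X).d (n + 1) n).hom (chainEquiv X (n + 1) c) = chainEquiv X n (bd n c) := by
  induction c using Finsupp.induction_linear with
  | zero => simp
  | add a b ha hb => simp only [map_add, ha, hb]
  | single σ a =>
    rw [chainEquiv_single]
    have := congrArg (fun f => f.hom a)
      (SSet.ιChainComplex_d (R := ModuleCat.of ℤ ℤ) (SS X) (toS σ))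
    refine this.trans ?_
    rw [bd_single]
    simp only [map_sum, ModuleCat.hom_sum, LinearMap.sum_apply]
    refine Finset.sum_congr rfl fun i _ => ?_
    rcases neg_one_pow_eq_or ℤ i.val with h | h
    · simp only [h, one_smul]
      exact (chainEquiv_single n (σ.comp (faceMap i)) a).symm
    · simp only [h, neg_smul, one_smul, map_neg]
      exact congrArg Neg.neg (chainEquiv_single n (σ.comp (faceMap i)) a).symm

theorem map_chainEquiv (f : C(X, Y)) (n : ℕ) (c : Ch X n) :
    ((((AlgebraicTopology.singularChainComplexFunctor (ModuleCat.{0} ℤ)).obj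
      (ModuleCat.of ℤ ℤ)).map (TopCat.ofHom f)).f n).hom (chainEquiv X n c) =
      chainEquiv Y n (push f n c) := by
  induction c using Finsupp.induction_linear with
  | zero => simp
  | add a b ha hb => simp only [map_add, ha, hb]
  | single σ a =>
    rw [push_single, chainEquiv_single, chainEquiv_single]
    exact congrArg (fun f => f.hom a)
      (SSet.ι_chainComplexMap_f (SS X) (SS Y) (TopCat.toSSet.map (TopCat.ofHom f)) (ModuleCat.of ℤ ℤ) (toS σ))

variable (X) in
/-- The cycles among the concrete chains. -/
def cyc (n : ℕ) : Submodule ℤ (Ch X n) :=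
  match n with
  | 0 => ⊤
  | n + 1 => LinearMap.ker (bd n)

/-- Transported from Mathlib's complex through `chainEquiv`, so no sum over pairs of faces has to be
cancelled. -/
theorem bd_bd (n : ℕ) (c : Ch X (n + 2)) : bd n (bd (n + 1) c) = 0 := by
  apply (chainEquiv X n).injective
  rw [← d_chainEquiv, ← d_chainEquiv, map_zero]
  exact congrArg (fun f => f.hom (chainEquiv X (n + 2) c)) ((cplx X).d_comp_d (n + 2) (n + 1) n)

theorem bd_mem_cyc (n : ℕ) (c : Ch X (n + 1)) : bd n c ∈ cyc X n := by
  cases n with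
  | zero => trivial
  | succ n => exact bd_bd n c

theorem push_mem_cyc (f : C(X, Y)) {n : ℕ} {c : Ch X n} (hc : c ∈ cyc X n) :
    push f n c ∈ cyc Y n := by
  cases n with
  | zero => trivial
  | succ n =>
    change bd n _ = 0
    rw [bd_push, show bd n c = 0 from hc, map_zero]

theorem mem_cyc_iff {n : ℕ} {c : Ch X n} :
    c ∈ cyc X n ↔ ((cplx X).sc n).g.hom (chainEquiv X n c) = 0 := by
  cases n with
  | zero =>
    refine ⟨fun _ => ?_, fun _ => trivial⟩
    have : ((cplx X).sc 0).g = 0 := (cplx X).shape _ _ (by simp)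
    rw [this]; rfl
  | succ n =>
    -- The index of the next term of the complex equals `n` only propositionally; a free `j` avoids
    -- casts.
    have key : ∀ j, j = n → (((cplx X).d (n + 1) j).hom (chainEquiv X (n + 1) c) = 0 ↔
        bd n c = 0) := by
      rintro j rfl
      rw [d_chainEquiv]
      exact (chainEquiv X j).map_eq_zero_iff
    exact (key _ (ChainComplex.next_nat_succ n)).symm

theorem mem_boundaries_iff {n : ℕ} {c : Ch X n} :
    (∃ e, bd n e = c) ↔ chainEquiv X n c ∈ LinearMap.range ((cplx X).sc n).f.hom := by
  have key : ∀ j, j = n + 1 → ((∃ e, bd n e = c) ↔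
      chainEquiv X n c ∈ LinearMap.range ((cplx X).d j n).hom) := by
    rintro j rfl
    constructor
    · rintro ⟨e, rfl⟩
      exact ⟨chainEquiv X _ e, d_chainEquiv n e⟩
    · rintro ⟨e, he⟩
      refine ⟨(chainEquiv X _).symm e, (chainEquiv X n).injective ?_⟩
      rw [← d_chainEquiv, LinearEquiv.apply_symm_apply]
      exact he
  exact key _ (ChainComplex.prev ℕ n)

variable (X) in
/-- The homology class of a cycle. -/
def cls (n : ℕ) : cyc X n →ₗ[ℤ] H n X :=
  ((cplx X).homologyπ n).hom ∘ₗ ((cplx X).sc n).moduleCatCyclesIso.inv.hom ∘ₗ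
    ((chainEquiv X n).toLinearMap ∘ₗ (cyc X n).subtype).codRestrict
      (LinearMap.ker ((cplx X).sc n).g.hom) fun c => mem_cyc_iff.1 c.2

theorem iCycles_cls_aux (n : ℕ) (z : cyc X n) :
    ((cplx X).iCycles n).hom (((cplx X).sc n).moduleCatCyclesIso.inv.hom
      (((chainEquiv X n).toLinearMap ∘ₗ (cyc X n).subtype).codRestrict
        (LinearMap.ker ((cplx X).sc n).g.hom) (fun c => mem_cyc_iff.1 c.2) z)) =
      chainEquiv X n z :=
  congrArg (fun f => f.hom
    (((chainEquiv X n).toLinearMap ∘ₗ (cyc X n).subtype).codRestrict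
        (LinearMap.ker ((cplx X).sc n).g.hom) (fun c => mem_cyc_iff.1 c.2) z))
    ((cplx X).sc n).moduleCatCyclesIso_inv_iCycles

/-- Together with `cls_eq_zero_iff` and `Hmap_cls` this makes homology explicit: cycles modulo
boundaries, with push-forward of representatives. -/
theorem cls_surjective (n : ℕ) : Function.Surjective (cls X n) := by
  intro h
  obtain ⟨y, rfl⟩ := (ModuleCat.epi_iff_surjective ((cplx X).homologyπ n)).1 inferInstance h
  have hy : ((cplx X).sc n).g.hom (((cplx X).iCycles n).hom y) = 0 :=
    congrArg (fun f => f.hom y) ((cplx X).sc n).iCycles_g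
  refine ⟨⟨(chainEquiv X n).symm (((cplx X).iCycles n).hom y), mem_cyc_iff.2 (by
    rw [LinearEquiv.apply_symm_apply]; exact hy)⟩, ?_⟩
  change ((cplx X).homologyπ n).hom _ = ((cplx X).homologyπ n).hom y
  congr 1
  apply (ModuleCat.mono_iff_injective ((cplx X).iCycles n)).1 inferInstance
  exact (iCycles_cls_aux n _).trans (LinearEquiv.apply_symm_apply _ _)

/-- Homology embeds in the chains modulo boundaries by `homologyι`, and the class of a cycle goes
there to the class of its underlying chain. -/
theorem cls_eq_zero_iff {n : ℕ} {z : cyc X n} : cls X n z = 0 ↔ ∃ e, bd n e = z.1 := by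
  refine Iff.trans ?_ (mem_boundaries_iff (c := z.1)).symm
  refine Iff.trans ?_ (((cplx X).sc n).moduleCat_pOpcycles_eq_zero_iff (chainEquiv X n z.1))
  have h1 := congrArg (fun f => f.hom (((cplx X).sc n).moduleCatCyclesIso.inv.hom
      (((chainEquiv X n).toLinearMap ∘ₗ (cyc X n).subtype).codRestrict
        (LinearMap.ker ((cplx X).sc n).g.hom) (fun c => mem_cyc_iff.1 c.2) z)))
    ((cplx X).homology_π_ι n)
  have h2 : ((cplx X).homologyι n).hom (cls X n z) =
      ((cplx X).sc n).pOpcycles.hom (chainEquiv X n z) := by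
    rw [← iCycles_cls_aux]
    exact h1
  have h3 := (ModuleCat.mono_iff_injective ((cplx X).homologyι n)).1 inferInstance
  change _ ↔ ((cplx X).sc n).pOpcycles.hom (chainEquiv X n z) = 0
  rw [← h2]
  exact (map_eq_zero_iff ((cplx X).homologyι n).hom h3).symm

theorem Hmap_cls (f : C(X, Y)) {n : ℕ} (z : cyc X n) :
    Hmap n f (cls X n z) = cls Y n ⟨push f n z.1, push_mem_cyc f z.2⟩ := by
  let φ := ((AlgebraicTopology.singularChainComplexFunctor (ModuleCat.{0} ℤ)).obj
      (ModuleCat.of ℤ ℤ)).map (TopCat.ofHom f)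
  have h1 := fun y => congrArg (fun g => g.hom y) (HomologicalComplex.homologyπ_naturality φ n)
  refine (h1 _).trans ?_
  change ((cplx Y).homologyπ n).hom _ = ((cplx Y).homologyπ n).hom _
  congr 1
  apply (ModuleCat.mono_iff_injective ((cplx Y).iCycles n)).1 inferInstance
  refine Eq.trans ?_ (iCycles_cls_aux n _).symm
  have h2 := fun y => congrArg (fun g => g.hom y) (HomologicalComplex.cyclesMap_i φ n)
  refine (h2 _).trans ?_
  refine Eq.trans ?_ (map_chainEquiv f n z.1)
  exact congrArg (φ.f n).hom (iCycles_cls_aux n z)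

end SingularChains

end

noncomputable section

namespace SingularChains

/-! ### Chains of ordered tuples and their barycentric subdivision -/

/-- Chains on ordered tuples of points. -/
abbrev TC (P : Type) (k : ℕ) : Type := (Fin (k + 1) → P) →₀ ℤ

section Tuples

variable {P Q : Type}

/-- The boundary of a chain of tuples. -/
def bdT (k : ℕ) : TC P (k + 1) →ₗ[ℤ] TC P k :=
  ∑ i : Fin (k + 2), (-1 : ℤ) ^ i.val • Finsupp.lmapDomain ℤ ℤ fun v => v ∘ i.succAbove

theorem bdT_single (k : ℕ) (v : Fin (k + 2) → P) (a : ℤ) :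
    bdT k (Finsupp.single v a) =
      ∑ i : Fin (k + 2), (-1 : ℤ) ^ i.val • Finsupp.single (v ∘ i.succAbove) a := by
  simp [bdT, LinearMap.sum_apply]

/-- The cone with apex `b`. -/
def cone (b : P) (k : ℕ) : TC P k →ₗ[ℤ] TC P (k + 1) :=
  Finsupp.lmapDomain ℤ ℤ fun v => (Fin.cons b v : Fin (k + 2) → P)

@[simp]
theorem cone_single (b : P) (k : ℕ) (v : Fin (k + 1) → P) (a : ℤ) :
    cone b k (Finsupp.single v a) = Finsupp.single (Fin.cons b v : Fin (k + 2) → P) a := by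
  simp [cone]

/-- The augmentation of zero-chains of tuples. -/
def augT : TC P 0 →ₗ[ℤ] ℤ := Finsupp.linearCombination ℤ fun _ => 1

theorem cons_comp_succ_succAbove {k : ℕ} (b : P) (v : Fin (k + 2) → P) (i : Fin (k + 2)) :
    (Fin.cons b v : Fin (k + 3) → P) ∘ i.succ.succAbove =
      (Fin.cons b (v ∘ i.succAbove) : Fin (k + 2) → P) := by
  ext j
  refine Fin.cases ?_ (fun j => ?_) j
  · simp
  · simp

/-- Omitting the apex returns `c`; omitting any other vertex gives the cone on a face, with the sign
shifted by one. -/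
theorem bdT_cone (b : P) (k : ℕ) (c : TC P (k + 1)) :
    bdT (k + 1) (cone b (k + 1) c) = c - cone b k (bdT k c) := by
  induction c using Finsupp.induction_linear with
  | zero => simp
  | add x y hx hy => simp only [map_add, hx, hy]; abel
  | single v a =>
    rw [cone_single, bdT_single, Fin.sum_univ_succ, bdT_single, map_sum]
    have h0 : (Fin.cons b v : Fin (k + 3) → P) ∘ (0 : Fin (k + 3)).succAbove = v := by
      ext j; simp
    simp only [cons_comp_succ_succAbove, map_smul, cone_single, h0, Fin.val_zero, pow_zero,
      one_smul, Fin.val_succ, pow_succ, mul_neg, mul_one, neg_smul, Finset.sum_neg_distrib]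
    abel

theorem bdT_cone_zero (b : P) (c : TC P 0) :
    bdT 0 (cone b 0 c) = c - augT c • Finsupp.single (fun _ => b) 1 := by
  induction c using Finsupp.induction_linear with
  | zero => simp
  | add x y hx hy => simp only [map_add, hx, hy, add_smul]; abel
  | single v a =>
    rw [cone_single, bdT_single, Fin.sum_univ_two]
    have h0 : (Fin.cons b v : Fin 2 → P) ∘ (0 : Fin 2).succAbove = v := by
      ext j; simp
    have h1 : (Fin.cons b v : Fin 2 → P) ∘ (1 : Fin 2).succAbove = fun _ => b := by
      ext j; fin_cases j; rfl
    rw [h0, h1]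
    simp [augT, sub_eq_add_neg]

theorem augT_bdT (c : TC P 1) : augT (bdT 0 c) = 0 := by
  induction c using Finsupp.induction_linear with
  | zero => simp
  | add x y hx hy => simp only [map_add, hx, hy, add_zero]
  | single v a =>
    rw [bdT_single, Fin.sum_univ_two]
    simp [augT]

/-- Every tuple is the cone on its tail, so the cone formula gives an induction on the degree. -/
theorem bdT_bdT (k : ℕ) (c : TC P (k + 2)) : bdT k (bdT (k + 1) c) = 0 := by
  induction k with
  | zero =>
    induction c using Finsupp.induction_linear with
    | zero => simp
    | add x y hx hy => simp only [map_add, hx, hy, add_zero]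
    | single v a =>
      rw [← Fin.cons_self_tail v, ← cone_single, bdT_cone, map_sub, bdT_cone_zero, augT_bdT]
      simp
  | succ k ih =>
    induction c using Finsupp.induction_linear with
    | zero => simp
    | add x y hx hy => simp only [map_add, hx, hy, add_zero]
    | single v a =>
      rw [← Fin.cons_self_tail v, ← cone_single, bdT_cone, map_sub, bdT_cone, ih]
      simp

variable (β : ∀ k, (Fin (k + 1) → P) → P) (β' : ∀ k, (Fin (k + 1) → Q) → Q)

/-- Barycentric subdivision of chains of tuples. -/
def subdiv : ∀ k, TC P k →ₗ[ℤ] TC P k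
  | 0 => LinearMap.id
  | k + 1 => Finsupp.linearCombination ℤ fun v =>
      cone (β (k + 1) v) k (subdiv k (bdT k (Finsupp.single v 1)))

/-- The chain homotopy between the identity and barycentric subdivision. -/
def subdivHtpy : ∀ k, TC P k →ₗ[ℤ] TC P (k + 1)
  | 0 => 0
  | k + 1 => Finsupp.linearCombination ℤ fun v =>
      cone (β (k + 1) v) (k + 1)
        (Finsupp.single v 1 - subdivHtpy k (bdT k (Finsupp.single v 1)))

theorem subdiv_single (k : ℕ) (v : Fin (k + 2) → P) :
    subdiv β (k + 1) (Finsupp.single v 1) =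
      cone (β (k + 1) v) k (subdiv β k (bdT k (Finsupp.single v 1))) := by
  simp [subdiv]

theorem subdivHtpy_single (k : ℕ) (v : Fin (k + 2) → P) :
    subdivHtpy β (k + 1) (Finsupp.single v 1) = cone (β (k + 1) v) (k + 1)
        (Finsupp.single v 1 - subdivHtpy β k (bdT k (Finsupp.single v 1))) := by
  simp [subdivHtpy]

theorem linearMap_ext_single {α M : Type*} [AddCommGroup M] {f g : (α →₀ ℤ) →ₗ[ℤ] M}
    (h : ∀ a, f (Finsupp.single a 1) = g (Finsupp.single a 1)) : f = g := by
  ext a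
  exact h a

/-- The cone formula leaves the subdivided boundary minus a cone on its boundary; that last boundary
vanishes by induction and `bdT_bdT`, or by the augmentation in degree 0. -/
theorem bdT_subdiv (k : ℕ) (c : TC P (k + 1)) :
    bdT k (subdiv β (k + 1) c) = subdiv β k (bdT k c) := by
  suffices h : bdT k ∘ₗ subdiv β (k + 1) = subdiv β k ∘ₗ bdT k from LinearMap.congr_fun h c
  refine linearMap_ext_single fun v => ?_
  simp only [LinearMap.comp_apply, subdiv_single]
  clear c
  induction k with
  | zero => rw [bdT_cone_zero]; simp [subdiv, augT_bdT]
  | succ k ih =>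
    rw [bdT_cone]
    have ih' : bdT k ∘ₗ subdiv β (k + 1) = subdiv β k ∘ₗ bdT k :=
      linearMap_ext_single fun v => by
        simp only [LinearMap.comp_apply, subdiv_single]; exact ih v
    have := LinearMap.congr_fun ih' (bdT (k + 1) (Finsupp.single v 1))
    simp only [LinearMap.comp_apply] at this
    rw [this, bdT_bdT]
    simp

theorem bdT_subdivHtpy_zero (c : TC P 0) :
    bdT 0 (subdivHtpy β 0 c) = c - subdiv β 0 c := by
  simp [subdivHtpy, subdiv]

theorem bdT_subdivHtpy (k : ℕ) (c : TC P (k + 1)) :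
    bdT (k + 1) (subdivHtpy β (k + 1) c) =
      c - subdiv β (k + 1) c - subdivHtpy β k (bdT k c) := by
  suffices h : bdT (k + 1) ∘ₗ subdivHtpy β (k + 1) =
      LinearMap.id - subdiv β (k + 1) - subdivHtpy β k ∘ₗ bdT k from LinearMap.congr_fun h c
  refine linearMap_ext_single fun v => ?_
  simp only [LinearMap.comp_apply, LinearMap.sub_apply, LinearMap.id_apply, subdiv_single,
    subdivHtpy_single, bdT_cone]
  have key : bdT k (subdivHtpy β k (bdT k (Finsupp.single v 1))) =
      bdT k (Finsupp.single v 1) - subdiv β k (bdT k (Finsupp.single v 1)) := by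
    clear c
    induction k with
    | zero => exact bdT_subdivHtpy_zero β _
    | succ k ih =>
      have ih' : bdT (k + 1) ∘ₗ subdivHtpy β (k + 1) =
          LinearMap.id - subdiv β (k + 1) - subdivHtpy β k ∘ₗ bdT k :=
        linearMap_ext_single fun v => by
          simp only [LinearMap.comp_apply, LinearMap.sub_apply, LinearMap.id_apply, subdiv_single,
            subdivHtpy_single, bdT_cone, map_sub, ih v]
          abel
      have := LinearMap.congr_fun ih' (bdT (k + 1) (Finsupp.single v 1))
      simpa [bdT_bdT] using this
  rw [map_sub, key]
  simp only [map_sub]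
  abel

/-- The map of chains of tuples induced by a map of points. -/
def mapT (f : P → Q) (k : ℕ) : TC P k →ₗ[ℤ] TC Q k :=
  Finsupp.lmapDomain ℤ ℤ fun v => f ∘ v

@[simp]
theorem mapT_single (f : P → Q) (k : ℕ) (v : Fin (k + 1) → P) (a : ℤ) :
    mapT f k (Finsupp.single v a) = Finsupp.single (f ∘ v) a := by
  simp [mapT]

theorem mapT_cone (f : P → Q) (b : P) (k : ℕ) (c : TC P k) :
    mapT f (k + 1) (cone b k c) = cone (f b) k (mapT f k c) := by
  induction c using Finsupp.induction_linear with
  | zero => simp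
  | add x y hx hy => simp only [map_add, hx, hy]
  | single v a =>
    simp only [cone_single, mapT_single]
    congr 1
    ext j
    refine Fin.cases ?_ (fun j => ?_) j <;> simp

theorem bdT_mapT (f : P → Q) (k : ℕ) (c : TC P (k + 1)) :
    bdT k (mapT f (k + 1) c) = mapT f k (bdT k c) := by
  induction c using Finsupp.induction_linear with
  | zero => simp
  | add x y hx hy => simp only [map_add, hx, hy]
  | single v a =>
    simp only [mapT_single, bdT_single, map_sum, map_smul]
    rfl

variable {β β'}

/-- Subdivision only uses the choice of apices, so any map that respects these choices commutes with
it. For affine maps this is `aff_bary`. -/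
theorem subdiv_mapT {f : P → Q} (hf : ∀ k v, f (β k v) = β' k (f ∘ v)) (k : ℕ) (c : TC P k) :
    subdiv β' k (mapT f k c) = mapT f k (subdiv β k c) := by
  induction k with
  | zero => rfl
  | succ k ih =>
    suffices h : subdiv β' (k + 1) ∘ₗ mapT f (k + 1) = mapT f (k + 1) ∘ₗ subdiv β (k + 1) from
      LinearMap.congr_fun h c
    refine linearMap_ext_single fun v => ?_
    simp only [LinearMap.comp_apply, mapT_single, subdiv_single, mapT_cone, hf, ← ih, ← bdT_mapT]

theorem subdivHtpy_mapT {f : P → Q} (hf : ∀ k v, f (β k v) = β' k (f ∘ v)) (k : ℕ)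
    (c : TC P k) : subdivHtpy β' k (mapT f k c) = mapT f (k + 1) (subdivHtpy β k c) := by
  induction k with
  | zero => simp [subdivHtpy]
  | succ k ih =>
    suffices h : subdivHtpy β' (k + 1) ∘ₗ mapT f (k + 1) =
        mapT f (k + 2) ∘ₗ subdivHtpy β (k + 1) from LinearMap.congr_fun h c
    refine linearMap_ext_single fun v => ?_
    simp only [LinearMap.comp_apply, mapT_single, subdivHtpy_single, mapT_cone, hf, map_sub,
      ← ih, ← bdT_mapT]

theorem linearMap_mem_of_supported {α M : Type*} [AddCommGroup M] (f : (α →₀ ℤ) →ₗ[ℤ] M)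
    {s : Set α} {N : Submodule ℤ M} (h : ∀ a ∈ s, f (Finsupp.single a 1) ∈ N) {c : α →₀ ℤ}
    (hc : c ∈ Finsupp.supported ℤ ℤ s) : f c ∈ N := by
  rw [Finsupp.supported_eq_span_single] at hc
  have : Submodule.span ℤ ((fun i => Finsupp.single i (1 : ℤ)) '' s) ≤ N.comap f := by
    rw [Submodule.span_le]
    rintro _ ⟨a, ha, rfl⟩
    exact h a ha
  exact this hc

variable [PseudoMetricSpace P]

/-- Besides the mesh bound, the induction carries the fact that new vertices lie in every closed
ball containing the old ones. This bounds the distance from the new barycentre to the vertices of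
the subdivided faces. -/
theorem subdiv_mem_supported
    (h1 : ∀ k v x R, (∀ i, dist x (v i) ≤ R) → dist x (β k v) ≤ R)
    (h2 : ∀ k v D, (∀ i j, dist (v i) (v j) ≤ D) →
      ∀ i, dist (β k v) (v i) ≤ (k : ℝ) / (k + 1) * D)
    (k : ℕ) (v : Fin (k + 1) → P) (D : ℝ) (hv : ∀ i j, dist (v i) (v j) ≤ D) :
    subdiv β k (Finsupp.single v 1) ∈ Finsupp.supported ℤ ℤ
      {w : Fin (k + 1) → P | (∀ i j, dist (w i) (w j) ≤ (k : ℝ) / (k + 1) * D) ∧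
        ∀ x R, (∀ i, dist x (v i) ≤ R) → ∀ j, dist x (w j) ≤ R} := by
  have hD : 0 ≤ D := dist_nonneg.trans (hv 0 0)
  induction k with
  | zero =>
    refine Finsupp.single_mem_supported ℤ _ ⟨fun i j => ?_, fun x R h => h⟩
    rw [show i = j from Fin.ext (by omega)]
    simp
  | succ k ih =>
    rw [subdiv_single, bdT_single, map_sum, map_sum]
    refine Submodule.sum_mem _ fun i _ => ?_
    rw [map_smul, map_smul]
    refine Submodule.smul_mem _ _ ?_
    refine linearMap_mem_of_supported (cone (β (k + 1) v) k) (fun w hw => ?_)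
      (ih (v ∘ i.succAbove) (fun a b => hv _ _))
    obtain ⟨hw1, hw2⟩ := hw
    rw [cone_single]
    refine Finsupp.single_mem_supported ℤ _ ⟨?_, ?_⟩
    · have hβ : ∀ j, dist (β (k + 1) v) (w j) ≤ ((k + 1 : ℕ) : ℝ) / ((k + 1 : ℕ) + 1) * D :=
        hw2 _ _ fun a => h2 (k + 1) v D hv _
      have hle : (k : ℝ) / (k + 1) * D ≤ ((k + 1 : ℕ) : ℝ) / ((k + 1 : ℕ) + 1) * D := by
        refine mul_le_mul_of_nonneg_right ?_ hD
        push_cast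
        rw [div_le_div_iff₀ (by positivity) (by positivity)]
        nlinarith
      intro a b
      refine Fin.cases ?_ (fun a => ?_) a <;> refine Fin.cases ?_ (fun b => ?_) b
      · simp only [Fin.cons_zero, dist_self]
        positivity
      · simpa using hβ b
      · simpa [dist_comm] using hβ a
      · simpa using (hw1 a b).trans hle
    · intro x R hx j
      refine Fin.cases ?_ (fun j => ?_) j
      · simpa using h1 (k + 1) v x R hx
      · simpa using hw2 x R (fun a => hx _) j

theorem subdiv_iterate_mem_supported
    (h1 : ∀ k v x R, (∀ i, dist x (v i) ≤ R) → dist x (β k v) ≤ R)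
    (h2 : ∀ k v D, (∀ i j, dist (v i) (v j) ≤ D) →
      ∀ i, dist (β k v) (v i) ≤ (k : ℝ) / (k + 1) * D)
    (k : ℕ) (D : ℝ) (m : ℕ) (c : TC P k)
    (hc : c ∈ Finsupp.supported ℤ ℤ {w : Fin (k + 1) → P | ∀ i j, dist (w i) (w j) ≤ D}) :
    (subdiv β k)^[m] c ∈ Finsupp.supported ℤ ℤ
      {w : Fin (k + 1) → P | ∀ i j, dist (w i) (w j) ≤ ((k : ℝ) / (k + 1)) ^ m * D} := by
  induction m with
  | zero => simpa using hc
  | succ m ih =>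
    rw [Function.iterate_succ_apply']
    refine linearMap_mem_of_supported _ (fun v hv => ?_) ih
    refine Finsupp.supported_mono ?_ (subdiv_mem_supported h1 h2 k v _ hv)
    intro w hw i j
    refine (hw.1 i j).trans (le_of_eq ?_)
    ring

end Tuples

/-! ### Affine simplices -/

theorem Simp.aff_mem {n k : ℕ} (v : Fin (k + 1) → Simp n) (t : Simp k) :
    (fun j => ∑ i, t i * v i j) ∈ stdSimplex ℝ (Fin (n + 1)) := by
  refine ⟨fun j => Finset.sum_nonneg fun i _ =>
    mul_nonneg (stdSimplex.zero_le t i) (stdSimplex.zero_le (v i) j), ?_⟩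
  rw [Finset.sum_comm]
  simp [← Finset.mul_sum]

/-- The affine simplex with given vertices. -/
def aff {n k : ℕ} (v : Fin (k + 1) → Simp n) : C(Simp k, Simp n) :=
  ⟨fun t => ⟨fun j => ∑ i, t i * v i j, Simp.aff_mem v t⟩, by
    refine Continuous.subtype_mk (continuous_pi fun j => continuous_finsetSum _ fun i _ => ?_) _
    exact ((continuous_apply i).comp continuous_subtype_val).mul continuous_const⟩

theorem aff_apply {n k : ℕ} (v : Fin (k + 1) → Simp n) (t : Simp k) (j : Fin (n + 1)) :
    aff v t j = ∑ i, t i * v i j := rfl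

/-- The vertices of the standard simplex. -/
def vtx (n : ℕ) (i : Fin (n + 1)) : Simp n := ⟨Pi.single i 1, single_mem_stdSimplex ℝ i⟩

theorem vtx_apply (n : ℕ) (i j : Fin (n + 1)) : vtx n i j = if j = i then 1 else 0 := by
  change (Pi.single i 1 : Fin (n + 1) → ℝ) j = _
  rw [Pi.single_apply]

theorem aff_vtx (n : ℕ) : aff (vtx n) = ContinuousMap.id _ := by
  ext t j
  change ∑ i, t i * vtx n i j = t j
  simp [vtx_apply]

theorem aff_apply_vtx {n k : ℕ} (v : Fin (k + 1) → Simp n) (i : Fin (k + 1)) :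
    aff v (vtx k i) = v i := by
  ext j
  simp [aff_apply, vtx_apply]

theorem aff_comp_aff {n k l : ℕ} (v : Fin (k + 1) → Simp n) (w : Fin (l + 1) → Simp k) :
    (aff v).comp (aff w) = aff (aff v ∘ w) := by
  ext t j
  change ∑ i, (∑ a, t a * w a i) * v i j = ∑ a, t a * ∑ i, w a i * v i j
  simp only [Finset.sum_mul, Finset.mul_sum, mul_assoc]
  exact Finset.sum_comm

theorem faceMap_eq_aff {n : ℕ} (i : Fin (n + 2)) :
    faceMap i = aff (vtx (n + 1) ∘ i.succAbove) := by
  ext t j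
  change FunOnFinite.linearMap ℝ ℝ i.succAbove t j = ∑ a, t a * vtx (n + 1) (i.succAbove a) j
  rw [FunOnFinite.linearMap_apply_apply, Finset.sum_filter]
  simp [vtx_apply, eq_comm]

theorem aff_comp_faceMap {n k : ℕ} (v : Fin (k + 2) → Simp n) (i : Fin (k + 2)) :
    (aff v).comp (faceMap i) = aff (v ∘ i.succAbove) := by
  rw [faceMap_eq_aff, aff_comp_aff]
  congr 1
  ext a : 1
  exact aff_apply_vtx v _

/-- The centre of the standard simplex. -/
def centre (k : ℕ) : Simp k := ⟨fun _ => 1 / (k + 1), fun _ => by positivity, by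
  simp; field_simp⟩

/-- The barycentre of the vertices of an affine simplex. -/
def bary (n k : ℕ) (v : Fin (k + 1) → Simp n) : Simp n := aff v (centre k)

theorem aff_bary {n m k : ℕ} (f : Fin (n + 1) → Simp m) (v : Fin (k + 1) → Simp n) :
    aff f (bary n k v) = bary m k (aff f ∘ v) := by
  rw [bary, bary, ← aff_comp_aff]; rfl

theorem Simp.dist_le_iff {n : ℕ} {x y : Simp n} {R : ℝ} (hR : 0 ≤ R) :
    dist x y ≤ R ↔ ∀ j, |x j - y j| ≤ R :=
  dist_pi_le_iff hR

/-- Balls are convex; the distance here is the sup distance of coordinates. -/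
theorem dist_aff_le {n k : ℕ} (v : Fin (k + 1) → Simp n) (t : Simp k) (x : Simp n) (R : ℝ)
    (h : ∀ i, dist x (v i) ≤ R) : dist x (aff v t) ≤ R := by
  have hR : 0 ≤ R := dist_nonneg.trans (h 0)
  rw [Simp.dist_le_iff hR]
  intro j
  have h1 : x j - aff v t j = ∑ i, t i * (x j - v i j) := by
    simp only [mul_sub, Finset.sum_sub_distrib, ← Finset.sum_mul, stdSimplex.sum_eq_one, one_mul,
      aff_apply]
  rw [h1]
  calc |∑ i, t i * (x j - v i j)| ≤ ∑ i, |t i * (x j - v i j)| := Finset.abs_sum_le_sum_abs _ _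
    _ ≤ ∑ i, t i * R := Finset.sum_le_sum fun i _ => by
        rw [abs_mul, abs_of_nonneg (stdSimplex.zero_le t i)]
        exact mul_le_mul_of_nonneg_left ((Simp.dist_le_iff hR).1 (h i) j) (stdSimplex.zero_le t i)
    _ = R := by rw [← Finset.sum_mul, stdSimplex.sum_eq_one, one_mul]

/-- In the average of the differences with `v i` the `i`-th term vanishes, which leaves k of the k +
1 terms. This factor below 1 makes iterated subdivisions fine. -/
theorem dist_bary_le (n k : ℕ) (v : Fin (k + 1) → Simp n) (D : ℝ)
    (h : ∀ i j, dist (v i) (v j) ≤ D) (i : Fin (k + 1)) :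
    dist (bary n k v) (v i) ≤ (k : ℝ) / (k + 1) * D := by
  have hD : 0 ≤ D := dist_nonneg.trans (h 0 0)
  rw [Simp.dist_le_iff (by positivity)]
  intro j
  have hs : ∑ a : Fin (k + 1), (1 : ℝ) / (k + 1) = 1 := by simp; field_simp
  have h1 : bary n k v j - v i j = ∑ a, (1 : ℝ) / (k + 1) * (v a j - v i j) := by
    simp only [mul_sub, Finset.sum_sub_distrib, ← Finset.sum_mul, hs, one_mul]
    rfl
  rw [h1]
  calc |∑ a, (1 : ℝ) / (k + 1) * (v a j - v i j)|
      ≤ ∑ a, |(1 : ℝ) / (k + 1) * (v a j - v i j)| := Finset.abs_sum_le_sum_abs _ _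
    _ ≤ ∑ a, (1 : ℝ) / (k + 1) * (if a = i then 0 else D) := Finset.sum_le_sum fun a _ => by
        rw [abs_mul, abs_of_nonneg (by positivity : (0 : ℝ) ≤ 1 / (k + 1))]
        refine mul_le_mul_of_nonneg_left ?_ (by positivity)
        split_ifs with ha
        · simp [ha]
        · exact (Simp.dist_le_iff hD).1 (h a i) j
    _ = (k : ℝ) / (k + 1) * D := by
        rw [← Finset.mul_sum, Finset.sum_ite, Finset.sum_const_zero, zero_add, Finset.sum_const,
          Finset.filter_ne', Finset.card_erase_of_mem (Finset.mem_univ i), Finset.card_univ,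
          Fintype.card_fin]
        simp
        ring

/-! ### Barycentric subdivision of singular chains -/

/-- Chains of tuples in a simplex, realised as affine singular chains. -/
def real (n k : ℕ) : TC (Simp n) k →ₗ[ℤ] Ch (Simp n) k := Finsupp.lmapDomain ℤ ℤ aff

@[simp]
theorem real_single (n k : ℕ) (v : Fin (k + 1) → Simp n) (a : ℤ) :
    real n k (Finsupp.single v a) = Finsupp.single (aff v) a := by
  simp [real]

theorem bd_real (n k : ℕ) (c : TC (Simp n) (k + 1)) :
    bd k (real n (k + 1) c) = real n k (bdT k c) := by
  induction c using Finsupp.induction_linear with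
  | zero => simp
  | add x y hx hy => simp only [map_add, hx, hy]
  | single v a =>
    simp only [real_single, bd_single, bdT_single, map_sum, map_smul, aff_comp_faceMap]

theorem push_aff_real {n m : ℕ} (f : Fin (n + 1) → Simp m) (k : ℕ) (c : TC (Simp n) k) :
    push (aff f) k (real n k c) = real m k (mapT (aff f) k c) := by
  induction c using Finsupp.induction_linear with
  | zero => simp
  | add x y hx hy => simp only [map_add, hx, hy]
  | single v a => simp only [real_single, push_single, mapT_single, aff_comp_aff]

variable {X Y : Type} [TopologicalSpace X] [TopologicalSpace Y]

/-- Barycentric subdivision of singular chains. -/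
def Sd (n : ℕ) : Ch X n →ₗ[ℤ] Ch X n :=
  Finsupp.linearCombination ℤ fun σ =>
    push σ n (real n n (subdiv (bary n) n (Finsupp.single (vtx n) 1)))

/-- The chain homotopy from the identity to barycentric subdivision. -/
def SdHtpy (n : ℕ) : Ch X n →ₗ[ℤ] Ch X (n + 1) :=
  Finsupp.linearCombination ℤ fun σ =>
    push σ (n + 1) (real n (n + 1) (subdivHtpy (bary n) n (Finsupp.single (vtx n) 1)))

theorem Sd_single (n : ℕ) (σ : C(Simp n, X)) : Sd n (Finsupp.single σ 1) =
    push σ n (real n n (subdiv (bary n) n (Finsupp.single (vtx n) 1))) := by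
  simp [Sd]

theorem SdHtpy_single (n : ℕ) (σ : C(Simp n, X)) : SdHtpy n (Finsupp.single σ 1) =
    push σ (n + 1) (real n (n + 1) (subdivHtpy (bary n) n (Finsupp.single (vtx n) 1))) := by
  simp [SdHtpy]

theorem Sd_push (f : C(X, Y)) (n : ℕ) (c : Ch X n) : Sd n (push f n c) = push f n (Sd n c) := by
  suffices h : Sd n ∘ₗ push f n = push f n ∘ₗ Sd n from LinearMap.congr_fun h c
  refine linearMap_ext_single fun σ => ?_
  simp only [LinearMap.comp_apply, push_single, Sd_single, push_comp]

theorem SdHtpy_push (f : C(X, Y)) (n : ℕ) (c : Ch X n) :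
    SdHtpy n (push f n c) = push f (n + 1) (SdHtpy n c) := by
  suffices h : SdHtpy n ∘ₗ push f n = push f (n + 1) ∘ₗ SdHtpy n from LinearMap.congr_fun h c
  refine linearMap_ext_single fun σ => ?_
  simp only [LinearMap.comp_apply, push_single, SdHtpy_single, push_comp]

theorem Sd_real (n k : ℕ) (c : TC (Simp n) k) :
    Sd k (real n k c) = real n k (subdiv (bary n) k c) := by
  suffices h : Sd k ∘ₗ real n k = real n k ∘ₗ subdiv (bary n) k from LinearMap.congr_fun h c
  refine linearMap_ext_single fun v => ?_
  simp only [LinearMap.comp_apply, real_single, Sd_single, push_aff_real]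
  rw [← subdiv_mapT (fun k w => aff_bary v w), mapT_single]
  congr 3
  ext i : 1
  exact aff_apply_vtx v i

theorem SdHtpy_real (n k : ℕ) (c : TC (Simp n) k) :
    SdHtpy k (real n k c) = real n (k + 1) (subdivHtpy (bary n) k c) := by
  suffices h : SdHtpy k ∘ₗ real n k = real n (k + 1) ∘ₗ subdivHtpy (bary n) k from
    LinearMap.congr_fun h c
  refine linearMap_ext_single fun v => ?_
  simp only [LinearMap.comp_apply, real_single, SdHtpy_single, push_aff_real]
  rw [← subdivHtpy_mapT (fun k w => aff_bary v w), mapT_single]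
  congr 3
  ext i : 1
  exact aff_apply_vtx v i

/-- A singular simplex is the push-forward of the identity simplex, so natural identities need only
be checked on affine chains, where they come from tuples. -/
theorem single_eq_push_real (n : ℕ) (σ : C(Simp n, X)) :
    Finsupp.single σ (1 : ℤ) = push σ n (real n n (Finsupp.single (vtx n) 1)) := by
  rw [real_single, push_single, aff_vtx, ContinuousMap.comp_id]

theorem bd_Sd (n : ℕ) (c : Ch X (n + 1)) : bd n (Sd (n + 1) c) = Sd n (bd n c) := by
  suffices h : bd n ∘ₗ Sd (n + 1) = (Sd n ∘ₗ bd n : Ch X (n + 1) →ₗ[ℤ] _) from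
    LinearMap.congr_fun h c
  refine linearMap_ext_single fun σ => ?_
  simp only [LinearMap.comp_apply]
  rw [single_eq_push_real, Sd_push, bd_push, bd_push, Sd_push, Sd_real, bd_real, bd_real, Sd_real,
    bdT_subdiv]

theorem bd_SdHtpy (n : ℕ) (c : Ch X (n + 1)) :
    bd (n + 1) (SdHtpy (n + 1) c) = c - Sd (n + 1) c - SdHtpy n (bd n c) := by
  suffices h : bd (n + 1) ∘ₗ SdHtpy (n + 1) =
      (LinearMap.id - Sd (n + 1) - SdHtpy n ∘ₗ bd n : Ch X (n + 1) →ₗ[ℤ] _) from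
    LinearMap.congr_fun h c
  refine linearMap_ext_single fun σ => ?_
  simp only [LinearMap.comp_apply, LinearMap.sub_apply, LinearMap.id_apply]
  rw [single_eq_push_real, SdHtpy_push, bd_push, bd_push, SdHtpy_push, Sd_push, SdHtpy_real,
    Sd_real, bd_real, bd_real, SdHtpy_real, bdT_subdivHtpy]
  simp only [map_sub]

theorem Sd_iterate_single (n m : ℕ) (σ : C(Simp n, X)) :
    (Sd n)^[m] (Finsupp.single σ 1) =
      push σ n (real n n ((subdiv (bary n) n)^[m] (Finsupp.single (vtx n) 1))) := by
  induction m with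
  | zero => exact single_eq_push_real n σ
  | succ m ih => rw [Function.iterate_succ_apply', ih, Sd_push, Sd_real,
      Function.iterate_succ_apply']

/-! ### Small chains -/

/-- The chains with support in a subset. -/
def chainsIn (U : Set X) (n : ℕ) : Submodule ℤ (Ch X n) :=
  Finsupp.supported ℤ ℤ {σ | Set.range σ ⊆ U}

theorem push_mem_chainsIn {U : Set X} {f : C(Y, X)} (hf : Set.range f ⊆ U) (n : ℕ) (c : Ch Y n) :
    push f n c ∈ chainsIn U n := by
  refine linearMap_mem_of_supported (s := Set.univ) _ (fun σ _ => ?_) (by simp)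
  rw [push_single]
  refine Finsupp.single_mem_supported ℤ _ ?_
  rintro _ ⟨t, rfl⟩
  exact hf ⟨σ t, rfl⟩

theorem SdHtpy_mem_chainsIn {U : Set X} {n : ℕ} {c : Ch X n} (hc : c ∈ chainsIn U n) :
    SdHtpy n c ∈ chainsIn U (n + 1) := by
  refine linearMap_mem_of_supported _ (fun σ hσ => ?_) hc
  rw [SdHtpy_single]
  exact push_mem_chainsIn hσ _ _

theorem Sd_mem_chainsIn {U : Set X} {n : ℕ} {c : Ch X n} (hc : c ∈ chainsIn U n) :
    Sd n c ∈ chainsIn U n := by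
  refine linearMap_mem_of_supported _ (fun σ hσ => ?_) hc
  rw [Sd_single]
  exact push_mem_chainsIn hσ _ _

/-- Take a Lebesgue number of the cover pulled back to the simplex and subdivide until the mesh is
smaller. Allowing all `m ≥ M` lets a finite sum of simplices use a common exponent. -/
theorem exists_Sd_iterate_single_mem {U V : Set X} (hU : IsOpen U) (hV : IsOpen V)
    (hUV : U ∪ V = Set.univ) (n : ℕ) (σ : C(Simp n, X)) :
    ∃ M, ∀ m, M ≤ m → (Sd n)^[m] (Finsupp.single σ 1) ∈ chainsIn U n ⊔ chainsIn V n := by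
  obtain ⟨δ, hδ, hL⟩ := lebesgue_number_lemma_of_metric (s := (Set.univ : Set (Simp n)))
    (c := fun b : Bool => σ ⁻¹' (if b then U else V)) isCompact_univ
    (fun b => by cases b <;> simp [hU.preimage σ.continuous, hV.preimage σ.continuous])
    (fun t _ => by
      have : σ t ∈ U ∪ V := hUV ▸ Set.mem_univ _
      rcases this with h | h
      · exact Set.mem_iUnion.2 ⟨true, by simpa using h⟩
      · exact Set.mem_iUnion.2 ⟨false, by simpa using h⟩)
  have hr : (n : ℝ) / (n + 1) < 1 := by
    rw [div_lt_one (by positivity)]; linarith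
  have hr0 : (0 : ℝ) ≤ (n : ℝ) / (n + 1) := by positivity
  obtain ⟨M, hM⟩ := exists_pow_lt_of_lt_one hδ hr
  refine ⟨M, fun m hm => ?_⟩
  have hvtx : (Finsupp.single (vtx n) 1 : TC (Simp n) n) ∈ Finsupp.supported ℤ ℤ
      {w : Fin (n + 1) → Simp n | ∀ i j, dist (w i) (w j) ≤ 1} := by
    refine Finsupp.single_mem_supported ℤ _ fun i j => ?_
    rw [Simp.dist_le_iff zero_le_one]
    intro a
    simp only [vtx_apply]
    split_ifs <;> simp
  rw [Sd_iterate_single]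
  have hS := subdiv_iterate_mem_supported (β := bary n)
    (fun k v x R h => dist_aff_le v (centre k) x R h) (dist_bary_le n) n 1 m _ hvtx
  refine linearMap_mem_of_supported (push σ n ∘ₗ real n n) (fun w hw => ?_) hS
  rw [LinearMap.comp_apply, real_single, push_single]
  obtain ⟨b, hb⟩ := hL (w 0) (Set.mem_univ _)
  have hball : ∀ t, aff w t ∈ Metric.ball (w 0) δ := by
    intro t
    rw [Metric.mem_ball']
    refine lt_of_le_of_lt (dist_aff_le w t (w 0) _ (fun i => hw 0 i)) ?_
    rw [mul_one]
    exact lt_of_le_of_lt (pow_le_pow_of_le_one hr0 hr.le hm) hM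
  cases b
  · refine Submodule.mem_sup_right (Finsupp.single_mem_supported ℤ _ ?_)
    rintro _ ⟨t, rfl⟩
    simpa using hb (hball t)
  · refine Submodule.mem_sup_left (Finsupp.single_mem_supported ℤ _ ?_)
    rintro _ ⟨t, rfl⟩
    simpa using hb (hball t)

theorem exists_Sd_iterate_mem {U V : Set X} (hU : IsOpen U) (hV : IsOpen V)
    (hUV : U ∪ V = Set.univ) (n : ℕ) (c : Ch X n) :
    ∃ M, ∀ m, M ≤ m → (Sd n)^[m] c ∈ chainsIn U n ⊔ chainsIn V n := by
  induction c using Finsupp.induction_linear with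
  | zero => exact ⟨0, fun m _ => by rw [iterate_map_zero]; exact zero_mem _⟩
  | add x y hx hy =>
    obtain ⟨M, hM⟩ := hx
    obtain ⟨N, hN⟩ := hy
    refine ⟨max M N, fun m hm => ?_⟩
    rw [iterate_map_add]
    exact add_mem (hM m (le_of_max_le_left hm)) (hN m (le_of_max_le_right hm))
  | single σ a =>
    obtain ⟨M, hM⟩ := exists_Sd_iterate_single_mem hU hV hUV n σ
    refine ⟨M, fun m hm => ?_⟩
    rw [← mul_one a, ← smul_eq_mul, ← Finsupp.smul_single, ← Module.End.pow_apply, map_smul,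
      Module.End.pow_apply]
    exact Submodule.smul_mem _ _ (hM m hm)

/-- A chain with small boundary differs from a small chain by a boundary. -/
theorem exists_small {U V : Set X} (hU : IsOpen U) (hV : IsOpen V)
    (hUV : U ∪ V = Set.univ) (n : ℕ) (c : Ch X (n + 1))
    (hc : bd n c ∈ chainsIn U n ⊔ chainsIn V n) :
    ∃ c' ∈ chainsIn U (n + 1) ⊔ chainsIn V (n + 1), ∃ e, c - c' = bd (n + 1) e := by
  obtain ⟨M, hM⟩ := exists_Sd_iterate_mem hU hV hUV (n + 1) c
  replace hM := hM M le_rfl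
  induction M generalizing c with
  | zero => exact ⟨c, hM, 0, by simp⟩
  | succ M ih =>
    have hmap : ∀ b ∈ chainsIn U n ⊔ chainsIn V n,
        Sd n b ∈ chainsIn U n ⊔ chainsIn V n ∧
        SdHtpy n b ∈ chainsIn U (n + 1) ⊔ chainsIn V (n + 1) := by
      intro b hb
      obtain ⟨u, hu, v, hv, rfl⟩ := Submodule.mem_sup.1 hb
      rw [map_add, map_add]
      exact ⟨Submodule.add_mem_sup (Sd_mem_chainsIn hu) (Sd_mem_chainsIn hv),
        Submodule.add_mem_sup (SdHtpy_mem_chainsIn hu) (SdHtpy_mem_chainsIn hv)⟩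
    obtain ⟨c', hc', e, he⟩ := ih (Sd (n + 1) c) (by rw [bd_Sd]; exact (hmap _ hc).1) hM
    -- The homotopy formula expresses `c - Sd c` as a boundary plus `SdHtpy` of the boundary of `c`;
    -- the latter is small because that boundary is small.
    refine ⟨c' + SdHtpy n (bd n c), add_mem hc' (hmap _ hc).2, e + SdHtpy (n + 1) c, ?_⟩
    rw [map_add, ← he, bd_SdHtpy]
    abel

end SingularChains

end

noncomputable section

/-! ### The Mayer-Vietoris sequence of two open subspaces. -/

namespace SingularChains

open Topology

variable {W A B X Y : Type} [TopologicalSpace W] [TopologicalSpace A] [TopologicalSpace B]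
  [TopologicalSpace X] [TopologicalSpace Y]

theorem push_injective {f : C(X, Y)} (hf : Function.Injective f) (n : ℕ) :
    Function.Injective (push f n) := by
  refine Finsupp.mapDomain_injective fun σ τ h => ?_
  ext t
  exact hf (DFunLike.congr_fun h t)

theorem exists_push_eq {f : C(X, Y)} (hf : IsEmbedding f) {n : ℕ} {c : Ch Y n}
    (hc : c ∈ chainsIn (Set.range f) n) : ∃ c', push f n c' = c := by
  have : c ∈ LinearMap.range (push f n) := by
    have := linearMap_mem_of_supported (LinearMap.id : Ch Y n →ₗ[ℤ] Ch Y n)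
      (N := LinearMap.range (push f n)) (fun σ hσ => ?_) hc
    · exact this
    · have h : ∀ t, ∃ x, f x = σ t := fun t => hσ ⟨t, rfl⟩
      choose g hg using h
      have hgc : Continuous g := by
        rw [hf.continuous_iff]
        exact (funext hg : f ∘ g = σ) ▸ σ.continuous
      refine ⟨Finsupp.single ⟨g, hgc⟩ 1, ?_⟩
      rw [push_single]
      congr 1
      ext t
      exact hg t
  exact this

theorem mem_cyc_of_push {f : C(X, Y)} (hf : Function.Injective f) {n : ℕ} {c : Ch X n}
    (hc : push f n c ∈ cyc Y n) : c ∈ cyc X n := by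
  cases n with
  | zero => trivial
  | succ n =>
    apply push_injective hf n
    rw [← bd_push, map_zero]
    exact hc

theorem exists_cls_eq {n : ℕ} (x : H n X) : ∃ (c : Ch X n) (hc : c ∈ cyc X n), cls X n ⟨c, hc⟩ = x := by
  obtain ⟨z, rfl⟩ := cls_surjective n x
  exact ⟨z.1, z.2, rfl⟩

theorem cls_eq_iff {n : ℕ} {z z' : cyc X n} : cls X n z = cls X n z' ↔ ∃ e, bd n e = z.1 - z'.1 := by
  rw [← sub_eq_zero, ← map_sub, cls_eq_zero_iff]; rfl

/-- The square of inclusions of the intersection of two open subspaces that cover a space. -/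
structure MVSquare (jA : C(W, A)) (jB : C(W, B)) (iA : C(A, X)) (iB : C(B, X)) : Prop where
  comm : ∀ w, iA (jA w) = iB (jB w)
  embA : IsOpenEmbedding iA
  embB : IsOpenEmbedding iB
  embW : IsEmbedding (iA.comp jA)
  cover : Set.range iA ∪ Set.range iB = Set.univ
  inter : Set.range iA ∩ Set.range iB ⊆ Set.range (iA.comp jA)

namespace MVSquare

variable {jA : C(W, A)} {jB : C(W, B)} {iA : C(A, X)} {iB : C(B, X)}
  (S : MVSquare jA jB iA iB)

include S

theorem push_comm (n : ℕ) (c : Ch W n) : push iA n (push jA n c) = push iB n (push jB n c) := by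
  rw [← push_comp, ← push_comp]
  congr 2
  ext w
  exact S.comm w

theorem injective_jA : Function.Injective jA := fun _ _ h =>
  S.embW.injective (congrArg iA h)

/-- Exactness on chains: the common image uses only simplices lying in both parts, hence in the
intersection, where they lift because the inclusion is an embedding. -/
theorem exists_push_of_push_eq {n : ℕ} {a : Ch A n} {b : Ch B n} (h : push iA n a = push iB n b) :
    ∃ w, push jA n w = a ∧ push jB n w = b := by
  have h1 : push iA n a ∈ chainsIn (Set.range (iA.comp jA)) n := by
    have hs : ({σ | Set.range σ ⊆ Set.range iA} ∩ {σ | Set.range σ ⊆ Set.range iB} :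
        Set C(Simp n, X)) ⊆ {σ | Set.range σ ⊆ Set.range (iA.comp jA)} :=
      fun σ hσ => (Set.subset_inter hσ.1 hσ.2).trans S.inter
    refine Finsupp.supported_mono (M := ℤ) (R := ℤ) hs ?_
    rw [Finsupp.supported_inter]
    refine ⟨push_mem_chainsIn subset_rfl n a, ?_⟩
    rw [h]
    exact push_mem_chainsIn subset_rfl n b
  obtain ⟨w, hw⟩ := exists_push_eq S.embW h1
  rw [push_comp] at hw
  refine ⟨w, push_injective S.embA.injective n hw, push_injective S.embB.injective n ?_⟩
  rw [← S.push_comm, hw, h]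

theorem exists_small (n : ℕ) (c : Ch X (n + 1)) {a : Ch A n} {b : Ch B n}
    (hc : bd n c = push iA n a + push iB n b) :
    ∃ a' b' e, c - (push iA (n + 1) a' + push iB (n + 1) b') = bd (n + 1) e := by
  obtain ⟨c', hc', e, he⟩ := SingularChains.exists_small S.embA.isOpen_range
    S.embB.isOpen_range S.cover n c (by
      rw [hc]
      exact Submodule.add_mem_sup (push_mem_chainsIn subset_rfl n a)
        (push_mem_chainsIn subset_rfl n b))
  obtain ⟨u, hu, v, hv, rfl⟩ := Submodule.mem_sup.1 hc'
  obtain ⟨a', rfl⟩ := exists_push_eq S.embA.isEmbedding hu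
  obtain ⟨b', rfl⟩ := exists_push_eq S.embB.isEmbedding hv
  exact ⟨a', b', e, he⟩

/-- Exactness of the Mayer-Vietoris sequence at the sum of the homology groups of the parts. -/
theorem exists_of_Hmap_eq {n : ℕ} {u : H n A} {v : H n B} (h : Hmap n iA u = Hmap n iB v) :
    ∃ w : H n W, Hmap n jA w = u ∧ Hmap n jB w = v := by
  obtain ⟨a, ha, rfl⟩ := exists_cls_eq u
  obtain ⟨b, hb, rfl⟩ := exists_cls_eq v
  rw [Hmap_cls, Hmap_cls, cls_eq_iff] at h
  obtain ⟨d, hd⟩ := h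
  obtain ⟨a', b', e, he⟩ := S.exists_small n d (a := a) (b := -b)
    (by rw [hd, map_neg, sub_eq_add_neg])
  have hd' : bd n (push iA (n + 1) a' + push iB (n + 1) b') = bd n d := by
    rw [← sub_eq_zero, ← map_sub, ← neg_sub, he, map_neg, bd_bd, neg_zero]
  rw [hd, map_add, bd_push, bd_push] at hd'
  -- Changing both cycles by boundaries makes their images equal as chains, so they come from a
  -- single chain of the overlap.
  have h2 : push iA n (a - bd n a') = push iB n (b + bd n b') := by
    rw [map_sub, map_add]
    have : push iA n a - push iB n b = push iA n (bd n a') + push iB n (bd n b') := hd'.symm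
    rw [sub_eq_iff_eq_add] at this
    rw [this]; abel
  obtain ⟨w, hw1, hw2⟩ := S.exists_push_of_push_eq h2
  have hw : w ∈ cyc W n := mem_cyc_of_push S.injective_jA (by
    rw [hw1]; exact sub_mem ha (bd_mem_cyc n a'))
  refine ⟨cls W n ⟨w, hw⟩, ?_, ?_⟩
  · rw [Hmap_cls, cls_eq_iff]
    exact ⟨-a', by simp [hw1]⟩
  · rw [Hmap_cls, cls_eq_iff]
    exact ⟨b', by simp [hw2]⟩

end MVSquare

/-- The graph of the connecting homomorphism of the Mayer-Vietoris sequence. -/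
def MVRel (jA : C(W, A)) (jB : C(W, B)) (iA : C(A, X)) (iB : C(B, X)) (n : ℕ)
    (x : H (n + 1) X) (w : H n W) : Prop :=
  ∃ (a : Ch A (n + 1)) (b : Ch B (n + 1)) (c : Ch W n) (hc : c ∈ cyc W n)
    (hz : push iA (n + 1) a + push iB (n + 1) b ∈ cyc X (n + 1)),
    bd n a = push jA n c ∧ bd n b = -push jB n c ∧ cls X (n + 1) ⟨_, hz⟩ = x ∧
      cls W n ⟨c, hc⟩ = w

namespace MVRel

variable {jA : C(W, A)} {jB : C(W, B)} {iA : C(A, X)} {iB : C(B, X)} {n : ℕ}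

/-- Linearity of the relation lets one subtract a known lift and reduce to `w = 0`, so
single-valuedness of the connecting map is never needed. -/
theorem sub_smul {x x' : H (n + 1) X} {w w' : H n W} (h : MVRel jA jB iA iB n x w)
    (h' : MVRel jA jB iA iB n x' w') (k : ℤ) :
    MVRel jA jB iA iB n (x - k • x') (w - k • w') := by
  obtain ⟨a, b, c, hc, hz, ha, hb, rfl, rfl⟩ := h
  obtain ⟨a', b', c', hc', hz', ha', hb', rfl, rfl⟩ := h'
  have e : push iA (n + 1) (a - k • a') + push iB (n + 1) (b - k • b') =
      (push iA (n + 1) a + push iB (n + 1) b) -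
        k • (push iA (n + 1) a' + push iB (n + 1) b') := by
    simp only [map_sub, map_smul, smul_add]
    abel
  refine ⟨a - k • a', b - k • b', c - k • c', sub_mem hc (Submodule.smul_mem _ k hc'), ?_,
    ?_, ?_, ?_, ?_⟩
  · rw [e]; exact sub_mem hz (Submodule.smul_mem _ k hz')
  · simp only [map_sub, map_smul, ha, ha']
  · simp only [map_sub, map_smul, hb, hb', smul_neg, sub_neg_eq_add]
    abel
  · rw [← map_zsmul, ← map_sub]
    congr 1
    exact Subtype.ext e
  · rw [← map_zsmul, ← map_sub]; rfl

theorem sub {x x' : H (n + 1) X} {w w' : H n W} (h : MVRel jA jB iA iB n x w)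
    (h' : MVRel jA jB iA iB n x' w') : MVRel jA jB iA iB n (x - x') (w - w') := by
  simpa using h.sub_smul h' 1

theorem Hmap_left {x : H (n + 1) X} {w : H n W} (h : MVRel jA jB iA iB n x w) :
    Hmap n jA w = 0 := by
  obtain ⟨a, b, c, hc, hz, ha, hb, rfl, rfl⟩ := h
  rw [Hmap_cls, cls_eq_zero_iff]
  exact ⟨a, ha⟩

theorem Hmap_right {x : H (n + 1) X} {w : H n W} (h : MVRel jA jB iA iB n x w) :
    Hmap n jB w = 0 := by
  obtain ⟨a, b, c, hc, hz, ha, hb, rfl, rfl⟩ := h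
  rw [Hmap_cls, cls_eq_zero_iff]
  exact ⟨-b, by rw [map_neg, hb, neg_neg]⟩

theorem map {W' A' B' X' : Type} [TopologicalSpace W'] [TopologicalSpace A'] [TopologicalSpace B']
    [TopologicalSpace X'] {jA' : C(W', A')} {jB' : C(W', B')} {iA' : C(A', X')} {iB' : C(B', X')}
    {fW : C(W, W')} {fA : C(A, A')} {fB : C(B, B')} {fX : C(X, X')}
    (hjA : fA.comp jA = jA'.comp fW) (hjB : fB.comp jB = jB'.comp fW)
    (hiA : fX.comp iA = iA'.comp fA) (hiB : fX.comp iB = iB'.comp fB)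
    {x : H (n + 1) X} {w : H n W} (h : MVRel jA jB iA iB n x w) :
    MVRel jA' jB' iA' iB' n (Hmap (n + 1) fX x) (Hmap n fW w) := by
  obtain ⟨a, b, c, hc, hz, ha, hb, rfl, rfl⟩ := h
  have e : push iA' (n + 1) (push fA (n + 1) a) + push iB' (n + 1) (push fB (n + 1) b) =
      push fX (n + 1) (push iA (n + 1) a + push iB (n + 1) b) := by
    rw [map_add, ← push_comp, ← push_comp, ← push_comp, ← push_comp, hiA, hiB]
  refine ⟨push fA _ a, push fB _ b, push fW _ c, push_mem_cyc fW hc, ?_, ?_, ?_, ?_, ?_⟩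
  · rw [e]; exact push_mem_cyc fX hz
  · rw [bd_push, ha, ← push_comp, ← push_comp, hjA]
  · rw [bd_push, hb, map_neg, ← push_comp, ← push_comp, hjB]
  · rw [Hmap_cls]
    congr 1
    exact Subtype.ext e
  · rw [Hmap_cls]

variable (S : MVSquare jA jB iA iB)

include S

/-- Split a cycle, up to a boundary, into a chain in each part; the boundaries of the two pieces
cancel and therefore live on the overlap. -/
theorem exists_right (x : H (n + 1) X) : ∃ w, MVRel jA jB iA iB n x w := by
  obtain ⟨z, hz, rfl⟩ := exists_cls_eq x
  have hz0 : bd n z = 0 := hz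
  obtain ⟨a, b, e, he⟩ := S.exists_small n z (a := 0) (b := 0) (by simp [hz0])
  have h1 : bd n (push iA (n + 1) a + push iB (n + 1) b) = 0 := by
    rw [← hz0, ← sub_eq_zero, ← map_sub, ← neg_sub, he, map_neg, bd_bd, neg_zero]
  have h2 : push iA n (bd n a) = push iB n (-bd n b) := by
    rw [map_add, bd_push, bd_push] at h1
    rw [map_neg]
    exact eq_neg_of_add_eq_zero_left h1
  obtain ⟨w, hw1, hw2⟩ := S.exists_push_of_push_eq h2
  have hw : w ∈ cyc W n := mem_cyc_of_push S.injective_jA (by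
    rw [hw1]; exact bd_mem_cyc n a)
  refine ⟨cls W n ⟨w, hw⟩, a, b, w, hw, h1, hw1.symm, by rw [hw2, neg_neg], ?_, rfl⟩
  rw [eq_comm, cls_eq_iff]
  exact ⟨e, he.symm⟩

/-- Glue fillings of the same cycle in the two parts, with opposite signs. -/
theorem exists_left {w : H n W} (hA : Hmap n jA w = 0) (hB : Hmap n jB w = 0) :
    ∃ x, MVRel jA jB iA iB n x w := by
  obtain ⟨c, hc, rfl⟩ := exists_cls_eq w
  rw [Hmap_cls, cls_eq_zero_iff] at hA hB
  obtain ⟨a, ha⟩ := hA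
  obtain ⟨b, hb⟩ := hB
  dsimp only at ha hb
  have hz : push iA (n + 1) a + push iB (n + 1) (-b) ∈ cyc X (n + 1) := by
    change bd n _ = 0
    rw [map_add, bd_push, bd_push, map_neg, map_neg, ha, hb, S.push_comm, add_neg_cancel]
  exact ⟨_, a, -b, c, hc, hz, ha, by rw [map_neg, hb], rfl, rfl⟩

/-- A filling in the overlap closes each of the two pieces to a cycle, and its two contributions to
the sum cancel. -/
theorem eq_add_of_zero {x : H (n + 1) X} (h : MVRel jA jB iA iB n x 0) :
    ∃ u v, x = Hmap (n + 1) iA u + Hmap (n + 1) iB v := by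
  obtain ⟨a, b, c, hc, hz, ha, hb, rfl, h0⟩ := h
  obtain ⟨e, he⟩ := cls_eq_zero_iff.1 h0
  dsimp only at he
  have ha' : a - push jA (n + 1) e ∈ cyc A (n + 1) := by
    change bd n _ = 0
    rw [map_sub, bd_push, he, ha, sub_self]
  have hb' : b + push jB (n + 1) e ∈ cyc B (n + 1) := by
    change bd n _ = 0
    rw [map_add, bd_push, he, hb, neg_add_cancel]
  refine ⟨cls A _ ⟨_, ha'⟩, cls B _ ⟨_, hb'⟩, ?_⟩
  rw [Hmap_cls, Hmap_cls, ← map_add]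
  congr 1
  apply Subtype.ext
  change _ = push iA (n + 1) (a - push jA (n + 1) e) + push iB (n + 1) (b + push jB (n + 1) e)
  rw [map_sub, map_add, S.push_comm, sub_add_add_cancel]

end MVRel

theorem MVSquare.prod {jA : C(W, A)} {jB : C(W, B)} {iA : C(A, X)} {iB : C(B, X)}
    (S : MVSquare jA jB iA iB) (Y : Type) [TopologicalSpace Y] :
    MVSquare (jA.prodMap (ContinuousMap.id Y)) (jB.prodMap (ContinuousMap.id Y))
      (iA.prodMap (ContinuousMap.id Y)) (iB.prodMap (ContinuousMap.id Y)) where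
  comm w := Prod.ext (S.comm w.1) rfl
  embA := S.embA.prodMap IsOpenEmbedding.id
  embB := S.embB.prodMap IsOpenEmbedding.id
  embW := S.embW.prodMap IsEmbedding.id
  cover := by
    refine Set.eq_univ_of_forall fun p => ?_
    have : p.1 ∈ Set.range iA ∪ Set.range iB := S.cover ▸ Set.mem_univ _
    rcases this with ⟨a, ha⟩ | ⟨b, hb⟩
    · exact Or.inl ⟨(a, p.2), Prod.ext ha rfl⟩
    · exact Or.inr ⟨(b, p.2), Prod.ext hb rfl⟩
  inter := by
    rintro p ⟨⟨a, ha⟩, ⟨b, hb⟩⟩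
    obtain ⟨w, hw⟩ := S.inter ⟨⟨a.1, congrArg Prod.fst ha⟩, ⟨b.1, congrArg Prod.fst hb⟩⟩
    exact ⟨(w, p.2), Prod.ext hw rfl⟩

/-! ### Homology in degree zero -/

/-- The one-point map. -/
abbrev ptMap (x : X) : C(Unit, X) := ContinuousMap.const Unit x

theorem Hmap_ptMap_eq (n : ℕ) {x y : X} (h : Joined x y) : Hmap n (ptMap x) = Hmap n (ptMap y) := by
  obtain ⟨γ⟩ := h
  refine Hmap_congr n ⟨⟨⟨fun p => γ p.1, by fun_prop⟩, fun _ => by simp, fun _ => by simp⟩⟩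

/-- The class of the one-point space. -/
def ptCls : H 0 Unit := cls Unit 0 ⟨Finsupp.single (ContinuousMap.const _ ()) 1, trivial⟩

/-- The class of a point. -/
def pointCls (x : X) : H 0 X := Hmap 0 (ptMap x) ptCls

theorem Hmap_pointCls (f : C(X, Y)) (x : X) : Hmap 0 f (pointCls x) = pointCls (f x) :=
  (Hmap_comp_apply 0 f (ptMap x) ptCls).symm

theorem pointCls_eq {x y : X} (h : Joined x y) : pointCls x = pointCls y :=
  LinearMap.congr_fun (Hmap_ptMap_eq 0 h) _

theorem pointCls_eq_cls (x : X) :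
    pointCls x = cls X 0 ⟨Finsupp.single (ContinuousMap.const _ x) 1, trivial⟩ := by
  rw [pointCls, ptCls, Hmap_cls]
  congr 1
  exact Subtype.ext (push_single _ _ _ _)

/-- Zero-simplices are points, so H₀ is generated by point classes, and one point in each path
component suffices. -/
theorem mem_of_pointCls_mem {S : Set X} (hS : ∀ y, ∃ x ∈ S, Joined x y) {N : AddSubgroup (H 0 X)}
    (hN : ∀ x ∈ S, pointCls x ∈ N) (y : H 0 X) : y ∈ N := by
  obtain ⟨c, hc, rfl⟩ := exists_cls_eq y
  induction c using Finsupp.induction_linear with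
  | zero => rw [show (⟨0, hc⟩ : cyc X 0) = 0 from rfl, map_zero]; exact zero_mem _
  | add a b ha hb =>
    have : (⟨a + b, hc⟩ : cyc X 0) = ⟨a, trivial⟩ + ⟨b, trivial⟩ := rfl
    rw [this, map_add]
    exact add_mem (ha trivial) (hb trivial)
  | single σ a =>
    obtain ⟨x, hx, hj⟩ := hS (σ default)
    have h1 : cls X 0 ⟨Finsupp.single σ a, hc⟩ = a • pointCls x := by
      rw [pointCls_eq hj, pointCls_eq_cls, ← map_zsmul]
      congr 1
      apply Subtype.ext
      change Finsupp.single σ a = a • Finsupp.single _ (1 : ℤ)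
      rw [Finsupp.smul_single, smul_eq_mul, mul_one]
      congr 1
      ext t
      change σ t = σ default
      rw [Subsingleton.elim default t]
    rw [h1]
    exact zsmul_mem (hN x hx) a

theorem Hmap_zero_surjective {f : C(X, Y)} (hf : ∀ y, ∃ x, Joined (f x) y) :
    Function.Surjective (Hmap 0 f) := fun y =>
  mem_of_pointCls_mem (S := Set.range f) (N := (Hmap 0 f).toAddMonoidHom.range)
    (fun y => let ⟨x, hx⟩ := hf y; ⟨f x, ⟨x, rfl⟩, hx⟩) (by
      rintro _ ⟨x, rfl⟩
      exact ⟨pointCls x, Hmap_pointCls f x⟩) y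

/-- The augmentation vanishes on boundaries and takes the value `k` on this multiple. -/
theorem zsmul_ptCls_eq_zero {k : ℤ} (h : k • ptCls = 0) : k = 0 := by
  rw [ptCls, ← map_zsmul, cls_eq_zero_iff] at h
  obtain ⟨e, he⟩ := h
  have he' : bd 0 e = k • Finsupp.single (ContinuousMap.const _ ()) 1 := he
  let φ : Ch Unit 0 →ₗ[ℤ] ℤ := Finsupp.linearCombination ℤ fun _ => 1
  have hφ : φ ∘ₗ bd 0 = 0 := by
    refine linearMap_ext_single fun σ => ?_
    rw [LinearMap.comp_apply, bd_single, Fin.sum_univ_two]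
    simp [φ]
  have h0 : φ (bd 0 e) = 0 := LinearMap.congr_fun hφ e
  rw [he', map_zsmul] at h0
  simpa [φ] using h0

/-- The functional that counts points in the path component of `x` kills boundaries, since both ends
of a 1-simplex lie in the same component. -/
theorem joined_of_pointCls_eq {x y : X} (h : pointCls x = pointCls y) : Joined x y := by
  classical
  rw [pointCls_eq_cls, pointCls_eq_cls, cls_eq_iff] at h
  obtain ⟨e, he⟩ := h
  dsimp only at he
  let φ : Ch X 0 →ₗ[ℤ] ℤ :=
    Finsupp.linearCombination ℤ fun σ => if Joined x (σ default) then 1 else 0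
  have hφ : φ ∘ₗ bd 0 = 0 := by
    refine linearMap_ext_single fun σ => ?_
    have hJ : ∀ s t, Joined (σ s) (σ t) := fun s t =>
      (PathConnectedSpace.joined s t).map σ.continuous
    rw [LinearMap.comp_apply, bd_single, Fin.sum_univ_two]
    have : Joined x (σ (faceMap 0 default)) ↔ Joined x (σ (faceMap 1 default)) :=
      ⟨fun h => h.trans (hJ _ _), fun h => h.trans (hJ _ _)⟩
    simp [φ, this]
  have h0 : φ (bd 0 e) = 0 := LinearMap.congr_fun hφ e
  rw [he, map_sub] at h0
  by_contra hxy
  simp [φ, hxy, Joined.refl] at h0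

/-- All of H₀(X) comes from one point, and collapsing the target to a point already detects those
classes. -/
theorem Hmap_zero_injective_of_pathConnected [PathConnectedSpace X] (f : C(X, Y)) :
    Function.Injective (Hmap 0 f) := by
  obtain ⟨x⟩ := (inferInstance : Nonempty X)
  have h1 : Function.Surjective (Hmap 0 (ptMap x)) :=
    Hmap_zero_surjective fun y => ⟨(), PathConnectedSpace.joined x y⟩
  rw [injective_iff_map_eq_zero]
  intro u hu
  obtain ⟨p, rfl⟩ := h1 u
  have h2 := congrArg (Hmap 0 (ContinuousMap.const Y ())) hu
  rw [← Hmap_comp_apply, ← Hmap_comp_apply, map_zero] at h2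
  have h3 : Hmap 0 (ContinuousMap.id Unit) p = 0 := h2
  rw [Hmap_id] at h3
  rw [h3, map_zero]

theorem H_subsingleton_of_contractible [ContractibleSpace X] {n : ℕ} (hn : n ≠ 0) :
    Subsingleton (H n X) := by
  obtain ⟨x, hx⟩ := id_nullhomotopic X
  have : Subsingleton (H n Unit) := H_subsingleton_of_totallyDisconnected hn
  refine ⟨fun a b => ?_⟩
  rw [← Hmap_id n a, ← Hmap_id n b, Hmap_congr n hx]
  change Hmap n ((ptMap x).comp (ContinuousMap.const X ())) a =
    Hmap n ((ptMap x).comp (ContinuousMap.const X ())) b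
  rw [Hmap_comp_apply, Hmap_comp_apply, Subsingleton.elim (Hmap n _ a)]

end SingularChains

end

noncomputable section

namespace SingularChains

open Topology

/-! ### Slices of products and their homology. -/

section Slices

variable {X Y Z : Type} [TopologicalSpace X] [TopologicalSpace Y] [TopologicalSpace Z]

/-- The inclusion of `X × {y}`. -/
def sliceL (X : Type) [TopologicalSpace X] (y : Y) : C(X, X × Y) :=
  ⟨fun x => (x, y), by fun_prop⟩

/-- The inclusion of `{x} × Y`. -/
def sliceR (x : X) (Y : Type) [TopologicalSpace Y] : C(Y, X × Y) :=
  ⟨fun y => (x, y), by fun_prop⟩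

/-- The product with the identity. -/
abbrev timesId (f : C(X, Z)) (Y : Type) [TopologicalSpace Y] : C(X × Y, Z × Y) :=
  f.prodMap (ContinuousMap.id Y)

theorem Hmap_const_eq_zero {n : ℕ} (hn : n ≠ 0) (y : Y) (x : H n X) :
    Hmap n (ContinuousMap.const X y) x = 0 := by
  have : Subsingleton (H n Unit) := H_subsingleton_of_totallyDisconnected hn
  change Hmap n ((ptMap y).comp (ContinuousMap.const X ())) x = 0
  rw [Hmap_comp_apply, Subsingleton.elim (Hmap n _ x) 0, map_zero]

theorem sliceL_injective (n : ℕ) (y : Y) : Function.Injective (Hmap n (sliceL X y)) := by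
  refine Function.LeftInverse.injective (g := Hmap n ContinuousMap.fst) fun x => ?_
  rw [← Hmap_comp_apply]
  exact Hmap_id n x

theorem Hmap_snd_sliceL {n : ℕ} (hn : n ≠ 0) (y : Y) (x : H n X) :
    Hmap n ContinuousMap.snd (Hmap n (sliceL X y) x) = 0 := by
  rw [← Hmap_comp_apply]
  exact Hmap_const_eq_zero hn y x

theorem Hmap_snd_sliceR (n : ℕ) (x : X) (y : H n Y) :
    Hmap n ContinuousMap.snd (Hmap n (sliceR x Y) y) = y := by
  rw [← Hmap_comp_apply]
  exact Hmap_id n y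

theorem timesId_homotopic {f g : C(X, Z)} (h : f.Homotopic g) :
    (timesId f Y).Homotopic (timesId g Y) := by
  obtain ⟨F⟩ := h
  exact ⟨⟨⟨fun p => (F (p.1, p.2.1), p.2.2), by fun_prop⟩,
    fun p => Prod.ext (F.map_zero_left p.1) rfl, fun p => Prod.ext (F.map_one_left p.1) rfl⟩⟩

theorem Hmap_timesId_sliceL (n : ℕ) (f : C(X, Z)) (y : Y) (x : H n X) :
    Hmap n (timesId f Y) (Hmap n (sliceL X y) x) = Hmap n (sliceL Z y) (Hmap n f x) := by
  rw [← Hmap_comp_apply, ← Hmap_comp_apply]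
  rfl

theorem Hmap_snd_timesId (n : ℕ) (f : C(X, Z)) (z : H n (X × Y)) :
    Hmap n ContinuousMap.snd (Hmap n (timesId f Y) z) = Hmap n ContinuousMap.snd z := by
  rw [← Hmap_comp_apply]
  rfl

theorem Hmap_sliceR_congr (n : ℕ) {x x' : X} (h : Joined x x') :
    Hmap n (sliceR x Y) = Hmap n (sliceR x' Y) := by
  obtain ⟨γ⟩ := h
  exact Hmap_congr n ⟨⟨⟨fun p => (γ p.1, p.2), by fun_prop⟩,
    fun _ => by simp [sliceR], fun _ => by simp [sliceR]⟩⟩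

theorem exists_eq_sliceR_of_contractible [ContractibleSpace X] (n : ℕ) (z : H n (X × Y)) (x : X) :
    z = Hmap n (sliceR x Y) (Hmap n ContinuousMap.snd z) := by
  have h : (ContinuousMap.id X).Homotopic (ContinuousMap.const X x) := by
    obtain ⟨x', hx'⟩ := id_nullhomotopic X
    obtain ⟨γ⟩ := PathConnectedSpace.joined x' x
    exact hx'.trans ⟨⟨⟨fun p => γ p.1, by fun_prop⟩, fun _ => by simp, fun _ => by simp⟩⟩
  have h2 := LinearMap.congr_fun (Hmap_congr n (timesId_homotopic (Y := Y) h)) z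
  rw [← Hmap_comp_apply]
  refine Eq.trans ?_ h2
  exact (Hmap_id n z).symm

/-- Surjectivity of a slice inclusion only depends on the homotopy type of the first factor. -/
theorem sliceL_surjective_of_retract {n : ℕ} {y : Y} {f : C(X, Z)} {g : C(Z, X)}
    (hfg : (g.comp f).Homotopic (ContinuousMap.id X))
    (h : Function.Surjective (Hmap n (sliceL Z y))) :
    Function.Surjective (Hmap n (sliceL X y)) := by
  intro z
  obtain ⟨a, ha⟩ := h (Hmap n (timesId f Y) z)
  refine ⟨Hmap n g a, ?_⟩
  rw [← Hmap_timesId_sliceL, ha, ← Hmap_comp_apply]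
  have := LinearMap.congr_fun (Hmap_congr n (timesId_homotopic (Y := Y) hfg)) z
  exact this.trans (Hmap_id n z)

theorem sliceL_zero_surjective [PathConnectedSpace Y] (y : Y) :
    Function.Surjective (Hmap 0 (sliceL X y)) :=
  Hmap_zero_surjective fun p => ⟨p.1, by
    obtain ⟨γ⟩ := PathConnectedSpace.joined y p.2
    exact ⟨⟨⟨fun t => (p.1, γ t), by fun_prop⟩, by simp [sliceL], by simp⟩⟩⟩

end Slices

/-! ### Mayer-Vietoris with two contractible parts. -/

section MayerVietoris

variable {W A B X Y : Type} [TopologicalSpace W] [TopologicalSpace A] [TopologicalSpace B]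
  [TopologicalSpace X] [TopologicalSpace Y] {jA : C(W, A)} {jB : C(W, B)} {iA : C(A, X)}
  {iB : C(B, X)} (S : MVSquare jA jB iA iB) [ContractibleSpace A] [ContractibleSpace B]

include S

/-- The homology of a product of a suspension with `Y`, in terms of that of the factors. -/
theorem MVSquare.exists_eq_sliceL_add_sliceR [PathConnectedSpace X] (n : ℕ) (y : Y) (x : X)
    (h : Function.Surjective (Hmap n (sliceL W y))) (z : H (n + 1) (X × Y)) :
    ∃ a b, z = Hmap (n + 1) (sliceL X y) a + Hmap (n + 1) (sliceR x Y) b := by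
  obtain ⟨w, hw⟩ := MVRel.exists_right (S.prod Y) z
  obtain ⟨w', rfl⟩ := h w
  have hA : Hmap n jA w' = 0 := by
    apply sliceL_injective n y
    rw [← Hmap_timesId_sliceL, hw.Hmap_left, map_zero]
  have hB : Hmap n jB w' = 0 := by
    apply sliceL_injective n y
    rw [← Hmap_timesId_sliceL, hw.Hmap_right, map_zero]
  -- The overlap class lies on a slice, so it already bounds in the square without the factor `Y`.
  -- Subtracting the resulting slice class leaves only classes from the contractible parts times
  -- `Y`.
  obtain ⟨x', hx'⟩ := MVRel.exists_left S hA hB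
  have h2 := hx'.map (jA' := timesId jA Y) (jB' := timesId jB Y) (iA' := timesId iA Y)
    (iB' := timesId iB Y) (fW := sliceL W y) (fA := sliceL A y) (fB := sliceL B y)
    (fX := sliceL X y) rfl rfl rfl rfl
  have h3 := hw.sub h2
  rw [sub_self] at h3
  obtain ⟨u, v, huv⟩ := h3.eq_add_of_zero (S.prod Y)
  obtain ⟨p⟩ := (inferInstance : Nonempty A)
  obtain ⟨q⟩ := (inferInstance : Nonempty B)
  have hu : ∀ b, Hmap (n + 1) (timesId iA Y) (Hmap (n + 1) (sliceR p Y) b) =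
      Hmap (n + 1) (sliceR x Y) b := fun b => by
    rw [Hmap_sliceR_congr (n + 1) (PathConnectedSpace.joined x (iA p)), ← Hmap_comp_apply]
    rfl
  have hv : ∀ b, Hmap (n + 1) (timesId iB Y) (Hmap (n + 1) (sliceR q Y) b) =
      Hmap (n + 1) (sliceR x Y) b := fun b => by
    rw [Hmap_sliceR_congr (n + 1) (PathConnectedSpace.joined x (iB q)), ← Hmap_comp_apply]
    rfl
  rw [exists_eq_sliceR_of_contractible _ u p, exists_eq_sliceR_of_contractible _ v q, hu, hv,
    ← map_add, sub_eq_iff_eq_add'] at huv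
  exact ⟨x', _, huv⟩

/-- The overlap is connected, so its H₀ injects into that of a part and the connecting class is
zero; the parts have no H₁. -/
theorem MVSquare.H_one_subsingleton [PathConnectedSpace W] : Subsingleton (H 1 X) := by
  have : Subsingleton (H 1 A) := H_subsingleton_of_contractible one_ne_zero
  have : Subsingleton (H 1 B) := H_subsingleton_of_contractible one_ne_zero
  refine subsingleton_of_forall_eq 0 fun x => ?_
  obtain ⟨w, hw⟩ := MVRel.exists_right S (n := 0) x
  have hw0 : w = 0 := Hmap_zero_injective_of_pathConnected jA (by rw [hw.Hmap_left, map_zero])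
  rw [hw0] at hw
  obtain ⟨u, v, rfl⟩ := hw.eq_add_of_zero S
  rw [Subsingleton.elim u 0, Subsingleton.elim v 0, map_zero, map_zero, add_zero]

/-- The multiples of `g` that die in both parts form a cyclic group; a lift of its generator `d • g`
generates. The order of `g` plays no role, and `g` need only generate the kernel of `jA`, which
matters when `n = 0`. -/
theorem MVSquare.exists_generator (n : ℕ) (g : H n W)
    (hg : ∀ w, Hmap n jA w = 0 → ∃ k : ℤ, w = k • g) :
    ∃ x₀ : H (n + 1) X, ∀ x, ∃ k : ℤ, x = k • x₀ := by
  have : Subsingleton (H (n + 1) A) := H_subsingleton_of_contractible n.succ_ne_zero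
  have : Subsingleton (H (n + 1) B) := H_subsingleton_of_contractible n.succ_ne_zero
  let K : AddSubgroup ℤ :=
    ((Hmap n jA).toAddMonoidHom.ker ⊓ (Hmap n jB).toAddMonoidHom.ker).comap
      (zmultiplesHom _ g)
  have hK : ∀ k : ℤ, k ∈ K ↔ Hmap n jA (k • g) = 0 ∧ Hmap n jB (k • g) = 0 := fun k => Iff.rfl
  obtain ⟨d, hd⟩ := Int.subgroup_cyclic K
  have hdK : d ∈ K := hd ▸ AddSubgroup.subset_closure rfl
  obtain ⟨x₀, hx₀⟩ := MVRel.exists_left S ((hK d).1 hdK).1 ((hK d).1 hdK).2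
  refine ⟨x₀, fun x => ?_⟩
  obtain ⟨w, hw⟩ := MVRel.exists_right S x
  obtain ⟨k, rfl⟩ := hg w hw.Hmap_left
  have hk : k ∈ K := (hK k).2 ⟨hw.Hmap_left, hw.Hmap_right⟩
  rw [hd, AddSubgroup.mem_closure_singleton] at hk
  obtain ⟨m, rfl⟩ := hk
  have h1 := hw.sub_smul hx₀ m
  rw [smul_eq_mul, mul_smul, sub_self] at h1
  obtain ⟨u, v, huv⟩ := h1.eq_add_of_zero S
  rw [Subsingleton.elim u 0, Subsingleton.elim v 0, map_zero, map_zero, add_zero,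
    sub_eq_zero] at huv
  exact ⟨m, huv⟩

end MayerVietoris

/-! ### Punctured vector spaces, built up one dimension at a time. -/

section Punctured

variable (F : Type) [NormedAddCommGroup F]

/-- A punctured vector space. -/
abbrev Punct : Type := {v : F // v ≠ 0}

/-- The complement of a closed ray. -/
abbrev PunctUp : Type := ({p | p.1 ≠ 0 ∨ 0 < p.2} : Set (F × ℝ))

/-- The complement of the opposite closed ray. -/
abbrev PunctDown : Type := ({p | p.1 ≠ 0 ∨ p.2 < 0} : Set (F × ℝ))

/-- The set is star-shaped about (0, 1). -/
instance [NormedSpace ℝ F] : ContractibleSpace (PunctUp F) := by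
  refine StarConvex.contractibleSpace (x := (0, 1)) ?_ ⟨(0, 1), Or.inr one_pos⟩
  intro y hy a b ha hb hab
  rcases hb.eq_or_lt with rfl | hb
  · exact Or.inr (by simp at hab; simp [hab])
  · rcases hy with hy | hy
    · exact Or.inl (by simpa [hb.ne'] using hy)
    · refine Or.inr ?_
      have := mul_pos hb hy
      simp
      linarith

instance [NormedSpace ℝ F] : ContractibleSpace (PunctDown F) := by
  refine StarConvex.contractibleSpace (x := (0, -1)) ?_ ⟨(0, -1), Or.inr (by norm_num)⟩
  intro y hy a b ha hb hab
  rcases hb.eq_or_lt with rfl | hb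
  · exact Or.inr (by simp at hab; simp [hab])
  · rcases hy with hy | hy
    · exact Or.inl (by simpa [hb.ne'] using hy)
    · refine Or.inr ?_
      have := mul_neg_of_pos_of_neg hb hy
      simp
      linarith

/-- The inclusion of the overlap in the complement of a ray. -/
def punctJUp : C(Punct F × ℝ, PunctUp F) :=
  ⟨fun p => ⟨(p.1.1, p.2), Or.inl p.1.2⟩, by fun_prop⟩

/-- The inclusion of the overlap in the complement of the opposite ray. -/
def punctJDown : C(Punct F × ℝ, PunctDown F) :=
  ⟨fun p => ⟨(p.1.1, p.2), Or.inl p.1.2⟩, by fun_prop⟩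

/-- The inclusion of the complement of a ray. -/
def punctIUp : C(PunctUp F, Punct (F × ℝ)) :=
  ⟨fun p => ⟨p.1, fun h => by simpa [h] using p.2⟩, by fun_prop⟩

/-- The inclusion of the complement of the opposite ray. -/
def punctIDown : C(PunctDown F, Punct (F × ℝ)) :=
  ⟨fun p => ⟨p.1, fun h => by simpa [h] using p.2⟩, by fun_prop⟩

theorem punctSquare : MVSquare (punctJUp F) (punctJDown F) (punctIUp F) (punctIDown F) where
  comm _ := rfl
  embA := by
    have ho : IsOpen ({p | p.1 ≠ 0 ∨ 0 < p.2} : Set (F × ℝ)) :=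
      (isOpen_ne_fun continuous_fst continuous_const).union
        (isOpen_lt continuous_const continuous_snd)
    exact IsOpenEmbedding.of_comp _ (isOpen_ne (x := (0 : F × ℝ))).isOpenEmbedding_subtypeVal
      ho.isOpenEmbedding_subtypeVal
  embB := by
    have ho : IsOpen ({p | p.1 ≠ 0 ∨ p.2 < 0} : Set (F × ℝ)) :=
      (isOpen_ne_fun continuous_fst continuous_const).union
        (isOpen_lt continuous_snd continuous_const)
    exact IsOpenEmbedding.of_comp _ (isOpen_ne (x := (0 : F × ℝ))).isOpenEmbedding_subtypeVal
      ho.isOpenEmbedding_subtypeVal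
  embW := by
    refine IsEmbedding.of_comp (ContinuousMap.continuous _) continuous_subtype_val ?_
    exact IsEmbedding.subtypeVal.prodMap IsEmbedding.id
  cover := by
    refine Set.eq_univ_of_forall fun p => ?_
    by_cases h : p.1.1 = 0
    · have h2 : p.1.2 ≠ 0 := fun h2 => p.2 (Prod.ext h h2)
      rcases h2.lt_or_gt with h2 | h2
      · exact Or.inr ⟨⟨p.1, Or.inr h2⟩, rfl⟩
      · exact Or.inl ⟨⟨p.1, Or.inr h2⟩, rfl⟩
    · exact Or.inl ⟨⟨p.1, Or.inl h⟩, rfl⟩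
  inter := by
    rintro p ⟨⟨a, rfl⟩, ⟨b, hb⟩⟩
    have hb' : b.1 = a.1 := congrArg Subtype.val hb
    have h1 : a.1.1 ≠ 0 := by
      intro h
      have h2 := a.2
      have h3 := b.2
      rw [hb'] at h3
      simp only [Set.mem_ofPred_eq, h, ne_eq, not_true_eq_false, false_or] at h2 h3
      exact absurd h2 h3.le.not_gt
    exact ⟨(⟨a.1.1, h1⟩, a.1.2), rfl⟩

/-- The zero section of the overlap. -/
def punctSec : C(Punct F, Punct F × ℝ) := sliceL (Punct F) 0

theorem punctSec_fst_homotopic :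
    ((punctSec F).comp ContinuousMap.fst).Homotopic (ContinuousMap.id _) := by
  refine ⟨⟨⟨fun p => (p.2.1, p.1.1 * p.2.2), by fun_prop⟩, fun p => ?_, fun p => ?_⟩⟩
  · simp [punctSec, sliceL]
  · simp

theorem punctSec_surjective (n : ℕ) : Function.Surjective (Hmap n (punctSec F)) := fun w =>
  ⟨Hmap n ContinuousMap.fst w, by
    rw [← Hmap_comp_apply, Hmap_congr n (punctSec_fst_homotopic F), Hmap_id]⟩

variable {F} [NormedSpace ℝ F] {Y : Type} [TopologicalSpace Y]

theorem Punct.exists_eq_sliceL_add_sliceR [PathConnectedSpace (Punct (F × ℝ))] (n : ℕ) (y : Y)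
    (x : Punct (F × ℝ)) (h : Function.Surjective (Hmap n (sliceL (Punct F) y)))
    (z : H (n + 1) (Punct (F × ℝ) × Y)) :
    ∃ a b, z = Hmap (n + 1) (sliceL _ y) a + Hmap (n + 1) (sliceR x Y) b :=
  (punctSquare F).exists_eq_sliceL_add_sliceR n y x
    (sliceL_surjective_of_retract (punctSec_fst_homotopic F) h) z

instance : PathConnectedSpace (Punct (ℝ × ℝ)) :=
  isPathConnected_iff_pathConnectedSpace.1
    (isPathConnected_compl_singleton_of_one_lt_rank (E := ℝ × ℝ) (by simp; norm_num) 0)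

instance : PathConnectedSpace (Punct ((ℝ × ℝ) × ℝ)) :=
  isPathConnected_iff_pathConnectedSpace.1
    (isPathConnected_compl_singleton_of_one_lt_rank (E := (ℝ × ℝ) × ℝ) (by simp; norm_num) 0)

theorem Punct.H_one_subsingleton : Subsingleton (H 1 (Punct ((ℝ × ℝ) × ℝ))) :=
  (punctSquare (ℝ × ℝ)).H_one_subsingleton

theorem Punct.H_one_prod [PathConnectedSpace Y] (x : Punct ((ℝ × ℝ) × ℝ))
    (z : H 1 (Punct ((ℝ × ℝ) × ℝ) × Y)) : ∃ b, z = Hmap 1 (sliceR x Y) b := by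
  obtain ⟨y⟩ := (inferInstance : Nonempty Y)
  obtain ⟨a, b, rfl⟩ := Punct.exists_eq_sliceL_add_sliceR 0 y x (sliceL_zero_surjective y) z
  have := Punct.H_one_subsingleton
  exact ⟨b, by rw [Subsingleton.elim a 0, map_zero, zero_add]⟩

/-- The splitting is used twice. For the punctured plane times `Y`, H₁(Y) = 0 leaves only slice
classes in degree 1, which is the hypothesis for degree 2 one dimension higher. -/
theorem Punct.H_two_prod [PathConnectedSpace Y] [Subsingleton (H 1 Y)] (y : Y)
    (x : Punct ((ℝ × ℝ) × ℝ)) (z : H 2 (Punct ((ℝ × ℝ) × ℝ) × Y)) :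
    ∃ a b, z = Hmap 2 (sliceL _ y) a + Hmap 2 (sliceR x Y) b := by
  refine Punct.exists_eq_sliceL_add_sliceR 1 y x (fun w => ?_) z
  obtain ⟨a, b, rfl⟩ := Punct.exists_eq_sliceL_add_sliceR 0 y ⟨(1, 0), by simp⟩
    (sliceL_zero_surjective y) w
  exact ⟨a, by rw [Subsingleton.elim b 0, map_zero, add_zero]⟩

/-- The overlap has two path components, with representatives `P` and `M`; the combinations of their
classes that die in a contractible part are the multiples of the difference. -/
theorem Punct.H_one_cyclic : ∃ g : H 1 (Punct (ℝ × ℝ)), ∀ x, ∃ k : ℤ, x = k • g := by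
  let P : Punct ℝ × ℝ := (⟨1, one_ne_zero⟩, 0)
  let M : Punct ℝ × ℝ := (⟨-1, by norm_num⟩, 0)
  refine (punctSquare ℝ).exists_generator 0 (pointCls P - pointCls M) fun w hw => ?_
  have h1 : w ∈ AddSubgroup.closure {pointCls P, pointCls M} := by
    refine mem_of_pointCls_mem (S := {P, M}) (fun y => ?_) ?_ w
    · have hseg : ∀ (q : Punct ℝ × ℝ), 0 < q.1.1 * y.1.1 → Joined q y := by
        intro q hq
        have hne : ∀ t : unitInterval, (1 - (t : ℝ)) * q.1.1 + t * y.1.1 ≠ 0 := by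
          intro t h
          have h0 := t.2.1
          have h1 := t.2.2
          -- Multiplying by the coordinate of `q` makes both summands nonnegative, and at least one
          -- of them is positive.
          have h2 : (1 - (t : ℝ)) * (q.1.1 * q.1.1) + t * (q.1.1 * y.1.1) = 0 := by
            linear_combination q.1.1 * h
          have h3 : 0 < q.1.1 * q.1.1 := mul_self_pos.2 q.1.2
          rcases h0.eq_or_lt with h0 | h0
          · rw [← h0] at h2; nlinarith
          · nlinarith [mul_pos h0 hq, mul_nonneg (sub_nonneg.2 h1) h3.le]
        refine ⟨⟨⟨fun t => (⟨(1 - (t : ℝ)) * q.1.1 + t * y.1.1, hne t⟩,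
          (1 - (t : ℝ)) * q.2 + t * y.2), by fun_prop⟩, ?_, ?_⟩⟩
        · simp
        · simp
      rcases y.1.2.lt_or_gt with h | h
      · exact ⟨M, Or.inr rfl, hseg M (by simpa [M] using h)⟩
      · exact ⟨P, Or.inl rfl, hseg P (by simpa [P] using h)⟩
    · rintro x (rfl | rfl)
      · exact AddSubgroup.subset_closure (Or.inl rfl)
      · exact AddSubgroup.subset_closure (Or.inr rfl)
  obtain ⟨k, l, rfl⟩ := AddSubgroup.mem_closure_pair.1 h1
  have h2 := congrArg (Hmap 0 (ContinuousMap.const _ ())) hw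
  rw [← Hmap_comp_apply, map_zero, map_add, map_zsmul, map_zsmul, Hmap_pointCls, Hmap_pointCls] at h2
  have h3 : (k + l) • ptCls = 0 := by
    rw [← Hmap_id 0 ptCls, add_zsmul]
    exact h2
  have h4 := zsmul_ptCls_eq_zero h3
  refine ⟨k, ?_⟩
  rw [zsmul_sub, eq_neg_of_add_eq_zero_right h4, neg_zsmul, sub_eq_add_neg]

theorem Punct.H_two_cyclic :
    ∃ g : H 2 (Punct ((ℝ × ℝ) × ℝ)), ∀ x, ∃ k : ℤ, x = k • g := by
  obtain ⟨g, hg⟩ := Punct.H_one_cyclic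
  refine (punctSquare (ℝ × ℝ)).exists_generator 1 (Hmap 1 (punctSec _) g) fun w _ => ?_
  obtain ⟨w', rfl⟩ := punctSec_surjective _ 1 w
  obtain ⟨k, rfl⟩ := hg w'
  exact ⟨k, map_zsmul _ _ _⟩

end Punctured

end SingularChains

end

noncomputable section

/-! ### Path spaces of the unit quaternions and the end point cover. -/

namespace SingularChains

open Topology unitInterval
open scoped Quaternion

/-- The unit quaternions. -/
abbrev S3 : Type := Metric.sphere (0 : Quaternion ℝ) 1

instance : Group S3 := inferInstance

instance : Mul S3 := inferInstance

instance : One S3 := inferInstance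

instance : Inv S3 := inferInstance

instance : IsTopologicalGroup S3 := inferInstance

instance : ContinuousMul S3 := inferInstance

instance : ContinuousInv S3 := inferInstance

instance : HasDistribNeg S3 := inferInstance

instance : Neg S3 := inferInstance

instance : ContinuousNeg S3 := inferInstance

/-- The paths of unit quaternions that start at `1`. -/
abbrev BasedPath : Type := {γ : C(I, S3) // γ 0 = 1}

/-- The paths of unit quaternions from `1` to `a`. -/
abbrev PathTo (a : S3) : Type := {γ : C(I, S3) // γ 0 = 1 ∧ γ 1 = a}

section Curry

variable {Z : Type} [TopologicalSpace Z]

/-- A family of based paths. -/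
def basedFamily (f : Z × I → S3) (hf : Continuous f) (h0 : ∀ z, f (z, 0) = 1) :
    C(Z, BasedPath) :=
  ⟨fun z => ⟨(ContinuousMap.curry ⟨f, hf⟩ z), h0 z⟩,
    (ContinuousMap.curry ⟨f, hf⟩).continuous.subtype_mk _⟩

/-- A family of paths with given end points. -/
def pathFamily {a : S3} (f : Z × I → S3) (hf : Continuous f) (h0 : ∀ z, f (z, 0) = 1)
    (h1 : ∀ z, f (z, 1) = a) : C(Z, PathTo a) :=
  ⟨fun z => ⟨(ContinuousMap.curry ⟨f, hf⟩ z), h0 z, h1 z⟩,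
    (ContinuousMap.curry ⟨f, hf⟩).continuous.subtype_mk _⟩

@[simp]
theorem basedFamily_apply (f : Z × I → S3) (hf : Continuous f) (h0 : ∀ z, f (z, 0) = 1) (z : Z)
    (t : I) : (basedFamily f hf h0 z).1 t = f (z, t) := rfl

@[simp]
theorem pathFamily_apply {a : S3} (f : Z × I → S3) (hf : Continuous f) (h0 : ∀ z, f (z, 0) = 1)
    (h1 : ∀ z, f (z, 1) = a) (z : Z) (t : I) : (pathFamily f hf h0 h1 z).1 t = f (z, t) := rfl

end Curry

theorem BasedPath.ext {γ δ : BasedPath} (h : ∀ t, γ.1 t = δ.1 t) : γ = δ :=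
  Subtype.ext (ContinuousMap.ext h)

theorem PathTo.ext {a : S3} {γ δ : PathTo a} (h : ∀ t, γ.1 t = δ.1 t) : γ = δ :=
  Subtype.ext (ContinuousMap.ext h)

/-- Shrink a path to its starting point through t ↦ γ((1 − s)t). -/
instance : ContractibleSpace BasedPath := by
  rw [contractible_iff_id_nullhomotopic]
  refine ⟨⟨ContinuousMap.const _ 1, rfl⟩, ⟨⟨basedFamily
    (fun p : (I × BasedPath) × I => p.1.2.1 (σ p.1.1 * p.2)) (by fun_prop) (fun z => ?_),
    fun γ => ?_, fun γ => ?_⟩⟩⟩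
  · simpa using z.2.2
  · exact BasedPath.ext fun t => by simp
  · exact BasedPath.ext fun t => by simpa using γ.2

/-- Normalisation of non-zero quaternions. -/
def nrm (q : {q : Quaternion ℝ // q ≠ 0}) : S3 :=
  ⟨‖q.1‖⁻¹ • q.1, by
    rw [mem_sphere_zero_iff_norm, norm_smul, norm_inv, norm_norm,
      inv_mul_cancel₀ (norm_ne_zero_iff.2 q.2)]⟩

theorem continuous_nrm : Continuous nrm := by
  refine Continuous.subtype_mk ?_ _
  exact (continuous_subtype_val.norm.inv₀ fun q => norm_ne_zero_iff.2 q.2).smul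
    continuous_subtype_val

theorem nrm_of_mem {q : Quaternion ℝ} (hq : q ≠ 0) (h : ‖q‖ = 1) :
    nrm ⟨q, hq⟩ = ⟨q, mem_sphere_zero_iff_norm.2 h⟩ := by
  apply Subtype.ext
  simp [nrm, h]

theorem S3.norm_coe (y : S3) : ‖(y : Quaternion ℝ)‖ = 1 := mem_sphere_zero_iff_norm.1 y.2

/-- If the segment from 1 to `y` meets 0, comparing norms forces t = 1/2, hence y = −1. -/
theorem segment_ne_zero {y : S3} (hy : y ≠ -1) (t : I) :
    (1 - (t : ℝ)) • (1 : Quaternion ℝ) + (t : ℝ) • (y : Quaternion ℝ) ≠ 0 := by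
  intro h
  have h1 := eq_neg_of_add_eq_zero_right h
  have h2 := congrArg norm h1
  rw [norm_neg, norm_smul, norm_smul, S3.norm_coe, norm_one, mul_one, mul_one, Real.norm_eq_abs,
    Real.norm_eq_abs, abs_of_nonneg t.2.1, abs_of_nonneg (sub_nonneg.2 t.2.2)] at h2
  have ht : (t : ℝ) = 1 / 2 := by linarith
  rw [ht, show (1 : ℝ) - 1 / 2 = 1 / 2 by norm_num, ← smul_neg] at h1
  exact hy (Subtype.ext (smul_right_injective _ (by norm_num : (1 / 2 : ℝ) ≠ 0) h1))

/-- The geodesic from `1` to a unit quaternion other than `-1`. -/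
def geod (p : {y : S3 // y ≠ -1} × I) : S3 := nrm ⟨_, segment_ne_zero p.1.2 p.2⟩

theorem continuous_geod : Continuous geod :=
  continuous_nrm.comp (Continuous.subtype_mk (by fun_prop) _)

@[fun_prop]
theorem Continuous.geod' {Z : Type} [TopologicalSpace Z] {f : Z → {y : S3 // y ≠ -1} × I}
    (hf : Continuous f) : Continuous fun z => geod (f z) := continuous_geod.comp hf

@[simp]
theorem geod_zero (y : {y : S3 // y ≠ -1}) : geod (y, 0) = 1 := by
  apply Subtype.ext
  simp [geod, nrm]

@[simp]
theorem geod_one (y : {y : S3 // y ≠ -1}) : geod (y, 1) = y := by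
  apply Subtype.ext
  simp [geod, nrm]

theorem neg_one_ne_one : (-1 : S3) ≠ 1 := fun h => by
  have h1 : (-(1 : Quaternion ℝ)).re = (1 : Quaternion ℝ).re :=
    congrArg (fun y : S3 => (y : Quaternion ℝ).re) h
  rw [Quaternion.re_neg, Quaternion.re_one] at h1
  norm_num at h1

/-- The negative of a unit quaternion other than `1`. -/
def negNe (y : {y : S3 // y ≠ 1}) : {y : S3 // y ≠ -1} := ⟨-y.1, fun h => y.2 (neg_injective h)⟩

@[fun_prop]
theorem continuous_negNe : Continuous negNe := continuous_subtype_val.neg.subtype_mk _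

/-- The unit quaternions other than `1` and `-1`. -/
abbrev S3pm : Type := {y : S3 // y ≠ 1 ∧ y ≠ -1}

/-- Forgetting that a quaternion is not `-1`. -/
def S3pm.neOne (y : S3pm) : {y : S3 // y ≠ 1} := ⟨y.1, y.2.1⟩

/-- Forgetting that a quaternion is not `1`. -/
def S3pm.neNegOne (y : S3pm) : {y : S3 // y ≠ -1} := ⟨y.1, y.2.2⟩

@[fun_prop]
theorem continuous_neOne : Continuous S3pm.neOne := by unfold S3pm.neOne; fun_prop

@[fun_prop]
theorem continuous_neNegOne : Continuous S3pm.neNegOne := by unfold S3pm.neNegOne; fun_prop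

theorem continuous_endpoint : Continuous fun γ : BasedPath => γ.1 1 := by fun_prop

/-- The based paths that do not end at `-1`, parametrised by loops and end points. -/
def endNearOne : C({y : S3 // y ≠ -1} × PathTo 1, BasedPath) :=
  basedFamily (fun p => p.1.2.1 p.2 * geod (p.1.1, p.2)) (by fun_prop)
    (fun z => by simp [z.2.2.1])

/-- The based paths that do not end at `1`, parametrised by paths to `-1` and end points. -/
def endNearNegOne : C({y : S3 // y ≠ 1} × PathTo (-1), BasedPath) :=
  basedFamily (fun p => p.1.2.1 p.2 * geod (negNe p.1.1, p.2)) (by fun_prop)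
    (fun z => by simp [z.2.2.1])

theorem endNearOne_endpoint (p : {y : S3 // y ≠ -1} × PathTo 1) :
    (endNearOne p).1 1 = p.1.1 := by
  simp [endNearOne, p.2.2.2]

theorem endNearNegOne_endpoint (p : {y : S3 // y ≠ 1} × PathTo (-1)) :
    (endNearNegOne p).1 1 = p.1.1 := by
  simp [endNearNegOne, p.2.2.2, negNe]

/-- The inverse of `endNearOne`. -/
def endNearOneInv : C({γ : BasedPath // γ.1 1 ≠ -1}, {y : S3 // y ≠ -1} × PathTo 1) :=
  ⟨fun γ => (⟨γ.1.1 1, γ.2⟩, pathFamily (Z := {γ : BasedPath // γ.1 1 ≠ -1})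
    (fun p => p.1.1.1 p.2 * (geod (⟨p.1.1.1 1, p.1.2⟩, p.2))⁻¹) (by fun_prop)
    (fun z => by simp [z.1.2]) (fun z => by simp) γ), by fun_prop⟩

/-- The inverse of `endNearNegOne`. -/
def endNearNegOneInv : C({γ : BasedPath // γ.1 1 ≠ 1}, {y : S3 // y ≠ 1} × PathTo (-1)) :=
  ⟨fun γ => (⟨γ.1.1 1, γ.2⟩, pathFamily (Z := {γ : BasedPath // γ.1 1 ≠ 1})
    (fun p => p.1.1.1 p.2 * (geod (negNe ⟨p.1.1.1 1, p.1.2⟩, p.2))⁻¹) (by fun_prop)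
    (fun z => by simp [z.1.2]) (fun z => by
      simp only [geod_one]
      rw [negNe, mul_inv_eq_iff_eq_mul, neg_mul_neg, one_mul]) γ), by fun_prop⟩

/-- The paths that do not end at `-1` are a product. -/
def endNearOneHomeo : {y : S3 // y ≠ -1} × PathTo 1 ≃ₜ {γ : BasedPath // γ.1 1 ≠ -1} where
  toFun p := ⟨endNearOne p, by rw [endNearOne_endpoint]; exact p.1.2⟩
  invFun := endNearOneInv
  left_inv p := by
    have h := endNearOne_endpoint p
    refine Prod.ext (Subtype.ext h) (PathTo.ext fun t => ?_)
    simp only [endNearOneInv, ContinuousMap.coe_mk, pathFamily_apply, h]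
    simp [endNearOne]
  right_inv γ := Subtype.ext (BasedPath.ext fun t => by simp [endNearOne, endNearOneInv])
  continuous_toFun := by fun_prop
  continuous_invFun := endNearOneInv.continuous

/-- The paths that do not end at `1` are a product. -/
def endNearNegOneHomeo : {y : S3 // y ≠ 1} × PathTo (-1) ≃ₜ {γ : BasedPath // γ.1 1 ≠ 1} where
  toFun p := ⟨endNearNegOne p, by rw [endNearNegOne_endpoint]; exact p.1.2⟩
  invFun := endNearNegOneInv
  left_inv p := by
    have h := endNearNegOne_endpoint p
    refine Prod.ext (Subtype.ext h) (PathTo.ext fun t => ?_)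
    simp only [endNearNegOneInv, ContinuousMap.coe_mk, pathFamily_apply, h]
    simp [endNearNegOne]
  right_inv γ := Subtype.ext (BasedPath.ext fun t => by simp [endNearNegOne, endNearNegOneInv])
  continuous_toFun := by fun_prop
  continuous_invFun := endNearNegOneInv.continuous

/-- The overlap in the paths that do not end at `-1`. -/
def overlapOne : C(S3pm × PathTo 1, {y : S3 // y ≠ -1} × PathTo 1) :=
  ⟨fun p => (p.1.neNegOne, p.2), by fun_prop⟩

/-- The change of fibre coordinates on the overlap. -/
def clutching : C(S3pm × PathTo 1, PathTo (-1)) :=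
  pathFamily (fun p => p.1.2.1 p.2 * geod (p.1.1.neNegOne, p.2) *
    (geod (negNe p.1.1.neOne, p.2))⁻¹) (by fun_prop)
    (fun z => by simp [z.2.2.1]) (fun z => by
      simp only [geod_one, z.2.2.2, one_mul]
      rw [negNe, mul_inv_eq_iff_eq_mul, neg_mul_neg, one_mul]; rfl)

/-- The overlap in the paths that do not end at `1`. -/
def overlapNegOne : C(S3pm × PathTo 1, {y : S3 // y ≠ 1} × PathTo (-1)) :=
  ⟨fun p => (p.1.neOne, clutching p), by fun_prop⟩

/-- Multiplying by a geodesic, or by the geodesic to the negated end point, moves the fibres over 1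
and −1 to the other end points. Each part is thus an open subspace, and the end points 1 and −1 are
never both missed. -/
theorem pathSquare : MVSquare overlapNegOne overlapOne endNearNegOne endNearOne := by
  have hcomm : ∀ w, endNearNegOne (overlapNegOne w) = endNearOne (overlapOne w) := fun w =>
    BasedPath.ext fun t => by
      simp [endNearNegOne, endNearOne, overlapNegOne, overlapOne, clutching]
  have hO : IsOpenEmbedding endNearOne := by
    have h1 : IsOpen {γ : BasedPath | γ.1 1 ≠ -1} :=
      isOpen_ne_fun continuous_endpoint continuous_const
    exact h1.isOpenEmbedding_subtypeVal.comp endNearOneHomeo.isOpenEmbedding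
  have hN : IsOpenEmbedding endNearNegOne := by
    have h1 : IsOpen {γ : BasedPath | γ.1 1 ≠ 1} :=
      isOpen_ne_fun continuous_endpoint continuous_const
    exact h1.isOpenEmbedding_subtypeVal.comp endNearNegOneHomeo.isOpenEmbedding
  have hrO : ∀ γ : BasedPath, γ.1 1 ≠ -1 → γ ∈ Set.range endNearOne := fun γ h =>
    ⟨endNearOneHomeo.symm ⟨γ, h⟩, congrArg Subtype.val (endNearOneHomeo.apply_symm_apply ⟨γ, h⟩)⟩
  have hrN : ∀ γ : BasedPath, γ.1 1 ≠ 1 → γ ∈ Set.range endNearNegOne := fun γ h =>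
    ⟨endNearNegOneHomeo.symm ⟨γ, h⟩,
      congrArg Subtype.val (endNearNegOneHomeo.apply_symm_apply ⟨γ, h⟩)⟩
  have hj : IsEmbedding overlapOne := by
    have h1 : IsEmbedding S3pm.neNegOne :=
      IsEmbedding.of_comp continuous_neNegOne continuous_subtype_val IsEmbedding.subtypeVal
    exact h1.prodMap IsEmbedding.id
  refine ⟨hcomm, hN, hO, ?_, ?_, ?_⟩
  · have : endNearNegOne.comp overlapNegOne = endNearOne.comp overlapOne := by
      ext1 w; exact hcomm w
    rw [this]
    exact hO.isEmbedding.comp hj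
  · refine Set.eq_univ_of_forall fun γ => ?_
    by_cases h : γ.1 1 = 1
    · exact Or.inr (hrO γ (by rw [h]; exact neg_one_ne_one.symm))
    · exact Or.inl (hrN γ h)
  · rintro γ ⟨⟨a, ha⟩, ⟨b, rfl⟩⟩
    have h1 := endNearOne_endpoint b
    have h2 : b.1.1 ≠ 1 := by
      rw [← h1, ← ha, endNearNegOne_endpoint]
      exact a.1.2
    exact ⟨(⟨b.1.1, h2, b.1.2⟩, b.2), hcomm _⟩

/-! ### The punctured three-sphere -/

/-- The imaginary part of a unit quaternion other than `1` and `-1`. -/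
def imPart : C(S3pm, Punct ((ℝ × ℝ) × ℝ)) :=
  ⟨fun y => ⟨((y.1.1.imI, y.1.1.imJ), y.1.1.imK), fun h => by
    have h1 : y.1.1.imI = 0 := congrArg (fun v => v.1.1) h
    have h2 : y.1.1.imJ = 0 := congrArg (fun v => v.1.2) h
    have h3 : y.1.1.imK = 0 := congrArg (fun v => v.2) h
    have h4 := Quaternion.normSq_eq_norm_mul_self y.1.1
    rw [S3.norm_coe, Quaternion.normSq_def', h1, h2, h3] at h4
    have h5 : (y.1.1.re - 1) * (y.1.1.re + 1) = 0 := by linear_combination h4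
    rcases mul_eq_zero.1 h5 with h5 | h5
    · refine y.2.1 (Subtype.ext (Quaternion.ext _ _ (sub_eq_zero.1 h5) h1 h2 h3))
    · refine y.2.2 (Subtype.ext (Quaternion.ext _ _ ((eq_neg_of_add_eq_zero_left h5).trans ?_)
        (h1.trans ?_) (h2.trans ?_) (h3.trans ?_)))
      all_goals simp⟩, by
    refine Continuous.subtype_mk ?_ _
    have h := continuous_subtype_val.comp (continuous_subtype_val (p := fun y : S3 => y ≠ 1 ∧ y ≠ -1))
    exact ((Quaternion.continuous_imI.comp h).prodMk (Quaternion.continuous_imJ.comp h)).prodMk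
      (Quaternion.continuous_imK.comp h)⟩

end SingularChains

end

noncomputable section

/-! ### The two-sphere as a deformation retract. -/

namespace SingularChains

open Topology unitInterval
open scoped Quaternion

theorem continuous_vec3 {Z : Type} [TopologicalSpace Z] {a b c : Z → ℝ} (ha : Continuous a)
    (hb : Continuous b) (hc : Continuous c) : Continuous fun z => !₂[a z, b z, c z] := by
  refine (PiLp.continuous_toLp 2 _).comp (continuous_pi fun i => ?_)
  fin_cases i <;> assumption

/-- The quaternion with given coordinates. -/
def mkQuat (a b c d : ℝ) : Quaternion ℝ := ⟨a, b, c, d⟩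

@[simp] theorem mkQuat_re (a b c d : ℝ) : (mkQuat a b c d).re = a := rfl

@[simp] theorem mkQuat_imI (a b c d : ℝ) : (mkQuat a b c d).imI = b := rfl

@[simp] theorem mkQuat_imJ (a b c d : ℝ) : (mkQuat a b c d).imJ = c := rfl

@[simp] theorem mkQuat_imK (a b c d : ℝ) : (mkQuat a b c d).imK = d := rfl

theorem continuous_quat {Z : Type} [TopologicalSpace Z] {a b c d : Z → ℝ} (ha : Continuous a)
    (hb : Continuous b) (hc : Continuous c) (hd : Continuous d) :
    Continuous fun z => mkQuat (a z) (b z) (c z) (d z) := by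
  refine Quaternion.linearIsometryEquivTuple.symm.continuous.comp
    (?_ : Continuous fun z => !₂[a z, b z, c z, d z])
  refine (PiLp.continuous_toLp 2 _).comp (continuous_pi fun i => ?_)
  fin_cases i <;> assumption

/-- A point of punctured three-space as a vector. -/
def Punct.vec (v : Punct ((ℝ × ℝ) × ℝ)) : EuclideanSpace ℝ (Fin 3) :=
  !₂[v.1.1.1, v.1.1.2, v.1.2]

theorem Punct.continuous_vec : Continuous Punct.vec :=
  continuous_vec3 (by fun_prop) (by fun_prop) (by fun_prop)

theorem Punct.vec_ne_zero (v : Punct ((ℝ × ℝ) × ℝ)) : v.vec ≠ 0 := fun h => v.2 (by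
  have h0 := congrArg (fun x : EuclideanSpace ℝ (Fin 3) => x 0) h
  have h1 := congrArg (fun x : EuclideanSpace ℝ (Fin 3) => x 1) h
  have h2 := congrArg (fun x : EuclideanSpace ℝ (Fin 3) => x 2) h
  exact Prod.ext (Prod.ext h0 h1) h2)

theorem Punct.unit_mem (v : Punct ((ℝ × ℝ) × ℝ)) :
    ‖v.vec‖⁻¹ • v.vec ∈ Metric.sphere (0 : EuclideanSpace ℝ (Fin 3)) 1 := by
  rw [mem_sphere_zero_iff_norm, norm_smul, norm_inv, norm_norm,
    inv_mul_cancel₀ (norm_ne_zero_iff.2 v.vec_ne_zero)]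

/-- The projection of punctured three-space to the unit sphere. -/
def toSphere : C(Punct ((ℝ × ℝ) × ℝ), S2) :=
  ⟨fun v => ⟨‖v.vec‖⁻¹ • v.vec, v.unit_mem⟩,
    Continuous.subtype_mk ((Punct.continuous_vec.norm.inv₀
      fun v => norm_ne_zero_iff.2 v.vec_ne_zero).smul Punct.continuous_vec) Punct.unit_mem⟩

theorem S2.coords_ne_zero (p : S2) : ((p.1 0, p.1 1), p.1 2) ≠ ((0 : (ℝ × ℝ) × ℝ)) := fun h => by
  have h0 : p.1 0 = 0 := congrArg (fun v => v.1.1) h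
  have h1 : p.1 1 = 0 := congrArg (fun v => v.1.2) h
  have h2 : p.1 2 = 0 := congrArg (fun v => v.2) h
  have h3 := S2.sum_sq p
  rw [h0, h1, h2] at h3
  norm_num at h3

/-- The inclusion of the unit sphere in punctured three-space. -/
def ofSphere : C(S2, Punct ((ℝ × ℝ) × ℝ)) :=
  ⟨fun p => ⟨((p.1 0, p.1 1), p.1 2), S2.coords_ne_zero p⟩, by fun_prop⟩

theorem toSphere_comp_ofSphere : toSphere.comp ofSphere = ContinuousMap.id S2 := by
  ext1 p
  have h : (ofSphere p).vec = p.1 := by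
    ext i
    fin_cases i <;> rfl
  apply Subtype.ext
  change ‖(ofSphere p).vec‖⁻¹ • (ofSphere p).vec = p.1
  rw [h, mem_sphere_zero_iff_norm.1 p.2, inv_one, one_smul]

theorem H_two_sphere_cyclic : ∃ g : H 2 S2, ∀ x, ∃ k : ℤ, x = k • g := by
  obtain ⟨g, hg⟩ := Punct.H_two_cyclic
  refine ⟨Hmap 2 toSphere g, fun x => ?_⟩
  obtain ⟨k, hk⟩ := hg (Hmap 2 ofSphere x)
  refine ⟨k, ?_⟩
  rw [← map_zsmul, ← hk, ← Hmap_comp_apply, toSphere_comp_ofSphere, Hmap_id]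

/-- The pure unit quaternion of a point of the sphere. -/
def pureQuat (p : S2) : Quaternion ℝ := mkQuat 0 (p.1 0) (p.1 1) (p.1 2)

@[fun_prop]
theorem continuous_pureQuat : Continuous pureQuat :=
  continuous_quat (by fun_prop) (by fun_prop) (by fun_prop) (by fun_prop)

theorem norm_quat_eq_one_iff {q : Quaternion ℝ} :
    ‖q‖ = 1 ↔ q.re ^ 2 + q.imI ^ 2 + q.imJ ^ 2 + q.imK ^ 2 = 1 := by
  rw [← Quaternion.normSq_def', Quaternion.normSq_eq_norm_mul_self]
  constructor
  · intro h; rw [h, one_mul]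
  · intro h
    nlinarith [norm_nonneg q]

theorem pureQuat_mem (p : S2) : pureQuat p ∈ Metric.sphere (0 : Quaternion ℝ) 1 :=
  mem_sphere_zero_iff_norm.2 (norm_quat_eq_one_iff.2 (by
    have := S2.sum_sq p
    simp only [pureQuat, mkQuat_re, mkQuat_imI, mkQuat_imJ, mkQuat_imK]
    linarith))

theorem pureQuat_ne (p : S2) :
    (⟨pureQuat p, pureQuat_mem p⟩ : S3) ≠ 1 ∧ (⟨pureQuat p, pureQuat_mem p⟩ : S3) ≠ -1 := by
  constructor <;> intro h
  · have h1 : (0 : ℝ) = (1 : Quaternion ℝ).re := congrArg (fun y : S3 => y.1.re) h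
    simp at h1
  · have h1 : (0 : ℝ) = (-1 : Quaternion ℝ).re := congrArg (fun y : S3 => y.1.re) h
    simp at h1

/-- The pure unit quaternions, as a sphere in the punctured three-sphere. -/
def pureS3pm : C(S2, S3pm) :=
  ⟨fun p => ⟨⟨pureQuat p, pureQuat_mem p⟩, pureQuat_ne p⟩,
    (continuous_pureQuat.subtype_mk pureQuat_mem).subtype_mk pureQuat_ne⟩

theorem imPart_ne_zero (y : S3pm) {q : Quaternion ℝ} (hI : q.imI = y.1.1.imI)
    (hJ : q.imJ = y.1.1.imJ) (hK : q.imK = y.1.1.imK) : q ≠ 0 := by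
  rintro rfl
  refine (imPart y).2 (Prod.ext (Prod.ext hI.symm hJ.symm) hK.symm)

theorem nrm_ne {q : Quaternion ℝ} (hq : q ≠ 0) {y : S3pm} (hI : q.imI = y.1.1.imI)
    (hJ : q.imJ = y.1.1.imJ) (hK : q.imK = y.1.1.imK) : nrm ⟨q, hq⟩ ≠ 1 ∧ nrm ⟨q, hq⟩ ≠ -1 := by
  have hn : ‖q‖⁻¹ ≠ 0 := inv_ne_zero (norm_ne_zero_iff.2 hq)
  have key : ∀ r : Quaternion ℝ, r.imI = 0 → r.imJ = 0 → r.imK = 0 → ‖q‖⁻¹ • q ≠ r := by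
    rintro r hrI hrJ hrK rfl
    rw [Quaternion.imI_smul, smul_eq_mul, mul_eq_zero, or_iff_right hn] at hrI
    rw [Quaternion.imJ_smul, smul_eq_mul, mul_eq_zero, or_iff_right hn] at hrJ
    rw [Quaternion.imK_smul, smul_eq_mul, mul_eq_zero, or_iff_right hn] at hrK
    exact imPart_ne_zero y (q := 0) (by rw [← hI, hrI]; rfl) (by rw [← hJ, hrJ]; rfl)
      (by rw [← hK, hrK]; rfl) rfl
  exact ⟨fun h => key 1 rfl rfl rfl (congrArg Subtype.val h),
    fun h => key (-1) (by simp) (by simp) (by simp) (congrArg Subtype.val h)⟩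

/-- Scale the real part by the homotopy parameter and renormalise: at 0 only the normalised
imaginary part is left, and at 1 the quaternion is unchanged. -/
theorem pureS3pm_retract :
    ((pureS3pm.comp toSphere).comp imPart).Homotopic (ContinuousMap.id S3pm) := by
  let f : I × S3pm → Quaternion ℝ := fun p =>
    mkQuat (p.1 * p.2.1.1.re) p.2.1.1.imI p.2.1.1.imJ p.2.1.1.imK
  have hf : Continuous f := by
    have h : Continuous fun p : I × S3pm => p.2.1.1 := by fun_prop
    have h1 : Continuous fun p : I × S3pm => (p.1 : ℝ) := by fun_prop
    exact continuous_quat (h1.mul (Quaternion.continuous_re.comp h))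
      (Quaternion.continuous_imI.comp h) (Quaternion.continuous_imJ.comp h)
      (Quaternion.continuous_imK.comp h)
  have hf0 : ∀ p, f p ≠ 0 := fun p => imPart_ne_zero p.2 rfl rfl rfl
  refine ⟨⟨⟨fun p => ⟨nrm ⟨f p, hf0 p⟩, nrm_ne (hf0 p) rfl rfl rfl⟩,
    (continuous_nrm.comp (hf.subtype_mk _)).subtype_mk _⟩, fun y => ?_, fun y => ?_⟩⟩
  · have hn : ‖f (0, y)‖ = ‖(imPart y).vec‖ := by
      rw [EuclideanSpace.norm_eq, Fin.sum_univ_three, eq_comm, Real.sqrt_eq_iff_mul_self_eq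
        (by positivity) (norm_nonneg _), ← Quaternion.normSq_eq_norm_mul_self,
        Quaternion.normSq_def']
      simp [f, imPart, Punct.vec]
    apply Subtype.ext
    apply Subtype.ext
    change ‖f (0, y)‖⁻¹ • f (0, y) = pureQuat (toSphere (imPart y))
    rw [hn]
    apply Quaternion.ext <;> simp [f, pureQuat, toSphere, imPart, Punct.vec]
  · apply Subtype.ext
    have h1 : f (1, y) = y.1.1 := by
      apply Quaternion.ext <;> simp [f]
    change nrm _ = y.1
    have h2 : ‖f (1, y)‖ = 1 := by rw [h1]; exact S3.norm_coe _
    exact (nrm_of_mem _ h2).trans (Subtype.ext h1)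

end SingularChains

end

noncomputable section

/-! ### Meridians generate the second homology of the paths to −1. -/

namespace SingularChains

open Topology unitInterval
open scoped Quaternion

instance : PathConnectedSpace S2 :=
  Function.Surjective.pathConnectedSpace (f := toSphere)
    (fun p => ⟨ofSphere p, DFunLike.congr_fun toSphere_comp_ofSphere p⟩) toSphere.continuous

instance : PathConnectedSpace S3pm := by
  obtain ⟨F⟩ := pureS3pm_retract
  have key : ∀ y : S3pm, Joined (pureS3pm southPole) y := fun y =>
    ((PathConnectedSpace.joined southPole (toSphere (imPart y))).map pureS3pm.continuous).trans
      ⟨F.evalAt y⟩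
  exact ⟨⟨pureS3pm southPole⟩, fun x y => (key x).symm.trans (key y)⟩

/-- A homology class of the paths to `-1` that dies among the based paths comes from the overlap,
from a class that dies among the loops. -/
theorem exists_Hmap_clutching (n : ℕ) (c : H n (PathTo (-1)))
    (h : Hmap n endNearNegOne (Hmap n (sliceR ⟨-1, neg_one_ne_one⟩ (PathTo (-1))) c) = 0) :
    ∃ w : H n (S3pm × PathTo 1), Hmap n clutching w = c ∧ Hmap n ContinuousMap.snd w = 0 := by
  obtain ⟨w, h1, h2⟩ := pathSquare.exists_of_Hmap_eq (n := n) (v := 0) (h.trans (map_zero _).symm)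
  refine ⟨w, ?_, ?_⟩
  · have h3 := congrArg (Hmap n ContinuousMap.snd) h1
    rw [Hmap_snd_sliceR, ← Hmap_comp_apply] at h3
    exact h3
  · have h3 := congrArg (Hmap n ContinuousMap.snd) h2
    rw [map_zero, ← Hmap_comp_apply] at h3
    exact h3

theorem eq_zero_of_Hmap_snd_zero {X Y : Type} [TopologicalSpace X] [TopologicalSpace Y]
    [PathConnectedSpace X] (z : H 0 (X × Y)) (h : Hmap 0 ContinuousMap.snd z = 0) : z = 0 := by
  obtain ⟨x⟩ := (inferInstance : Nonempty X)
  have hs : Function.Surjective (Hmap 0 (sliceR x Y)) := Hmap_zero_surjective fun p => ⟨p.2, by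
    obtain ⟨γ⟩ := PathConnectedSpace.joined x p.1
    exact ⟨⟨⟨fun t => (γ t, p.2), by fun_prop⟩, by simp [sliceR], by simp⟩⟩⟩
  obtain ⟨b, rfl⟩ := hs z
  rw [Hmap_snd_sliceR] at h
  rw [h, map_zero]

/-- The unit quaternion `cos θ + sin θ p`. -/
def rotor (p : S2) (θ : ℝ) : S3 :=
  ⟨mkQuat (Real.cos θ) (Real.sin θ * p.1 0) (Real.sin θ * p.1 1) (Real.sin θ * p.1 2),
    mem_sphere_zero_iff_norm.2 (norm_quat_eq_one_iff.2 (by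
      have h1 := S2.sum_sq p
      have h2 := Real.sin_sq_add_cos_sq θ
      simp only [mkQuat_re, mkQuat_imI, mkQuat_imJ, mkQuat_imK]
      linear_combination h2 + Real.sin θ ^ 2 * h1))⟩

@[fun_prop]
theorem Continuous.rotor {Z : Type} [TopologicalSpace Z] {f : Z → S2} {g : Z → ℝ}
    (hf : Continuous f) (hg : Continuous g) : Continuous fun z => rotor (f z) (g z) :=
  Continuous.subtype_mk (continuous_quat (by fun_prop) (by fun_prop) (by fun_prop) (by fun_prop)) _

theorem rotor_add (p : S2) (θ φ : ℝ) : rotor p (θ + φ) = rotor p θ * rotor p φ := by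
  apply Subtype.ext
  have h1 := S2.sum_sq p
  apply Quaternion.ext
  · simp [rotor, Real.cos_add]
    linear_combination (Real.sin θ * Real.sin φ) * h1
  · simp [rotor, Real.sin_add]; ring
  · simp [rotor, Real.sin_add]; ring
  · simp [rotor, Real.sin_add]; ring

@[simp]
theorem rotor_zero (p : S2) : rotor p 0 = 1 := by
  apply Subtype.ext
  apply Quaternion.ext <;> simp [rotor]

@[simp]
theorem rotor_pi (p : S2) : rotor p Real.pi = -1 := by
  apply Subtype.ext
  apply Quaternion.ext <;> simp [rotor]

theorem rotor_neg (p : S2) (θ : ℝ) : rotor p (-θ) = (rotor p θ)⁻¹ := by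
  rw [eq_inv_iff_mul_eq_one, ← rotor_add, neg_add_cancel, rotor_zero]

/-- The path from `1` to `-1` through `p`. -/
def meridian : C(S2, PathTo (-1)) :=
  pathFamily (fun z => rotor z.1 (Real.pi * z.2)) (by fun_prop) (by simp) (by simp)

/-- The angle of the point of the segment from `1` to `i`. -/
def segAngle (t : I) : ℝ := Complex.arg ⟨1 - t, t⟩

@[fun_prop]
theorem continuous_segAngle : Continuous segAngle := by
  rw [continuous_iff_continuousAt]
  intro t
  have h : (⟨1 - t, t⟩ : ℂ) ∈ Complex.slitPlane := by
    rw [Complex.mem_slitPlane_iff]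
    by_cases ht : (t : ℝ) = 0
    · left; simp [ht]
    · exact Or.inr ht
  refine ContinuousAt.comp (f := fun t : I => (⟨1 - t, t⟩ : ℂ)) (Complex.continuousAt_arg h) ?_
  have : (fun t : I => (⟨1 - t, t⟩ : ℂ)) = fun t : I => Complex.equivRealProdCLM.symm (1 - (t : ℝ), (t : ℝ)) := by
    ext t
    simp [Complex.equivRealProdCLM_symm_apply, Complex.ext_iff]
  rw [this]
  fun_prop

theorem segAngle_zero : segAngle 0 = 0 := by
  have : (⟨1 - (0 : I), (0 : I)⟩ : ℂ) = 1 := by apply Complex.ext <;> simp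
  rw [segAngle, this, Complex.arg_one]

theorem segAngle_one : segAngle 1 = Real.pi / 2 := by
  have : (⟨1 - (1 : I), (1 : I)⟩ : ℂ) = Complex.I := by apply Complex.ext <;> simp
  rw [segAngle, this, Complex.arg_I]

/-- The segment from 1 to ±p lies in the plane spanned by 1 and p, a copy of ℂ in which normalising
only keeps the argument. -/
theorem geod_eq_rotor (y : {y : S3 // y ≠ -1}) (p : S2) (ε : ℝ) (hε : ε = 1 ∨ ε = -1)
    (hy : (y.1 : Quaternion ℝ) = ε • pureQuat p) (t : I) :
    geod (y, t) = rotor p (ε * segAngle t) := by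
  have hc := Complex.norm_mul_cos_arg ⟨1 - t, t⟩
  have hs := Complex.norm_mul_sin_arg ⟨1 - t, t⟩
  change _ * Real.cos (segAngle t) = 1 - (t : ℝ) at hc
  change _ * Real.sin (segAngle t) = (t : ℝ) at hs
  set r : ℝ := ‖(⟨1 - t, t⟩ : ℂ)‖
  have hq : (1 - (t : ℝ)) • (1 : Quaternion ℝ) + (t : ℝ) • (y.1 : Quaternion ℝ) =
      r • (rotor p (ε * segAngle t)).1 := by
    rw [hy]
    rcases hε with rfl | rfl
    · apply Quaternion.ext <;>
        simp [rotor, pureQuat, ← hc, ← mul_assoc, hs]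
    · apply Quaternion.ext <;>
        simp [rotor, pureQuat, ← hc, ← mul_assoc, hs]
  have hr0 : r ≠ 0 := fun h => segment_ne_zero y.2 t (by rw [hq, h, zero_smul])
  apply Subtype.ext
  simp only [geod, nrm]
  rw [hq, norm_smul, S3.norm_coe, mul_one, smul_smul, Real.norm_eq_abs, abs_of_nonneg (norm_nonneg _),
    inv_mul_cancel₀ hr0, one_smul]

/-- The constant loop. -/
def constLoop : PathTo 1 := ⟨ContinuousMap.const I 1, rfl, rfl⟩

/-- At the constant loop, clutching along p is the geodesic to p times the inverse of the geodesic
to −p, a rotor of angle `2 * segAngle`. That angle runs from 0 to π, so it can be interpolated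
linearly to πt with fixed ends. -/
theorem clutching_homotopic_meridian :
    ((clutching.comp (sliceL S3pm constLoop)).comp pureS3pm).Homotopic meridian := by
  refine ⟨⟨pathFamily (fun z : (I × S2) × I => rotor z.1.2
      ((1 - (z.1.1 : ℝ)) * (2 * segAngle z.2) + z.1.1 * (Real.pi * z.2)))
      (by fun_prop) (fun z => by simp [segAngle_zero]) (fun z => ?_), fun p => ?_, fun p => ?_⟩⟩
  · have : (1 - (z.1 : ℝ)) * (2 * segAngle 1) + z.1 * (Real.pi * ((1 : I) : ℝ)) = Real.pi := by
      rw [segAngle_one]; simp; ring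
    simp only [this, rotor_pi]
  · apply PathTo.ext
    intro t
    have h1 := geod_eq_rotor (pureS3pm p).neNegOne p 1 (Or.inl rfl) (one_smul _ _).symm t
    have h2 := geod_eq_rotor (negNe (pureS3pm p).neOne) p (-1) (Or.inr rfl)
      (by simp [negNe, S3pm.neOne, pureS3pm]) t
    change rotor p ((1 - ((0 : I) : ℝ)) * (2 * segAngle t) + ((0 : I) : ℝ) * (Real.pi * t)) =
      (1 : S3) * geod ((pureS3pm p).neNegOne, t) *
      (geod (negNe (pureS3pm p).neOne, t))⁻¹
    rw [h1, h2, ← rotor_neg, one_mul, ← rotor_add]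
    congr 1
    simp
    ring
  · apply PathTo.ext
    intro t
    simp [meridian]

/-- The difference of two point classes dies among the based paths, hence comes from an overlap
class whose projection to the loops is 0. Since the other factor of the overlap is path connected,
that class is 0. -/
instance : PathConnectedSpace (PathTo (-1)) := by
  refine ⟨⟨meridian southPole⟩, fun a b => joined_of_pointCls_eq ?_⟩
  obtain ⟨w, h1, h2⟩ := exists_Hmap_clutching 0 (pointCls a - pointCls b) (by
    rw [map_sub, map_sub, Hmap_pointCls, Hmap_pointCls, Hmap_pointCls, Hmap_pointCls,
      pointCls_eq (PathConnectedSpace.joined _ (endNearNegOne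
        (sliceR ⟨-1, neg_one_ne_one⟩ (PathTo (-1)) b))), sub_self])
  rw [eq_zero_of_Hmap_snd_zero w h2, map_zero] at h1
  exact sub_eq_zero.1 h1.symm

/-- Pointwise multiplication by a fixed path. -/
def mulPath {a b c : S3} (m : PathTo b) (h : a * b = c) : PathTo a ≃ₜ PathTo c where
  toFun := pathFamily (Z := PathTo a) (fun z => z.1.1 z.2 * m.1 z.2) (by fun_prop)
    (fun z => by simp [z.2.1, m.2.1]) (fun z => by simp [z.2.2, m.2.2, h])
  invFun := pathFamily (Z := PathTo c) (fun z => z.1.1 z.2 * (m.1 z.2)⁻¹) (by fun_prop)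
    (fun z => by simp [z.2.1, m.2.1]) (fun z => by simp [z.2.2, m.2.2, ← h])
  left_inv γ := PathTo.ext fun t => by simp
  right_inv γ := PathTo.ext fun t => by simp
  continuous_toFun := (pathFamily _ _ _ _).continuous
  continuous_invFun := (pathFamily _ _ _ _).continuous

theorem mulPath_apply {a b c : S3} (m : PathTo b) (h : a * b = c) (γ : PathTo a) (t : I) :
    (mulPath m h γ).1 t = γ.1 t * m.1 t := rfl

/-- Multiplication by a meridian interchanges the loops and the paths to `-1`. -/
def toLoop : PathTo (-1) ≃ₜ PathTo 1 := mulPath (meridian southPole) (by rw [neg_mul_neg, one_mul])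

instance : PathConnectedSpace (PathTo 1) := toLoop.surjective.pathConnectedSpace toLoop.continuous

theorem Hmap_homeomorph_surjective {X Y : Type} [TopologicalSpace X] [TopologicalSpace Y] (n : ℕ)
    (e : X ≃ₜ Y) : Function.Surjective (Hmap n (e : C(X, Y))) := fun y => by
  refine ⟨Hmap n (e.symm : C(Y, X)) y, ?_⟩
  have h : (e : C(X, Y)).comp (e.symm : C(Y, X)) = ContinuousMap.id Y := by
    ext1 y
    exact e.apply_symm_apply y
  rw [← Hmap_comp_apply, h]
  exact Hmap_id n y

theorem exists_Hmap_clutching_of_ne_zero {n : ℕ} (hn : n ≠ 0) (c : H n (PathTo (-1))) :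
    ∃ w : H n (S3pm × PathTo 1), Hmap n clutching w = c ∧ Hmap n ContinuousMap.snd w = 0 :=
  have := H_subsingleton_of_contractible (X := BasedPath) hn
  exists_Hmap_clutching n c (Subsingleton.elim _ _)

theorem timesId_retract (n : ℕ) (w : H n (S3pm × PathTo 1)) :
    Hmap n (timesId (pureS3pm.comp toSphere) (PathTo 1)) (Hmap n (timesId imPart (PathTo 1)) w) =
      w := by
  rw [← Hmap_comp_apply]
  exact (LinearMap.congr_fun (Hmap_congr n (timesId_homotopic pureS3pm_retract)) w).trans
    (Hmap_id n w)

/-- In degree 1 the sphere factor contributes nothing, so an overlap class with zero projection to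
the loops is zero. Thus H₁ of the paths to −1 vanishes, and `toLoop` carries this over to the loops.
-/
theorem subsingleton_H_one_pathTo : Subsingleton (H 1 (PathTo 1)) := by
  have h : ∀ c : H 1 (PathTo (-1)), c = 0 := fun c => by
    obtain ⟨w, h1, h2⟩ := exists_Hmap_clutching_of_ne_zero one_ne_zero c
    obtain ⟨b, hb⟩ := Punct.H_one_prod (ofSphere southPole) (Hmap 1 (timesId imPart (PathTo 1)) w)
    have h3 := congrArg (Hmap 1 ContinuousMap.snd) hb
    rw [Hmap_snd_timesId, h2, Hmap_snd_sliceR] at h3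
    rw [← h1, ← timesId_retract 1 w, hb, ← h3, map_zero, map_zero, map_zero]
  refine subsingleton_of_forall_eq 0 fun c => ?_
  obtain ⟨c, rfl⟩ := Hmap_homeomorph_surjective 1 toLoop c
  rw [h c, map_zero]

/-- The overlap class splits into a slice part and a loop part. Projection to the loops kills the
first and is zero on the sum, so the loop part vanishes and only the sphere over the constant loop
remains. -/
theorem meridian_surjective : Function.Surjective (Hmap 2 meridian) := by
  have := subsingleton_H_one_pathTo
  intro c
  obtain ⟨w, h1, h2⟩ := exists_Hmap_clutching_of_ne_zero two_ne_zero c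
  obtain ⟨a, b, hab⟩ := Punct.H_two_prod constLoop (ofSphere southPole)
    (Hmap 2 (timesId imPart (PathTo 1)) w)
  have h3 := congrArg (Hmap 2 ContinuousMap.snd) hab
  rw [map_add, Hmap_snd_timesId, h2, Hmap_snd_sliceR, Hmap_snd_sliceL two_ne_zero, zero_add] at h3
  rw [← h3, map_zero, add_zero] at hab
  refine ⟨Hmap 2 toSphere a, ?_⟩
  rw [← Hmap_congr 2 clutching_homotopic_meridian, ← h1, ← timesId_retract 2 w, hab,
    Hmap_timesId_sliceL, Hmap_comp_apply, Hmap_comp_apply, Hmap_comp_apply]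

end SingularChains

end

noncomputable section

/-! ### Rigid fiberings are the same as based loops of rotations. -/

namespace RigidFiberings

theorem actSphere_mul (A B : O3) (y : S2) : actSphere (A * B) y = actSphere A (actSphere B y) := by
  apply Subtype.ext
  simp [actSphere, Matrix.mulVec_mulVec]

theorem actSphere_injective {A B : O3} (h : ∀ y, actSphere A y = actSphere B y) : A = B := by
  apply Subtype.ext
  ext i j
  have h1 := congrArg (fun y : S2 => y.1 i) (h ⟨EuclideanSpace.single j 1, by simp⟩)
  simpa [actSphere] using h1

theorem toO3_mul (A B : SO3) : (A * B).toO3 = A.toO3 * B.toO3 := rfl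

theorem toO3_one : (1 : SO3).toO3 = 1 := rfl

theorem toO3_inv (A : SO3) : A⁻¹.toO3 = A.toO3⁻¹ := by
  rw [eq_inv_iff_mul_eq_one, ← toO3_mul, inv_mul_cancel, toO3_one]

theorem conj_mul_mul {G : Type} [Group G] (b x y : G) :
    b * (x * y⁻¹) * b⁻¹ * (b * y) = b * x := by group

/-- A fibre meets each level of the circle factor once, and its point over 1 is its label `y`
because loops are based; so the fibres determine the loop pointwise. -/
theorem Phi_injective : Function.Injective Phi := by
  intro γ δ h
  have h1 : loopDecomposition γ = loopDecomposition δ := congrArg Subtype.val h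
  apply Subtype.ext
  ext1 t
  have key : (γ.1 t).toO3 = (δ.1 t).toO3 := by
    refine actSphere_injective fun y => ?_
    have h2 : (Set.range fun t : Circle => (t, actSphere (γ.1 t).toO3 y)) ∈ loopDecomposition δ :=
      h1 ▸ ⟨y, rfl⟩
    obtain ⟨y', hy'⟩ := h2
    have h3 : ∀ t, actSphere (γ.1 t).toO3 y = actSphere (δ.1 t).toO3 y' := fun t => by
      obtain ⟨t', ht'⟩ := hy' ▸ Set.mem_range_self (f := fun t : Circle =>
        (t, actSphere (γ.1 t).toO3 y)) t
      obtain rfl : t' = t := congrArg Prod.fst ht'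
      exact (congrArg Prod.snd ht').symm
    have h4 := h3 1
    rw [γ.2, δ.2, toO3_one, actSphere_one, actSphere_one] at h4
    rw [h3 t, h4]
  exact Subtype.ext (congrArg (fun A : O3 => A.1) key)

theorem actCircle_symm (α : O2) (x : Circle) : actCircle α (actCircle α.symm x) = x :=
  Circle.ext (α.apply_symm_apply x)

theorem actCircle_symm' (α : O2) (x : Circle) : actCircle α.symm (actCircle α x) = x :=
  Circle.ext (α.symm_apply_apply x)

theorem continuous_actCircle (α : O2) : Continuous (actCircle α) :=
  Continuous.subtype_mk (α.continuous.comp continuous_subtype_val) _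

/-- The conjugate of a rotation by an orthogonal matrix. -/
def conjSO3 (β : O3) (A : SO3) : SO3 :=
  ⟨(β * A.toO3 * β⁻¹).1, (β * A.toO3 * β⁻¹).2, by
    have h1 : A.1.det = 1 := A.2.2
    have h2 := congrArg Matrix.det (congrArg Subtype.val (mul_inv_cancel β))
    change (β.1 * A.1 * (β⁻¹).1).det = 1
    rw [Matrix.det_mul, Matrix.det_mul, h1, mul_one, ← Matrix.det_mul]
    exact h2.trans Matrix.det_one⟩

theorem continuous_conjSO3 (β : O3) : Continuous (conjSO3 β) := by
  refine Continuous.subtype_mk ?_ _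
  change Continuous fun A : SO3 => β.1 * A.1 * (β⁻¹).1
  fun_prop

/-- The loop whose fibering is the image of the trivial one under a rigid map. -/
def rigidLoop (α : O2) (β : O3) (γ : LoopSO3) : LoopSO3 :=
  ⟨⟨fun t => conjSO3 β (γ.1 (actCircle α.symm t) * (γ.1 (actCircle α.symm 1))⁻¹),
    (continuous_conjSO3 β).comp (by
      have := continuous_actCircle α.symm
      fun_prop)⟩, by
    apply Subtype.ext
    change (β * SO3.toO3 (γ.1 (actCircle α.symm 1) * (γ.1 (actCircle α.symm 1))⁻¹) * β⁻¹).1 = 1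
    rw [mul_inv_cancel, toO3_one, mul_one, mul_inv_cancel]
    rfl⟩

theorem map_rigidMap (α : O2) (β : O3) (γ : LoopSO3) :
    trivialDecomposition.map (rigidMap α β γ) = loopDecomposition (rigidLoop α β γ) := by
  -- `rigidLoop` is normalised to be the identity at the base point, so the image of the fibre over
  -- `y` is relabelled by its point `B y` over 1.
  set B : O3 := β * (γ.1 (actCircle α.symm 1)).toO3
  have key : ∀ y : S2, rigidMap α β γ '' {q | q.2 = y} =
      Set.range fun t : Circle => (t, actSphere ((rigidLoop α β γ).1 t).toO3 (actSphere B y)) := by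
    intro y
    have h1 : ∀ t, actSphere ((rigidLoop α β γ).1 t).toO3 (actSphere B y) =
        actSphere β (actSphere (γ.1 (actCircle α.symm t)).toO3 y) := fun t => by
      rw [← actSphere_mul, ← actSphere_mul]
      rw [show ((rigidLoop α β γ).1 t).toO3 = β * SO3.toO3 (γ.1 (actCircle α.symm t) *
        (γ.1 (actCircle α.symm 1))⁻¹) * β⁻¹ from rfl, toO3_mul, toO3_inv, conj_mul_mul]
    ext q
    constructor
    · rintro ⟨⟨x, y'⟩, rfl, rfl⟩
      refine ⟨actCircle α x, ?_⟩
      simp only [h1, actCircle_symm']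
      rfl
    · rintro ⟨t, rfl⟩
      refine ⟨(actCircle α.symm t, y), rfl, ?_⟩
      simp only [h1, rigidMap, actCircle_symm]
  ext C
  constructor
  · rintro ⟨_, ⟨y, rfl⟩, rfl⟩
    exact ⟨_, key y⟩
  · rintro ⟨y, rfl⟩
    refine ⟨_, ⟨actSphere B⁻¹ y, rfl⟩, ?_⟩
    rw [key, ← actSphere_mul, mul_inv_cancel, actSphere_one]

theorem Phi_surjective : Function.Surjective Phi := by
  rintro ⟨F, α, β, γ, rfl⟩
  exact ⟨rigidLoop α β γ, Subtype.ext (map_rigidMap α β γ).symm⟩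

/-- The identification of the loops of rotations with the rigid fiberings. -/
def phiHomeo : LoopSO3 ≃ₜ SFrigid where
  toEquiv := Equiv.ofBijective Phi ⟨Phi_injective, Phi_surjective⟩
  continuous_toFun := continuous_coinduced_rng
  continuous_invFun := continuous_coinduced_dom.2 (continuous_id.congr fun γ =>
    ((Equiv.ofBijective Phi ⟨Phi_injective, Phi_surjective⟩).symm_apply_apply γ).symm)

end RigidFiberings

end

noncomputable section

namespace SingularChains

open Topology unitInterval
open scoped Quaternion

/-! ### The double covering of the rotation group -/

/-- The matrix of the conjugation by a quaternion (scaled by the square of its norm). -/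
def quatMatrix (q : Quaternion ℝ) : Matrix (Fin 3) (Fin 3) ℝ :=
  !![q.re ^ 2 + q.imI ^ 2 - q.imJ ^ 2 - q.imK ^ 2, 2 * (q.imI * q.imJ - q.re * q.imK),
      2 * (q.imI * q.imK + q.re * q.imJ);
    2 * (q.imI * q.imJ + q.re * q.imK), q.re ^ 2 - q.imI ^ 2 + q.imJ ^ 2 - q.imK ^ 2,
      2 * (q.imJ * q.imK - q.re * q.imI);
    2 * (q.imI * q.imK - q.re * q.imJ), 2 * (q.imJ * q.imK + q.re * q.imI),
      q.re ^ 2 - q.imI ^ 2 - q.imJ ^ 2 + q.imK ^ 2]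

theorem quatMatrix_mul (p q : Quaternion ℝ) : quatMatrix (p * q) = quatMatrix p * quatMatrix q := by
  ext i j
  fin_cases i <;> fin_cases j <;>
    simp [quatMatrix, Matrix.mul_apply, Fin.sum_univ_three] <;> ring

theorem quatMatrix_one : quatMatrix 1 = 1 := by
  ext i j
  fin_cases i <;> fin_cases j <;> simp [quatMatrix]

theorem continuous_quatMatrix : Continuous quatMatrix := by
  have h0 := Quaternion.continuous_re
  have h1 := Quaternion.continuous_imI
  have h2 := Quaternion.continuous_imJ
  have h3 := Quaternion.continuous_imK
  refine continuous_matrix fun i j => ?_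
  fin_cases i <;> fin_cases j <;> simp [quatMatrix] <;> fun_prop

theorem S3.sum_sq (y : S3) : y.1.re ^ 2 + y.1.imI ^ 2 + y.1.imJ ^ 2 + y.1.imK ^ 2 = 1 :=
  norm_quat_eq_one_iff.1 y.norm_coe

theorem quatMatrix_mem (y : S3) : quatMatrix y.1 ∈ Matrix.specialOrthogonalGroup (Fin 3) ℝ := by
  have h := y.sum_sq
  rw [Matrix.mem_specialOrthogonalGroup_iff, Matrix.mem_orthogonalGroup_iff]
  constructor
  · ext i j
    fin_cases i <;> fin_cases j <;>
      simp [quatMatrix, Matrix.mul_apply, Fin.sum_univ_three] <;> grind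
  · rw [Matrix.det_fin_three]
    simp [quatMatrix]
    -- The determinant is the cube of the squared norm N, and N³ − 1 = (N² + N + 1)(N − 1).
    linear_combination ((y.1.re ^ 2 + y.1.imI ^ 2 + y.1.imJ ^ 2 + y.1.imK ^ 2) ^ 2 +
      (y.1.re ^ 2 + y.1.imI ^ 2 + y.1.imJ ^ 2 + y.1.imK ^ 2) + 1) * h

/-- The homomorphism from the unit quaternions to the rotations. -/
def toRotation : S3 →* SO3 where
  toFun y := ⟨quatMatrix y.1, quatMatrix_mem y⟩
  map_one' := Subtype.ext quatMatrix_one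
  map_mul' p q := Subtype.ext (quatMatrix_mul p.1 q.1)

@[fun_prop]
theorem continuous_toRotation : Continuous toRotation :=
  Continuous.subtype_mk (continuous_quatMatrix.comp continuous_subtype_val) _

theorem quatMatrix_mkQuat {x y z c s : ℝ} (hp : x ^ 2 + y ^ 2 + z ^ 2 = 1)
    (h : s ^ 2 + c ^ 2 = 1) {C S : ℝ} (hC : C = 2 * c ^ 2 - 1) (hS : S = 2 * s * c) :
    quatMatrix (mkQuat c (s * x) (s * y) (s * z)) =
    !![C + (1 - C) * (x * x), -(S * z) + (1 - C) * (x * y), S * y + (1 - C) * (x * z);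
      S * z + (1 - C) * (y * x), C + (1 - C) * (y * y), -(S * x) + (1 - C) * (y * z);
      -(S * y) + (1 - C) * (z * x), S * x + (1 - C) * (z * y), C + (1 - C) * (z * z)] := by
  subst hC hS
  ext i j
  fin_cases i <;> fin_cases j <;> simp [quatMatrix] <;> grind

theorem toRotation_rotor (p : S2) (θ : ℝ) :
    (toRotation (rotor p θ)).1 = rotationMatrix p (Real.cos (2 * θ)) (Real.sin (2 * θ)) := by
  rw [rotationMatrix_eq]
  exact quatMatrix_mkQuat (S2.sum_sq p) (Real.sin_sq_add_cos_sq θ) (Real.cos_two_mul θ)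
    (Real.sin_two_mul θ)

theorem toRotation_eq_one_iff (y : S3) : toRotation y = 1 ↔ y = 1 ∨ y = -1 := by
  constructor
  · intro h
    have h1 : quatMatrix y.1 = 1 := congrArg Subtype.val h
    have h2 := y.sum_sq
    have e : ∀ i j, quatMatrix y.1 i j = (1 : Matrix (Fin 3) (Fin 3) ℝ) i j := fun i j => by rw [h1]
    have e00 := e 0 0
    have e11 := e 1 1
    have e22 := e 2 2
    simp [quatMatrix] at e00 e11 e22
    have hI : y.1.imI = 0 := by nlinarith
    have hJ : y.1.imJ = 0 := by nlinarith
    have hK : y.1.imK = 0 := by nlinarith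
    have h5 : (y.1.re - 1) * (y.1.re + 1) = 0 := by rw [hI, hJ, hK] at h2; linear_combination h2
    rcases mul_eq_zero.1 h5 with h5 | h5
    · exact Or.inl (Subtype.ext (Quaternion.ext _ _ (sub_eq_zero.1 h5) hI hJ hK))
    · refine Or.inr (Subtype.ext (Quaternion.ext _ _ ((eq_neg_of_add_eq_zero_left h5).trans ?_)
        (hI.trans ?_) (hJ.trans ?_) (hK.trans ?_)))
      all_goals simp
  · rintro (rfl | rfl)
    · exact map_one _
    · apply Subtype.ext
      ext i j
      fin_cases i <;> fin_cases j <;> simp [toRotation, quatMatrix]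

theorem exists_polar (a b : ℝ) : ∃ r θ : ℝ, a = r * Real.cos θ ∧ b = r * Real.sin θ ∧
    r ^ 2 = a ^ 2 + b ^ 2 := by
  refine ⟨‖(⟨a, b⟩ : ℂ)‖, Complex.arg ⟨a, b⟩, (Complex.norm_mul_cos_arg ⟨a, b⟩).symm,
    (Complex.norm_mul_sin_arg ⟨a, b⟩).symm, ?_⟩
  rw [Complex.sq_norm, Complex.normSq_mk]
  ring

theorem exists_angle {a b : ℝ} (h : a ^ 2 + b ^ 2 = 1) :
    ∃ θ : ℝ, a = Real.cos θ ∧ b = Real.sin θ := by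
  refine ⟨Complex.arg ⟨a, b⟩, ?_⟩
  have hn : ‖(⟨a, b⟩ : ℂ)‖ = 1 := by
    rw [← sq_eq_sq₀ (norm_nonneg _) zero_le_one, Complex.sq_norm, Complex.normSq_mk]
    linarith
  have h1 := Complex.norm_mul_cos_arg ⟨a, b⟩
  have h2 := Complex.norm_mul_sin_arg ⟨a, b⟩
  rw [hn, one_mul] at h1 h2
  exact ⟨h1.symm, h2.symm⟩

/-- The points of the sphere on the coordinate axes. -/
def axis (i : Fin 3) : S2 := ⟨EuclideanSpace.single i 1, by simp⟩

/-- Orthogonality also clears the third row, which leaves a planar rotation block; its angle is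
halved for the rotor. -/
theorem eq_rotation_of_fix {B : SO3} (h : ∀ i, B.1 i 2 = if i = 2 then 1 else 0) :
    ∃ θ, B = toRotation (rotor (axis 2) θ) := by
  have h02 : B.1 0 2 = 0 := h 0
  have h12 : B.1 1 2 = 0 := h 1
  have h22 : B.1 2 2 = 1 := h 2
  have hr := (Matrix.mem_orthogonalGroup_iff (Fin 3) ℝ).1 B.2.1
  have hc := (Matrix.mem_orthogonalGroup_iff' (Fin 3) ℝ).1 B.2.1
  have hd : B.1.det = 1 := B.2.2
  have r22 := congrFun (congrFun hr 2) 2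
  have c00 := congrFun (congrFun hc 0) 0
  have c11 := congrFun (congrFun hc 1) 1
  have c01 := congrFun (congrFun hc 0) 1
  simp [Matrix.mul_apply, Fin.sum_univ_three, h22] at r22
  have h20 : B.1 2 0 = 0 := by nlinarith
  have h21 : B.1 2 1 = 0 := by nlinarith
  simp [Matrix.mul_apply, Fin.sum_univ_three, h20, h21] at c00 c11 c01
  rw [Matrix.det_fin_three, h02, h12, h22, h20, h21] at hd
  have h11 : B.1 1 1 = B.1 0 0 := by
    linear_combination (B.1 0 0) * hd - B.1 1 1 * c00 + B.1 1 0 * c01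
  have h01 : B.1 0 1 = - B.1 1 0 := by
    linear_combination (-B.1 1 0) * hd - B.1 0 1 * c00 + B.1 0 0 * c01
  obtain ⟨θ, hθ1, hθ2⟩ := exists_angle (a := B.1 0 0) (b := B.1 1 0) (by linear_combination c00)
  refine ⟨θ / 2, Subtype.ext ?_⟩
  rw [toRotation_rotor, rotationMatrix_eq, mul_div_cancel₀ _ two_ne_zero, ← hθ1, ← hθ2]
  ext i j
  fin_cases i <;> fin_cases j <;> simp [axis, h02, h12, h22, h20, h21, h11, h01]

/-- Euler angles: `Q` is built from spherical coordinates of the third column of `A`, so `Q⁻¹ * A`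
fixes the third axis. -/
theorem toRotation_surjective : Function.Surjective toRotation := by
  intro A
  have hc := (Matrix.mem_orthogonalGroup_iff' (Fin 3) ℝ).1 A.2.1
  have c22 := congrFun (congrFun hc 2) 2
  simp [Matrix.mul_apply, Fin.sum_univ_three] at c22
  obtain ⟨r, ψ, hx, hy, hr⟩ := exists_polar (A.1 0 2) (A.1 1 2)
  obtain ⟨φ, hz, hr'⟩ := exists_angle (a := A.1 2 2) (b := r) (by rw [hr]; linear_combination c22)
  set Q := toRotation (rotor (axis 2) (ψ / 2) * rotor (axis 1) (φ / 2)) with hQ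
  have hQv : ∀ i, Q.1 i 2 = A.1 i 2 := by
    intro i
    have : Q.1 = _ * _ := congrArg Subtype.val (map_mul toRotation _ _)
    rw [toRotation_rotor, toRotation_rotor, rotationMatrix_eq, rotationMatrix_eq,
      mul_div_cancel₀ _ two_ne_zero, mul_div_cancel₀ _ two_ne_zero] at this
    rw [this]
    fin_cases i <;> simp [axis, Matrix.mul_apply, Fin.sum_univ_three, hx, hy, hz, hr'] <;> ring
  obtain ⟨θ, hθ⟩ := eq_rotation_of_fix (B := Q⁻¹ * A) (fun i => by
    have hq := (Matrix.mem_orthogonalGroup_iff' (Fin 3) ℝ).1 Q.2.1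
    have h1 : (Q⁻¹ * A).1 i 2 = (Q⁻¹ * Q).1 i 2 := by
      change ∑ j, (Q⁻¹).1 i j * A.1 j 2 = ∑ j, (Q⁻¹).1 i j * Q.1 j 2
      simp only [hQv]
    rw [h1, inv_mul_cancel]
    exact Matrix.one_apply)
  exact ⟨rotor (axis 2) (ψ / 2) * rotor (axis 1) (φ / 2) * rotor (axis 2) θ,
    (map_mul toRotation _ _).trans (by rw [← hθ, ← hQ, mul_inv_cancel_left])⟩

instance : CompactSpace S3 := Metric.sphere.compactSpace _ _

/-- A continuous surjection from a compact space to a Hausdorff one is a quotient map, and a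
quotient homomorphism with finite, hence discrete, kernel is a covering. -/
theorem isCoveringMap_toRotation : IsCoveringMap toRotation := by
  have hq : IsQuotientMap toRotation :=
    continuous_toRotation.isClosedMap.isQuotientMap continuous_toRotation toRotation_surjective
  refine (hq.isQuotientCoveringMap_of_isDiscrete_ker_monoidHom ?_).isCoveringMap
  have h : (toRotation.ker : Set S3) = {1, -1} := by
    ext y
    exact toRotation_eq_one_iff y
  rw [h]
  exact (Set.toFinite _).isDiscrete

end SingularChains

end

noncomputable section

namespace SingularChains

open Topology unitInterval

/-! ### Loops of rotations and paths of unit quaternions -/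

/-- The standard parametrisation of the circle by the unit interval. -/
def circleParam : C(I, Circle) := ⟨fun t => Circle.exp (2 * Real.pi * t), by fun_prop⟩

theorem circleParam_apply (t : I) : circleParam t = Circle.exp (2 * Real.pi * t) := rfl

theorem circleParam_zero : circleParam 0 = 1 := by simp [circleParam_apply]

theorem circleParam_one : circleParam 1 = 1 := by simp [circleParam_apply]

theorem circleParam_surjective : Function.Surjective circleParam := by
  intro z
  have hp := Real.pi_pos
  have h1 := Complex.neg_pi_lt_arg (z : ℂ)
  have h2 := Complex.arg_le_pi (z : ℂ)
  rcases le_total 0 (Complex.arg (z : ℂ)) with h | h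
  · refine ⟨⟨Complex.arg z / (2 * Real.pi), by positivity, ?_⟩, ?_⟩
    · rw [div_le_one (by positivity)]; linarith
    · rw [circleParam_apply, mul_div_cancel₀ _ (by positivity), Circle.exp_arg]
  · refine ⟨⟨(Complex.arg z + 2 * Real.pi) / (2 * Real.pi), div_nonneg (by linarith)
      (by positivity), ?_⟩, ?_⟩
    · rw [div_le_one (by positivity)]; linarith
    · rw [circleParam_apply, mul_div_cancel₀ _ (by positivity), Circle.exp_add,
        Circle.exp_two_pi, mul_one, Circle.exp_arg]

theorem eq_or_of_circleParam_eq {s t : I} (h : circleParam s = circleParam t) :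
    s = t ∨ (s = 0 ∨ s = 1) ∧ (t = 0 ∨ t = 1) := by
  obtain ⟨m, hm⟩ := Circle.exp_eq_exp.1 h
  have hp := Real.pi_pos
  have h1 : (s : ℝ) = t + m := by
    have : 2 * Real.pi * ((s : ℝ) - t - m) = 0 := by linear_combination hm
    rcases mul_eq_zero.1 this with h | h
    · linarith
    · linarith
  have hs0 := s.2.1
  have hs1 := s.2.2
  have ht0 := t.2.1
  have ht1 := t.2.2
  have hm1 : -1 ≤ m := by
    have : (-1 : ℝ) ≤ m := by linarith
    exact_mod_cast this
  have hm2 : m ≤ 1 := by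
    have : (m : ℝ) ≤ 1 := by linarith
    exact_mod_cast this
  interval_cases m
  · push_cast at h1
    exact Or.inr ⟨Or.inl (Subtype.ext (by change (s : ℝ) = 0; linarith)),
      Or.inr (Subtype.ext (by change (t : ℝ) = 1; linarith))⟩
  · push_cast at h1
    exact Or.inl (Subtype.ext (by linarith))
  · push_cast at h1
    exact Or.inr ⟨Or.inr (Subtype.ext (by change (s : ℝ) = 1; linarith)),
      Or.inl (Subtype.ext (by change (t : ℝ) = 0; linarith))⟩

/-- A product of a quotient map with an arbitrary space need not be a quotient map; properness of
`circleParam` makes this one closed. -/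
theorem isQuotientMap_prod_circleParam (Z : Type) [TopologicalSpace Z] :
    IsQuotientMap (Prod.map id circleParam : Z × I → Z × Circle) := by
  have h : IsProperMap (Prod.map id circleParam : Z × I → Z × Circle) :=
    isProperMap_id.prodMap circleParam.continuous.isProperMap
  exact h.isClosedMap.isQuotientMap h.continuous
    (Function.surjective_id.prodMap circleParam_surjective)

/-- The inverse of the parametrisation of the circle. -/
def circleTime (z : Circle) : I := Function.surjInv circleParam_surjective z

theorem toRotation_circleTime {a : S3} (ha : toRotation a = 1) (γ : PathTo a) (t : I) :
    toRotation (γ.1 (circleTime (circleParam t))) = toRotation (γ.1 t) := by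
  have h0 : toRotation (γ.1 0) = 1 := by rw [γ.2.1, map_one]
  have h1 : toRotation (γ.1 1) = 1 := by rw [γ.2.2, ha]
  rcases eq_or_of_circleParam_eq
    (Function.surjInv_eq circleParam_surjective (circleParam t)) with h | ⟨h | h, h' | h'⟩
  · exact congrArg (fun t => toRotation (γ.1 t)) h
  all_goals
    rw [circleTime, h]
    simp only [h', h0, h1]

/-- The loops of rotations of paths of unit quaternions, as one map. -/
def rotationLoopAux {a : S3} (ha : toRotation a = 1) : C(PathTo a × Circle, SO3) :=
  ⟨fun p => toRotation (p.1.1 (circleTime p.2)), by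
    rw [(isQuotientMap_prod_circleParam (PathTo a)).continuous_iff]
    have h : Continuous fun p : PathTo a × I => toRotation (p.1.1 p.2) := by fun_prop
    exact h.congr fun p => (toRotation_circleTime ha p.1 p.2).symm⟩

theorem rotationLoopAux_one {a : S3} (ha : toRotation a = 1) (γ : PathTo a) :
    (rotationLoopAux ha).curry γ 1 = 1 := by
  change toRotation (γ.1 (circleTime 1)) = 1
  rw [← circleParam_zero, toRotation_circleTime ha, γ.2.1, map_one]

/-- The loop of rotations of a path of unit quaternions. -/
def rotationLoop {a : S3} (ha : toRotation a = 1) : C(PathTo a, LoopSO3) :=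
  ⟨fun γ => ⟨(rotationLoopAux ha).curry γ, rotationLoopAux_one ha γ⟩,
    (rotationLoopAux ha).curry.continuous.subtype_mk _⟩

theorem rotationLoop_apply {a : S3} (ha : toRotation a = 1) (γ : PathTo a) (t : I) :
    (rotationLoop ha γ).1 (circleParam t) = toRotation (γ.1 t) :=
  toRotation_circleTime ha γ t

theorem LoopSO3.ext_param {γ δ : LoopSO3} (h : ∀ t, γ.1 (circleParam t) = δ.1 (circleParam t)) :
    γ = δ := by
  apply Subtype.ext
  ext1 z
  obtain ⟨t, rfl⟩ := circleParam_surjective z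
  exact h t

/-- The evaluation of a loop of rotations. -/
def loopEval : C(I × LoopSO3, SO3) := ⟨fun p => p.2.1 (circleParam p.1), by fun_prop⟩

theorem loopEval_zero (γ : LoopSO3) :
    loopEval (0, γ) = toRotation (ContinuousMap.const LoopSO3 (1 : S3) γ) := by
  change γ.1 (circleParam 0) = toRotation 1
  rw [circleParam_zero, γ.2, map_one]

/-- The lift of a loop of rotations to the unit quaternions. -/
def loopLift : C(LoopSO3, BasedPath) :=
  basedFamily (fun p => isCoveringMap_toRotation.liftHomotopy loopEval
      (ContinuousMap.const LoopSO3 1) loopEval_zero (p.2, p.1)) (by fun_prop)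
    (isCoveringMap_toRotation.liftHomotopy_zero loopEval (ContinuousMap.const LoopSO3 1)
      loopEval_zero)

theorem toRotation_loopLift (γ : LoopSO3) (t : I) :
    toRotation ((loopLift γ).1 t) = γ.1 (circleParam t) :=
  congrFun (isCoveringMap_toRotation.liftHomotopy_lifts loopEval (ContinuousMap.const LoopSO3 1)
      loopEval_zero) (t, γ)

/-- Both paths lift the same loop and start at 1, so uniqueness of lifts applies. -/
theorem loopLift_rotationLoop {a : S3} (ha : toRotation a = 1) (γ : PathTo a) :
    loopLift (rotationLoop ha γ) = ⟨γ.1, γ.2.1⟩ := by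
  apply Subtype.ext
  apply DFunLike.coe_injective
  refine isCoveringMap_toRotation.eq_of_comp_eq (ContinuousMap.continuous _)
    (ContinuousMap.continuous _) (funext fun t => ?_) 0 ?_
  · exact (toRotation_loopLift _ t).trans (rotationLoop_apply ha γ t)
  · exact (loopLift (rotationLoop ha γ)).2.trans γ.2.1.symm

/-- The paths of unit quaternions to a given point over the identity as loops of rotations. -/
def rotationLoopHomeo {a : S3} (ha : toRotation a = 1) :
    PathTo a ≃ₜ {γ : LoopSO3 // (loopLift γ).1 1 = a} where
  toFun γ := ⟨rotationLoop ha γ, by rw [loopLift_rotationLoop]; exact γ.2.2⟩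
  invFun γ := ⟨(loopLift γ.1).1, (loopLift γ.1).2, γ.2⟩
  left_inv γ := Subtype.ext
    (congrArg (fun δ : BasedPath => δ.1) (loopLift_rotationLoop ha γ))
  right_inv γ := Subtype.ext (LoopSO3.ext_param fun t =>
    (rotationLoop_apply ha _ t).trans (toRotation_loopLift γ.1 t))
  continuous_toFun := by fun_prop
  continuous_invFun := by fun_prop

/-! ### The two components of the space of rigid fiberings. -/

theorem toRotation_neg_one : toRotation (-1) = 1 := (toRotation_eq_one_iff _).2 (Or.inr rfl)

theorem loopLift_one (γ : LoopSO3) : (loopLift γ).1 1 = 1 ∨ (loopLift γ).1 1 = -1 :=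
  (toRotation_eq_one_iff _).1 (by rw [toRotation_loopLift, circleParam_one, γ.2])

theorem continuous_loopLift_one : Continuous fun γ : LoopSO3 => (loopLift γ).1 1 := by fun_prop

theorem isClopen_loopLift_one : IsClopen {γ : LoopSO3 | (loopLift γ).1 1 = 1} := by
  refine ⟨isClosed_singleton.preimage continuous_loopLift_one, ?_⟩
  have h : {γ : LoopSO3 | (loopLift γ).1 1 = 1} = {γ : LoopSO3 | (loopLift γ).1 1 = -1}ᶜ := by
    ext γ
    constructor
    · intro h h'
      exact neg_one_ne_one ((Eq.symm h').trans h)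
    · exact fun h => (loopLift_one γ).resolve_right h
  rw [h]
  exact (isClosed_singleton.preimage continuous_loopLift_one).isOpen_compl

theorem isConnected_loopLift_eq {a : S3} (ha : toRotation a = 1) [PathConnectedSpace (PathTo a)] :
    IsConnected {γ : LoopSO3 | (loopLift γ).1 1 = a} := by
  rw [isConnected_iff_connectedSpace]
  exact (rotationLoopHomeo ha).surjective.connectedSpace (rotationLoopHomeo ha).continuous

/-- The loops whose lift closes up form a clopen connected set containing the constant loop, so
their image is exactly the component of the trivial fibering. -/
theorem Phi_mem_SFrigidT (γ : LoopSO3) : Phi γ ∈ SFrigidT ↔ (loopLift γ).1 1 = 1 := by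
  have h0 : trivialFibering = Phi (rotationLoop (map_one toRotation) constLoop) := by
    refine Subtype.ext (trivialDecomposition_eq.trans (congrArg loopDecomposition ?_))
    exact LoopSO3.ext_param fun t =>
      ((rotationLoop_apply (map_one toRotation) constLoop t).trans (map_one _)).symm
  have hs : Phi '' {γ : LoopSO3 | (loopLift γ).1 1 = 1} = SFrigidT := by
    have hm : trivialFibering ∈ Phi '' {γ : LoopSO3 | (loopLift γ).1 1 = 1} :=
      ⟨_, (rotationLoopHomeo (map_one toRotation) constLoop).2, h0.symm⟩
    refine Set.Subset.antisymm ?_ ?_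
    · exact ((isConnected_loopLift_eq (map_one toRotation)).isPreconnected.image _
        phiHomeo.continuous.continuousOn).subset_connectedComponent hm
    · refine IsClopen.connectedComponent_subset ?_ hm
      exact ⟨phiHomeo.isClosedMap _ isClopen_loopLift_one.1,
        phiHomeo.isOpenMap _ isClopen_loopLift_one.2⟩
  rw [← hs, Phi_injective.mem_set_image]
  rfl

theorem Phi_mem_SFrigidN (γ : LoopSO3) : Phi γ ∈ SFrigidN ↔ (loopLift γ).1 1 = -1 := by
  rw [SFrigidN, Set.mem_compl_iff, Phi_mem_SFrigidT]
  constructor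
  · exact (loopLift_one γ).resolve_left
  · intro h h'
    exact neg_one_ne_one (h.symm.trans h')

/-- The loops of unit quaternions parametrise the component of the trivial fibering. -/
def homeoT : PathTo 1 ≃ₜ SFrigidT :=
  (rotationLoopHomeo (map_one toRotation)).trans
    (phiHomeo.subtype fun γ => (Phi_mem_SFrigidT γ).symm)

/-- The paths to `-1` parametrise the other fiberings. -/
def homeoN : PathTo (-1) ≃ₜ SFrigidN :=
  (rotationLoopHomeo toRotation_neg_one).trans
    (phiHomeo.subtype fun γ => (Phi_mem_SFrigidN γ).symm)

theorem isConnected_SFrigidN : IsConnected SFrigidN := by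
  rw [isConnected_iff_connectedSpace]
  exact homeoN.surjective.connectedSpace homeoN.continuous

/-! ### Gluck loops, meridians and the generators. -/

theorem gluckLoop_exp (p : S2) (θ : ℝ) :
    (gluckLoop p).1 (Circle.exp θ) = toRotation (rotor p (θ / 2)) := by
  apply Subtype.ext
  rw [toRotation_rotor, mul_div_cancel₀ _ two_ne_zero]
  change rotationMatrix p _ _ = _
  rw [Circle.coe_exp, Complex.exp_ofReal_mul_I_re, Complex.exp_ofReal_mul_I_im]

theorem rotationLoop_meridian (p : S2) :
    rotationLoop toRotation_neg_one (meridian p) = gluckLoop p := by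
  refine LoopSO3.ext_param fun t => ?_
  rw [rotationLoop_apply, circleParam_apply, gluckLoop_exp]
  change toRotation (rotor p (Real.pi * t)) = _
  congr 2
  ring

/-- The concatenation of the meridian through `p` with the one through the south pole. -/
def meridianConcat : C(S2, PathTo 1) :=
  pathFamily (fun z => rotor z.1 (Real.pi * min (2 * (z.2 : ℝ)) 1) *
    rotor southPole (Real.pi * max (2 * (z.2 : ℝ) - 1) 0)) (by fun_prop) (by simp)
    (fun z => by norm_num)

theorem rotationLoop_meridianConcat (p : S2) :
    rotationLoop (map_one toRotation) (meridianConcat p) =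
      (gluckLoop p).concat (gluckLoop southPole) := by
  refine LoopSO3.ext_param fun t => ?_
  have hp := Real.pi_pos
  have h0 := t.2.1
  have h1 := t.2.2
  have hsq : (circleParam t) ^ 2 = Circle.exp (2 * (2 * Real.pi * t)) := by
    rw [circleParam_apply, two_mul (2 * Real.pi * (t : ℝ)), Circle.exp_add, sq]
  have him : ((circleParam t : Circle) : ℂ).im = Real.sin (2 * Real.pi * t) := by
    rw [circleParam_apply, Circle.coe_exp, Complex.exp_ofReal_mul_I_im]
  rw [rotationLoop_apply]
  change toRotation (rotor p (Real.pi * min (2 * (t : ℝ)) 1) *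
    rotor southPole (Real.pi * max (2 * (t : ℝ) - 1) 0)) =
    if 0 ≤ ((circleParam t : Circle) : ℂ).im then (gluckLoop p).1 ((circleParam t) ^ 2)
      else (gluckLoop southPole).1 ((circleParam t) ^ 2)
  rw [him, hsq, gluckLoop_exp, gluckLoop_exp]
  rcases le_total (t : ℝ) (1 / 2) with h | h
  · rw [if_pos (Real.sin_nonneg_of_nonneg_of_le_pi (by positivity) (by nlinarith)),
      min_eq_left (by linarith), max_eq_right (by linarith), mul_zero, rotor_zero, mul_one]
    congr 2
    ring
  · rw [min_eq_right (by linarith), max_eq_left (by linarith), mul_one, rotor_pi, map_mul,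
      toRotation_neg_one, one_mul]
    -- The two angles differ by π, which only changes the sign of the rotor.
    have h2 : toRotation (rotor southPole (Real.pi * (2 * t - 1))) =
        toRotation (rotor southPole (2 * (2 * Real.pi * t) / 2)) := by
      rw [show 2 * (2 * Real.pi * (t : ℝ)) / 2 = Real.pi * (2 * t - 1) + Real.pi by ring, rotor_add,
        rotor_pi, map_mul, toRotation_neg_one, mul_one]
    split_ifs with hs
    · have ht : (t : ℝ) = 1 ∨ (t : ℝ) = 1 / 2 := by
        by_contra! hne
        have h3 : (t : ℝ) < 1 := lt_of_le_of_ne h1 hne.1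
        have h4 : 1 / 2 < (t : ℝ) := lt_of_le_of_ne h hne.2.symm
        have h5 : 0 < Real.sin (2 * Real.pi * t - Real.pi) :=
          Real.sin_pos_of_pos_of_lt_pi (by nlinarith) (by nlinarith)
        rw [Real.sin_sub_pi] at h5
        linarith
      have hpi : ∀ q : S2, toRotation (rotor q Real.pi) = 1 := fun q => by
        rw [rotor_pi, toRotation_neg_one]
      have h2pi : ∀ q : S2, toRotation (rotor q (2 * Real.pi)) = 1 := fun q => by
        rw [two_mul, rotor_add, map_mul, hpi, mul_one]
      rw [h2]
      rcases ht with ht | ht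
      · rw [ht, show 2 * (2 * Real.pi * (1 : ℝ)) / 2 = 2 * Real.pi by ring, h2pi, h2pi]
      · rw [ht, show 2 * (2 * Real.pi * (1 / 2 : ℝ)) / 2 = Real.pi by ring, hpi, hpi]
    · exact h2

/-- The usual comparison of pointwise product and concatenation: both are products of rotors, and
the two time parameters are interpolated linearly with fixed end values. -/
theorem meridianConcat_homotopic :
    ((toLoop : C(PathTo (-1), PathTo 1)).comp meridian).Homotopic meridianConcat := by
  refine ⟨⟨pathFamily (fun z : (I × S2) × I =>
      rotor z.1.2 (Real.pi * ((1 - (z.1.1 : ℝ)) * z.2 + z.1.1 * min (2 * (z.2 : ℝ)) 1)) *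
      rotor southPole (Real.pi * ((1 - (z.1.1 : ℝ)) * z.2 + z.1.1 * max (2 * (z.2 : ℝ) - 1) 0)))
      (by fun_prop) (fun z => by simp) (fun z => by norm_num), fun p => ?_, fun p => ?_⟩⟩
  · refine PathTo.ext fun t => ?_
    simp [toLoop, mulPath_apply, meridian]
  · refine PathTo.ext fun t => ?_
    simp [meridianConcat]

theorem meridianConcat_surjective : Function.Surjective (Hmap 2 meridianConcat) := by
  rw [← Hmap_congr 2 meridianConcat_homotopic]
  intro c
  obtain ⟨a, rfl⟩ := Hmap_homeomorph_surjective 2 toLoop c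
  obtain ⟨x, rfl⟩ := meridian_surjective a
  exact ⟨x, Hmap_comp_apply 2 _ _ x⟩

/-- A surjection from a cyclic group carries a generator to a generator. -/
theorem sphereGeneratesH2_of_surjective {X : Type} [TopologicalSpace X] {f : C(S2, X)}
    (hf : Function.Surjective (Hmap 2 f)) : SphereGeneratesH2 f := by
  obtain ⟨g, hg⟩ := H_two_sphere_cyclic
  refine ⟨g, ?_, ?_⟩
  · refine Submodule.eq_top_iff'.2 fun x => ?_
    obtain ⟨k, hk⟩ := hg x
    rw [hk]
    exact zsmul_mem (Submodule.mem_span_singleton_self g) k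
  · refine Submodule.eq_top_iff'.2 fun y => ?_
    obtain ⟨x, rfl⟩ := hf y
    obtain ⟨k, rfl⟩ := hg x
    rw [map_zsmul]
    exact zsmul_mem (Submodule.mem_span_singleton_self (H2map f g)) k

theorem sphereGeneratesH2_homeomorph {X Y : Type} [TopologicalSpace X] [TopologicalSpace Y]
    {f : C(S2, X)} (hf : Function.Surjective (Hmap 2 f)) (e : X ≃ₜ Y) :
    SphereGeneratesH2 ((e : C(X, Y)).comp f) := by
  refine sphereGeneratesH2_of_surjective fun y => ?_
  obtain ⟨x, rfl⟩ := Hmap_homeomorph_surjective 2 e y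
  obtain ⟨z, rfl⟩ := hf x
  exact ⟨z, Hmap_comp_apply 2 _ _ z⟩

end SingularChains

end

open SingularChains in
theorem theorem1p2 :
    (IsConnected SFrigidN) ∧
    (∃ f : C(S2, SFrigidT),
      (∀ p : S2, (f p : SFrigid) =
        Phi ((gluckLoop p).concat
          (gluckLoop southPole))) ∧
      SphereGeneratesH2 f) ∧
    (∃ g : C(S2, SFrigidN),
      (∀ p : S2, (g p : SFrigid) =
        Phi (gluckLoop p)) ∧
      SphereGeneratesH2 g) :=
  ⟨isConnected_SFrigidN,
    ⟨(homeoT : C(PathTo 1, SFrigidT)).comp meridianConcat,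
      fun p => congrArg Phi (rotationLoop_meridianConcat p),
      sphereGeneratesH2_homeomorph meridianConcat_surjective homeoT⟩,
    ⟨(homeoN : C(PathTo (-1), SFrigidN)).comp meridian,
      fun p => congrArg Phi (rotationLoop_meridian p),
      sphereGeneratesH2_homeomorph meridian_surjective homeoN⟩⟩
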